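/- Write points of $\mathbb R^n$ as $y=(y',t)$ with $y'\in\mathbb R^{n-1}$, and put $B'_r=\{|y'|<r\}$, $G_r=B'_r\times(0,r)$. Let $\underline m\le 0$ and $\overline m\ge 2$ be integers and $p=1-(\underline m+\overline m)$, $q=\underline m\,\overline m$. There are nonnegative integers $N_i$ ($i\ge\overline m$), depending only on $i,\underline m,\overline m$, with $N_{\overline m}=1$, such that the following holds. Let $\ell\ge k\ge\overline m$ be integers, $\alpha\in(0,1)$, $0<r<R$. Let $F$ be a real function of $y'\in B_R'$, $t\in[0,R)$ and of further real arguments standing for $$v_t,\ \frac vt,\ \frac{v^2}{t^3},\ \frac{vv_t}{t^2},\ \frac{v_t^2}{t},\ D_{y'}v_t,\ D^2_{y'}v,\ \frac{D_{y'}v}{t},\qquad(*)$$ and let $F$ be (locally) of class $C^{\ell-2,\alpha}$ in all its arguments; if $\overline m=2$, assume moreover that $F$ is smooth in all its arguments except $y'$, all its derivatives in these arguments being (locally) of class $C^{\ell-2,\alpha}$ in all arguments. Let $v\in C^1(\bar G_R)\cap C^{\ell,\alpha}(G_R)$ (the latter locally) solve $$v_{tt}+p\frac{v_t}{t}+q\frac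 v{t^2}+F=0\quad\text{in }G_R,$$ where $F$ is evaluated at $y'$, $t$ and the quantities $(*)$. Assume that, for every $\tau=0,1,\dots,\ell-1$, $$\frac{D^\tau_{y'}v}{t},\ D^\tau_{y'}Dv,\ \frac{D^\tau_{y'}(v^2)}{t^3},\ \frac{D^\tau_{y'}(vv_t)}{t^2},\ \frac{D^\tau_{y'}(v_t^2)}{t}\in C^\alpha(\bar G_r).$$ Then there are functions $c_i$ ($2\le i\le\overline m-1$) and $c_{i,j}$ ($\overline m\le i\le k$, $0\le j\le N_i$) on $B'_r$ and a function $w_k$ on $G_r$ such that, for all $(y',t)\in G_r$, $$v(y',t)=\sum_{i=2}^{\overline m-1}c_i(y')t^i+\sum_{i=\overline m}^k\sum_{j=0}^{N_i}c_{i,j}(y')t^i(\log t)^j+\int_0^t\int_0^{s_1}\cdots\int_0^{s_{k-1}}w_k(y',s_k)\,ds_k\cdots ds_1,$$ with the following properties (Hölder classes on $B'_r$ are with finite norm on $B_r'$): - $c_i\in C^{\ell-i,\alpha}(B'_r)$ for $2\le i\le\overline m-1$, and $c_{\overline m,1}\in C^{\ell-\overline m,\alpha}(B'_r)$; - $c_{\overline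 m,0}\in C^{\ell-\overline m,\epsilon}(B'_r)$, and $c_{i,j}\in C^{\ell-i,\epsilon}(B'_r)$ for $\overline m<i\le k$, $0\le j\le N_i$, for every $\epsilon\in(0,\alpha)$; - for every $\tau=0,\dots,\ell-k$, the derivatives $D^\tau_{y'}w_k$ exist, belong to $C^\epsilon(\bar G_r)$ for every $\epsilon\in(0,\alpha)$, and satisfy $|D^\tau_{y'}w_k|\le Ct^\alpha$ in $G_r$ for some constant $C$. -/

import Mathlib

open Set Metric
open scoped NNReal ContDiff

noncomputable section

namespace SingularExpansion

/-- The space `ℝ^{n-1}` of tangential variables `y'`, with `d = n - 1`. -/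
abbrev Tan (d : ℕ) : Type := EuclideanSpace ℝ (Fin d)

/-- The ball `B'_r` in the tangential variables. -/
def tanBall (d : ℕ) (r : ℝ) : Set (Tan d) := ball 0 r

/-- The cylinder `G_r = {(y', t) : |y'| < r, 0 < t < r}`. -/
def cyl (d : ℕ) (r : ℝ) : Set (Tan d × ℝ) := tanBall d r ×ˢ Ioo 0 r

section Holder

variable {X Y : Type*} [NormedAddCommGroup X] [NormedSpace ℝ X]
  [NormedAddCommGroup Y] [NormedSpace ℝ Y]

/-- `f ∈ C^{a}` up to the boundary of a bounded set `U`: `f` is uniformly Hölder continuous on `U`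
(equivalently, it extends to a Hölder continuous function on the closure of `U`). -/
def IsHolder (a : ℝ≥0) (f : X → Y) (U : Set X) : Prop :=
  ∃ C : ℝ≥0, HolderOnWith C a f U

/-- `f ∈ C^{m,a}` on a bounded convex set `U` with finite norm: `f` is `C^m` in `U` and its
derivative of order `m` is uniformly Hölder continuous with exponent `a` on `U`. -/
def IsCHolder (m : ℕ) (a : ℝ≥0) (f : X → Y) (U : Set X) : Prop :=
  ContDiffOn ℝ m f U ∧ IsHolder a (iteratedFDerivWithin ℝ m f U) U

/-- `f ∈ C^{m,a}` locally in `U`: `f` is `C^m` in `U` and its derivative of order `m` is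
Hölder continuous with exponent `a` on every compact subset of `U`. -/
def IsLocCHolder (m : ℕ) (a : ℝ≥0) (f : X → Y) (U : Set X) : Prop :=
  ContDiffOn ℝ m f U ∧
    ∀ K : Set X, K ⊆ U → IsCompact K → IsHolder a (iteratedFDerivWithin ℝ m f U) K

end Holder

section Derivatives

variable {d : ℕ} {Y : Type*} [NormedAddCommGroup Y] [NormedSpace ℝ Y]

/-- The normal derivative `f_t`. -/
def dt (f : Tan d × ℝ → ℝ) (x : Tan d × ℝ) : ℝ := deriv (fun s => f (x.1, s)) x.2

/-- The tangential partial derivative `∂f/∂y'_a`. -/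
def dTan (a : Fin d) (f : Tan d × ℝ → ℝ) (x : Tan d × ℝ) : ℝ :=
  fderiv ℝ (fun z => f (z, x.2)) x.1 (EuclideanSpace.single a 1)

/-- The collection `D_{y'}^τ f` of all tangential derivatives of order `τ`. -/
def dTanIter (τ : ℕ) (f : Tan d × ℝ → Y) (x : Tan d × ℝ) :
    ContinuousMultilinearMap ℝ (fun _ : Fin τ => Tan d) Y :=
  iteratedFDeriv ℝ τ (fun z => f (z, x.2)) x.1

end Derivatives

/-- The space of values of
`(v_t, v/t, v²/t³, v v_t/t², v_t²/t, D_{y'}v_t, D²_{y'}v, D_{y'}v/t)`. -/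
abbrev Jet (d : ℕ) : Type :=
  (Fin 5 → ℝ) × (Fin d → ℝ) × (Fin d → Fin d → ℝ) × (Fin d → ℝ)

/-- The quantities
`(v_t, v/t, v²/t³, v v_t/t², v_t²/t, D_{y'}v_t, D²_{y'}v, D_{y'}v/t)` at the point `x = (y', t)`. -/
def jet {d : ℕ} (v : Tan d × ℝ → ℝ) (x : Tan d × ℝ) : Jet d :=
  (![dt v x, v x / x.2, v x ^ 2 / x.2 ^ 3, v x * dt v x / x.2 ^ 2, dt v x ^ 2 / x.2],
    fun a => dTan a (dt v) x, fun a b => dTan a (dTan b v) x, fun a => dTan a v x / x.2)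

/-- `v_tt + p v_t/t + q v/t² + F = 0` in `G_R`, where `F` is a function of `y'`, `t` and of
the quantities in `jet v`. -/
def IsSolution {d : ℕ} (p q : ℝ) (F : Tan d × ℝ × Jet d → ℝ) (R : ℝ) (v : Tan d × ℝ → ℝ) : Prop :=
  ∀ x ∈ cyl d R,
    dt (dt v) x + p * (dt v x / x.2) + q * (v x / x.2 ^ 2) + F (x.1, x.2, jet v x) = 0

/-- The set `B'_R × [0, R) × Jet` of arguments of `F`. -/
def argSet (d : ℕ) (R : ℝ) : Set (Tan d × ℝ × Jet d) := tanBall d R ×ˢ (Ico 0 R ×ˢ univ)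

/-- `F` is smooth in all of its arguments except `y'`, and is `C^{m,a}` together with all its
derivatives with respect to these arguments. -/
def IsSmoothExceptTan {d : ℕ} (m : ℕ) (a : ℝ≥0) (F : Tan d × ℝ × Jet d → ℝ) (R : ℝ) : Prop :=
  (∀ y ∈ tanBall d R, ContDiffOn ℝ ∞ (fun z => F (y, z)) (Ico 0 R ×ˢ univ)) ∧
    ∀ j : ℕ, IsLocCHolder m a
      (fun x : Tan d × ℝ × Jet d =>
        iteratedFDerivWithin ℝ j (fun z => F (x.1, z)) (Ico 0 R ×ˢ univ) x.2) (argSet d R)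

/-- For `τ = 0, …, ℓ - 1`, the quantities `D_{y'}^τ v / t`, `D_{y'}^τ D v`, `D_{y'}^τ (v²) / t³`,
`D_{y'}^τ (v v_t) / t²` and `D_{y'}^τ (v_t²) / t` are `C^a` up to the boundary of `G_r`. -/
def TangentialRegularity {d : ℕ} (ℓ : ℕ) (a : ℝ≥0) (r : ℝ) (v : Tan d × ℝ → ℝ) : Prop :=
  ∀ τ < ℓ,
    IsHolder a (fun x => x.2⁻¹ • dTanIter τ v x) (cyl d r) ∧
    IsHolder a (fun x => dTanIter τ (fderiv ℝ v) x) (cyl d r) ∧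
    IsHolder a (fun x => (x.2 ^ 3)⁻¹ • dTanIter τ (fun y => v y ^ 2) x) (cyl d r) ∧
    IsHolder a (fun x => (x.2 ^ 2)⁻¹ • dTanIter τ (fun y => v y * dt v y) x) (cyl d r) ∧
    IsHolder a (fun x => x.2⁻¹ • dTanIter τ (fun y => dt v y ^ 2) x) (cyl d r)

/-- `iterIntegral f m t = ∫_0^t ∫_0^{s_1} ⋯ ∫_0^{s_{m-1}} f(s_m) ds_m ⋯ ds_1`. -/
def iterIntegral (f : ℝ → ℝ) : ℕ → ℝ → ℝ
  | 0 => f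
  | m + 1 => fun t => ∫ s in (0 : ℝ)..t, iterIntegral f m s

end SingularExpansion

end

/-!
Write `a = mlo ≤ 0`, `b = mhi ≥ 2` and `θ = t ∂_t`. For `u = v / t²` the equation reads
`(θ + 2 - a) (θ + 2 - b) u = -F`, where `F` is evaluated at `y'`, `t` and the arguments
`z = (t, v_t, v / t, …)`. Each component of `z` is `t` times an expression in `u` and its
derivatives: `v_t = t (θ u + 2 u)`, `v² / t³ = t u²`, `D_{y'} v_t = t D_{y'} (θ u + 2 u)`, and
`D²_{y'} v = t · t D²_{y'} u` even gains two powers of `t`. Knowing the expansion of `u` in terms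
`c(y') t^i (log t)^j` below order `m` therefore determines that of `F` up to order `m`, and the two
first order Euler operators can be inverted term by term, which gives the expansion of `u` up to
order `m`. The only resonance is `i = b - 2`, in the second operator: it produces the first
logarithm and leaves one coefficient free.

**Function classes.** Remainders are measured in the scale-invariant Hölder classes `W` of weight
`γ`; `Reg` adds `m` derivatives `θ` and `s` tangential ones, in any order, and `HasExp` is the
existence of an expansion with a remainder in `Reg`. The operators
`ρ ↦ t^(-ν) ∫_{t₀}^t s^(ν - 1) ρ ds` preserve `Reg` and gain one `θ` (`Reg.invOp`), which is the
basis of `HasExp.solve_pos` and `HasExp.solve_nonpos`. Remainders have weight `m + α` and Hölder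
exponents `ε < α`: the Hölder quotient of exponent `ε` has weight `m + α - ε`, so at `ε = α` the
integral that inverts the resonant operator would diverge. Coefficients determined by such an
integral are hence of class `C^{·,ε}` only; the set `X` in `HasExp` singles out those of class
`C^{·,α}`.

**The nonlinear term.** `comp_hasExp` obtains the expansion of `F ∘ z` by integrating
`θ (F ∘ z) = t ∑ (∂_i F ∘ z) h_i`, where `θ z_i = t h_i`, and induction on the order. At order `0`
it only needs that `F ∘ z - F(·, 0)` has weight `α`. If `b ≥ 3`, this follows from the Hölder
continuity of `F`, since `z` is Lipschitz at comparable heights (`Setting.coord_lipschitz`). If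
`b = 2`, then `u` has a logarithm in its leading term and `z` is only Hölder continuous; here `F` is
differentiable in `z` by hypothesis, and `hasFDerivWithinAt_partial` exchanges the derivatives in
`z` with those in `y'`.

**The case `b = 2`.** The logarithm in the leading term costs an arbitrarily small power of `t`
whenever a remainder is multiplied with `u`. The induction is therefore first run with lossy weights
(the flag `e = true` in `W`). A lossy expansion of order `m + 1` is a sharp one of order `m`, and
feeding this into the products (`comp_hasExp_sharp`) yields the expansions with sharp weights in a
second run (`Setting.expU_of_eq_two`).

**Conclusion.** The expansion of `u` of order `m` holds with `ℓ - 2 - m` tangential derivatives. The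
coefficients are unique (`IsExp.coeff_unique`), so the one of `t^i` has the regularity that the
expansion of order `i` provides. The remainder of `v = t² u` of order `k` has weight `k + α` and `k`
derivatives in `t`, and hence is the `k`-fold integral of its `k`-th derivative
(`Reg.exists_iterIntegral`).
-/

namespace SingularExpansion

open Filter Topology MeasureTheory Asymptotics

variable {d : ℕ} {r : ℝ}

/-! ### Logarithmic and tangential derivatives, and iterated regularity -/

/-- `g = t ∂_t f` in the cylinder. -/
def IsTheta (r : ℝ) (f g : Tan d × ℝ → ℝ) : Prop :=
  ∀ x ∈ cyl d r, HasDerivAt (fun s => f (x.1, s)) (g x / x.2) x.2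

/-- `k` is the family of tangential partial derivatives of `f` in the cylinder. -/
def IsGrad (r : ℝ) (f : Tan d × ℝ → ℝ) (k : Fin d → Tan d × ℝ → ℝ) : Prop :=
  ∀ x ∈ cyl d r, HasFDerivAt (fun z => f (z, x.2))
    (∑ a, k a x • (EuclideanSpace.proj a : Tan d →L[ℝ] ℝ)) x.1

/-- All iterated derivatives of `f` with at most `m` factors `t ∂_t` and at most `s` tangential
factors, taken in any order, exist and have the property `Q`. -/
def Reg (r : ℝ) (Q : (Tan d × ℝ → ℝ) → Prop) (m s : ℕ) (f : Tan d × ℝ → ℝ) : Prop :=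
  Q f ∧ (∀ m', m = m' + 1 → ∃ g, IsTheta r f g ∧ Reg r Q m' s g) ∧
    ∀ s', s = s' + 1 → ∃ k : Fin d → Tan d × ℝ → ℝ, IsGrad r f k ∧ ∀ a, Reg r Q m s' (k a)
termination_by m + s

lemma mem_cyl {x : Tan d × ℝ} : x ∈ cyl d r ↔ x.1 ∈ tanBall d r ∧ 0 < x.2 ∧ x.2 < r := by
  simp [cyl, Set.mem_prod]

lemma mk_mem_cyl {y : Tan d} {t : ℝ} : (y, t) ∈ cyl d r ↔ y ∈ tanBall d r ∧ 0 < t ∧ t < r :=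
  mem_cyl

lemma isOpen_tanBall : IsOpen (tanBall d r) := isOpen_ball

lemma eventually_time {x : Tan d × ℝ} (hx : x ∈ cyl d r) : ∀ᶠ s in 𝓝 x.2, (x.1, s) ∈ cyl d r := by
  have h := mem_cyl.1 hx
  filter_upwards [Ioo_mem_nhds h.2.1 h.2.2] with s hs
  exact mk_mem_cyl.2 ⟨h.1, hs.1, hs.2⟩

lemma eventually_space {x : Tan d × ℝ} (hx : x ∈ cyl d r) :
    ∀ᶠ z in 𝓝 x.1, (z, x.2) ∈ cyl d r := by
  have h := mem_cyl.1 hx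
  filter_upwards [isOpen_tanBall.mem_nhds h.1] with s hs
  exact mk_mem_cyl.2 ⟨hs, h.2⟩

section Basic

variable {f f' g g' : Tan d × ℝ → ℝ} {k k' : Fin d → Tan d × ℝ → ℝ}

lemma IsTheta.congr (h : IsTheta r f g) (hf : EqOn f' f (cyl d r)) (hg : EqOn g' g (cyl d r)) :
    IsTheta r f' g' := by
  intro x hx
  rw [hg hx]
  refine (h x hx).congr_of_eventuallyEq ?_
  filter_upwards [eventually_time hx] with s hs using hf hs

lemma IsGrad.congr (h : IsGrad r f k) (hf : EqOn f' f (cyl d r))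
    (hk : ∀ a, EqOn (k' a) (k a) (cyl d r)) : IsGrad r f' k' := by
  intro x hx
  have := (h x hx).congr_of_eventuallyEq (f₁ := fun z => f' (z, x.2)) (by
    filter_upwards [eventually_space hx] with s hs using hf hs)
  convert this using 3 with a
  rw [hk a hx]

lemma IsTheta.unique (h : IsTheta r f g) (h' : IsTheta r f g') : EqOn g g' (cyl d r) := by
  intro x hx
  have := (h x hx).unique (h' x hx)
  have h0 := (mem_cyl.1 hx).2.1
  field_simp at this
  exact this

lemma sum_proj_single (c : Fin d → ℝ) (a : Fin d) :
    (∑ b, c b • (EuclideanSpace.proj b : Tan d →L[ℝ] ℝ)) (EuclideanSpace.single a 1) = c a := by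
  simp

lemma IsGrad.unique (h : IsGrad r f k) (h' : IsGrad r f k') (a : Fin d) :
    EqOn (k a) (k' a) (cyl d r) := by
  intro x hx
  have := (h x hx).unique (h' x hx)
  simpa only [sum_proj_single] using congrArg (fun L => L (EuclideanSpace.single a 1)) this

lemma clm_eq_sum_proj (L : Tan d →L[ℝ] ℝ) :
    L = ∑ a, L (EuclideanSpace.single a 1) • (EuclideanSpace.proj a : Tan d →L[ℝ] ℝ) := by
  ext y
  have hy : y = ∑ a, y a • (EuclideanSpace.single a (1 : ℝ) : Tan d) := by
    ext b
    simp [Finset.sum_apply, Pi.single_apply]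
  conv_lhs => rw [hy]
  simp [mul_comm]

lemma IsTheta.add (h : IsTheta r f g) (h' : IsTheta r f' g') :
    IsTheta r (fun x => f x + f' x) (fun x => g x + g' x) := fun x hx => by
  refine ((h x hx).add (h' x hx)).congr_deriv ?_
  ring

lemma IsGrad.add (h : IsGrad r f k) (h' : IsGrad r f' k') :
    IsGrad r (fun x => f x + f' x) (fun a x => k a x + k' a x) := fun x hx => by
  refine ((h x hx).add (h' x hx)).congr_fderiv ?_
  simp only [add_smul, Finset.sum_add_distrib]

lemma IsTheta.mul (h : IsTheta r f g) (h' : IsTheta r f' g') :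
    IsTheta r (fun x => f x * f' x) (fun x => g x * f' x + f x * g' x) := fun x hx => by
  refine ((h x hx).mul (h' x hx)).congr_deriv ?_
  ring

lemma IsGrad.mul (h : IsGrad r f k) (h' : IsGrad r f' k') :
    IsGrad r (fun x => f x * f' x) (fun a x => k a x * f' x + f x * k' a x) := fun x hx => by
  refine ((h x hx).mul (h' x hx)).congr_fderiv ?_
  simp only [add_smul, Finset.sum_add_distrib, Finset.smul_sum, smul_smul]
  rw [add_comm]
  congr 1
  exact Finset.sum_congr rfl fun a _ => by rw [mul_comm]

lemma IsTheta.const (c : ℝ) : IsTheta r (fun _ : Tan d × ℝ => c) (fun _ => 0) := fun x hx => by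
  simpa using hasDerivAt_const x.2 c

lemma IsGrad.const (c : ℝ) : IsGrad r (fun _ : Tan d × ℝ => c) (fun _ _ => 0) := fun x hx => by
  simpa using hasFDerivAt_const c x.1

lemma IsGrad.time (φ : ℝ → ℝ) : IsGrad r (fun x : Tan d × ℝ => φ x.2) (fun _ _ => 0) :=
  fun x hx => by simpa using hasFDerivAt_const (φ x.2) x.1

lemma IsTheta.const_mul (c : ℝ) (h : IsTheta r f g) :
    IsTheta r (fun x => c * f x) (fun x => c * g x) := fun x hx => by
  simpa [mul_div_assoc] using (h x hx).const_mul c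

lemma IsGrad.const_mul (c : ℝ) (h : IsGrad r f k) :
    IsGrad r (fun x => c * f x) (fun a x => c * k a x) := fun x hx => by
  have := (h x hx).const_mul c
  simpa only [Finset.smul_sum, smul_smul] using this

end Basic

section Reg

variable {Q Q' Q'' : (Tan d × ℝ → ℝ) → Prop} {m s : ℕ} {f f' g : Tan d × ℝ → ℝ}

lemma Reg.base (h : Reg r Q m s f) : Q f := by
  rw [Reg] at h; exact h.1

lemma Reg.theta (h : Reg r Q (m + 1) s f) : ∃ g, IsTheta r f g ∧ Reg r Q m s g := by
  rw [Reg] at h; exact h.2.1 m rfl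

lemma Reg.grad (h : Reg r Q m (s + 1) f) :
    ∃ k : Fin d → Tan d × ℝ → ℝ, IsGrad r f k ∧ ∀ a, Reg r Q m s (k a) := by
  rw [Reg] at h; exact h.2.2 s rfl

/-- A family of predicates that is stable under the two kinds of derivatives and implies `Q`
implies `Reg`. -/
lemma Reg.of_family (P : ℕ → ℕ → (Tan d × ℝ → ℝ) → Prop)
    (h0 : ∀ m s f, P m s f → Q f)
    (hθ : ∀ m s f, P (m + 1) s f → ∃ g, IsTheta r f g ∧ P m s g)
    (hg : ∀ m s f, P m (s + 1) f →
      ∃ k : Fin d → Tan d × ℝ → ℝ, IsGrad r f k ∧ ∀ a, P m s (k a)) :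
    ∀ m s f, P m s f → Reg r Q m s f := by
  suffices H : ∀ n m s f, m + s = n → P m s f → Reg r Q m s f from
    fun m s f => H _ m s f rfl
  intro n
  induction n with
  | zero =>
    intro m s f hn h
    rw [Reg]
    exact ⟨h0 _ _ _ h, fun m' hm => by omega, fun s' hs => by omega⟩
  | succ n ih =>
    intro m s f hn h
    rw [Reg]
    refine ⟨h0 _ _ _ h, ?_, ?_⟩
    · rintro m' rfl
      obtain ⟨g, hg1, hg2⟩ := hθ _ _ _ h
      exact ⟨g, hg1, ih _ _ _ (by omega) hg2⟩
    · rintro s' rfl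
      obtain ⟨k, hk1, hk2⟩ := hg _ _ _ h
      exact ⟨k, hk1, fun a => ih _ _ _ (by omega) (hk2 a)⟩

lemma Reg.mk_zero (h : Q f) : Reg r Q 0 0 f := by
  rw [Reg]; exact ⟨h, fun m' hm => by omega, fun s' hs => by omega⟩

lemma Reg.imp (hQ : ∀ f, Q f → Q' f) (h : Reg r Q m s f) : Reg r Q' m s f :=
  Reg.of_family (Reg r Q) (fun _ _ _ h => hQ _ h.base) (fun _ _ _ h => h.theta)
    (fun _ _ _ h => h.grad) _ _ _ h

lemma Reg.mono {m' s' : ℕ} (hm : m' ≤ m) (hs : s' ≤ s) (h : Reg r Q m s f) :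
    Reg r Q m' s' f := by
  refine Reg.of_family (fun m' s' f => ∃ m s, m' ≤ m ∧ s' ≤ s ∧ Reg r Q m s f)
    ?_ ?_ ?_ m' s' f ⟨m, s, hm, hs, h⟩
  · rintro _ _ _ ⟨m, s, _, _, h⟩; exact h.base
  · rintro a b f ⟨m, s, h1, h2, h⟩
    obtain ⟨m, rfl⟩ : ∃ k, m = k + 1 := ⟨m - 1, by omega⟩
    obtain ⟨g, hg, hg'⟩ := h.theta
    exact ⟨g, hg, m, s, by omega, h2, hg'⟩
  · rintro a b f ⟨m, s, h1, h2, h⟩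
    obtain ⟨s, rfl⟩ : ∃ k, s = k + 1 := ⟨s - 1, by omega⟩
    obtain ⟨g, hg, hg'⟩ := h.grad
    exact ⟨g, hg, fun a => ⟨m, s, h1, by omega, hg' a⟩⟩

lemma Reg.congr (hQ : ∀ f g, EqOn f g (cyl d r) → Q g → Q f) (hfg : EqOn f g (cyl d r))
    (h : Reg r Q m s g) : Reg r Q m s f := by
  refine Reg.of_family (fun m s f => ∃ g, EqOn f g (cyl d r) ∧ Reg r Q m s g)
    ?_ ?_ ?_ m s f ⟨g, hfg, h⟩
  · rintro _ _ _ ⟨g, e, h⟩; exact hQ _ _ e h.base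
  · rintro a b f ⟨g, e, h⟩
    obtain ⟨k, hk, hk'⟩ := h.theta
    exact ⟨k, hk.congr e (eqOn_refl _ _), k, eqOn_refl _ _, hk'⟩
  · rintro a b f ⟨g, e, h⟩
    obtain ⟨k, hk, hk'⟩ := h.grad
    exact ⟨k, hk.congr e (fun _ => eqOn_refl _ _), fun a => ⟨k a, eqOn_refl _ _, hk' a⟩⟩

lemma Reg.add (hQ : ∀ f g, Q f → Q g → Q (fun x => f x + g x))
    (h : Reg r Q m s f) (h' : Reg r Q m s f') : Reg r Q m s (fun x => f x + f' x) := by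
  refine Reg.of_family (fun m s F => ∃ f f', Reg r Q m s f ∧ Reg r Q m s f' ∧
    F = fun x => f x + f' x) ?_ ?_ ?_ m s _ ⟨f, f', h, h', rfl⟩
  · rintro _ _ _ ⟨f, g, h, h', rfl⟩; exact hQ _ _ h.base h'.base
  · rintro a b _ ⟨f, g, h, h', rfl⟩
    obtain ⟨k, hk, hk'⟩ := h.theta
    obtain ⟨l, hl, hl'⟩ := h'.theta
    exact ⟨_, hk.add hl, _, _, hk', hl', rfl⟩
  · rintro a b _ ⟨f, g, h, h', rfl⟩
    obtain ⟨k, hk, hk'⟩ := h.grad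
    obtain ⟨l, hl, hl'⟩ := h'.grad
    exact ⟨_, hk.add hl, fun a => ⟨_, _, hk' a, hl' a, rfl⟩⟩

lemma Reg.const_mul (hQ : ∀ (c : ℝ) f, Q f → Q (fun x => c * f x)) (c : ℝ)
    (h : Reg r Q m s f) : Reg r Q m s (fun x => c * f x) := by
  refine Reg.of_family (fun m s F => ∃ f, Reg r Q m s f ∧ F = fun x => c * f x)
    ?_ ?_ ?_ m s _ ⟨f, h, rfl⟩
  · rintro _ _ _ ⟨f, h, rfl⟩; exact hQ _ _ h.base
  · rintro a b _ ⟨f, h, rfl⟩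
    obtain ⟨k, hk, hk'⟩ := h.theta
    exact ⟨_, hk.const_mul c, _, hk', rfl⟩
  · rintro a b _ ⟨f, h, rfl⟩
    obtain ⟨k, hk, hk'⟩ := h.grad
    exact ⟨_, hk.const_mul c, fun a => ⟨_, hk' a, rfl⟩⟩

lemma Reg.mul (hQ : ∀ f g, Q'' f → Q'' g → Q'' (fun x => f x + g x))
    (hm : ∀ f g, Q f → Q' g → Q'' (fun x => f x * g x))
    (h : Reg r Q m s f) (h' : Reg r Q' m s f') : Reg r Q'' m s (fun x => f x * f' x) := by
  suffices H : ∀ n m s f f', m + s = n → Reg r Q m s f → Reg r Q' m s f' →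
      Reg r Q'' m s (fun x => f x * f' x) from H _ m s f f' rfl h h'
  clear h h'
  intro n
  induction n with
  | zero =>
    intro m s f f' hn h h'
    obtain ⟨rfl, rfl⟩ : m = 0 ∧ s = 0 := by omega
    exact Reg.mk_zero (hm _ _ h.base h'.base)
  | succ n ih =>
    intro m s f f' hn h h'
    rw [Reg]
    refine ⟨hm _ _ h.base h'.base, ?_, ?_⟩
    · rintro m' rfl
      obtain ⟨g, hg1, hg2⟩ := h.theta
      obtain ⟨g', hg1', hg2'⟩ := h'.theta
      exact ⟨_, hg1.mul hg1', (ih _ _ _ _ (by omega) hg2 (h'.mono (by omega) le_rfl)).add hQ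
        (ih _ _ _ _ (by omega) (h.mono (by omega) le_rfl) hg2')⟩
    · rintro s' rfl
      obtain ⟨g, hg1, hg2⟩ := h.grad
      obtain ⟨g', hg1', hg2'⟩ := h'.grad
      exact ⟨_, hg1.mul hg1', fun a => (ih _ _ _ _ (by omega) (hg2 a)
        (h'.mono le_rfl (by omega))).add hQ
        (ih _ _ _ _ (by omega) (h.mono le_rfl (by omega)) (hg2' a))⟩

end Reg

/-! ### Weighted Hölder classes -/

/-- Admissible losses in the exponent of a weight: none for `false`, and every positive one
for `true`. -/
def loss (e : Bool) : Set ℝ := if e then Ioi 0 else {0}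

/-- The scale-invariant weighted Hölder class: `f = O(t^γ)`, and on pairs of points with comparable
heights the Hölder quotient of exponent `ε ∈ S` is `O(t^(γ - ε))`; both up to a factor `t^(-η)`,
where `η` is an arbitrary admissible loss. -/
structure W (r : ℝ) (S : Set ℝ) (e : Bool) (γ : ℝ) (f : Tan d × ℝ → ℝ) : Prop where
  cont : ∀ y ∈ tanBall d r, ContinuousOn (fun s => f (y, s)) (Ioo 0 r)
  bd : ∀ η ∈ loss e, ∃ C, 0 ≤ C ∧ ∀ x ∈ cyl d r, |f x| ≤ C * x.2 ^ (γ - η)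
  hol : ∀ ε ∈ S, ∀ η ∈ loss e, ∃ C, 0 ≤ C ∧ ∀ x ∈ cyl d r, ∀ x' ∈ cyl d r,
    x'.2 ≤ x.2 → x.2 ≤ 2 * x'.2 → |f x - f x'| ≤ C * x.2 ^ (γ - ε - η) * ‖x - x'‖ ^ ε

lemma rpow_comparable {s t : ℝ} (a : ℝ) (hs : 0 < s) (h1 : s ≤ t) (h2 : t ≤ 2 * s) :
    s ^ a ≤ 2 ^ |a| * t ^ a := by
  have ht : 0 < t := hs.trans_le h1
  rcases le_total 0 a with ha | ha
  · rw [abs_of_nonneg ha]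
    have h3 : s ^ a ≤ t ^ a := Real.rpow_le_rpow hs.le h1 ha
    have h4 : (1 : ℝ) ≤ 2 ^ a := Real.one_le_rpow (by norm_num) ha
    nlinarith [Real.rpow_nonneg ht.le a]
  · rw [abs_of_nonpos ha]
    have h3 : s ^ a ≤ (t / 2) ^ a :=
      Real.rpow_le_rpow_of_nonpos (by positivity) (by linarith) ha
    rw [Real.div_rpow ht.le (by norm_num)] at h3
    rw [Real.rpow_neg (by norm_num)]
    calc s ^ a ≤ t ^ a / 2 ^ a := h3
      _ = _ := by ring

lemma rpow_le_const {t a b : ℝ} (ht : 0 < t) (htr : t < r) (hab : b ≤ a) :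
    t ^ a ≤ r ^ (a - b) * t ^ b := by
  have h : t ^ a = t ^ (a - b) * t ^ b := by rw [← Real.rpow_add ht]; ring_nf
  rw [h]
  gcongr

/-- The weight `t^(γ - η)`, with an admissible loss for `e`, is dominated by `t^(γ' - η')`, for
every admissible loss `η'` for `e'`. -/
def Dom (e : Bool) (γ : ℝ) (e' : Bool) (γ' : ℝ) : Prop :=
  ∀ η' ∈ loss e', ∃ η ∈ loss e, γ' - η' ≤ γ - η

lemma mem_loss_false {η : ℝ} : η ∈ loss false ↔ η = 0 := by simp [loss]
lemma mem_loss_true {η : ℝ} : η ∈ loss true ↔ 0 < η := by simp [loss]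

lemma loss_nonneg {e : Bool} {η : ℝ} (h : η ∈ loss e) : 0 ≤ η := by
  cases e
  · rw [mem_loss_false] at h; exact h.ge
  · rw [mem_loss_true] at h; exact h.le

lemma loss_small (e : Bool) {x : ℝ} (hx : 0 < x) : ∃ η ∈ loss e, η < x := by
  cases e
  · exact ⟨0, by simp [mem_loss_false], hx⟩
  · exact ⟨x / 2, by rw [mem_loss_true]; positivity, by linarith⟩

lemma loss_small_le {e : Bool} {x η : ℝ} (hx : 0 < x) (hη : η ∈ loss e) :
    ∃ η' ∈ loss e, η' ≤ η ∧ η' < x := by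
  cases e
  · exact ⟨η, hη, le_rfl, by rw [mem_loss_false] at hη; rw [hη]; exact hx⟩
  · rw [mem_loss_true] at hη
    refine ⟨min η (x / 2), by rw [mem_loss_true]; positivity, min_le_left _ _, ?_⟩
    exact (min_le_right _ _).trans_lt (by linarith)

lemma loss_split {e e' : Bool} {η : ℝ} (h : η ∈ loss (e || e')) :
    ∃ η₁ ∈ loss e, ∃ η₂ ∈ loss e', η₁ + η₂ = η := by
  cases e <;> cases e' <;> simp [loss] at h ⊢
  · exact h.symm
  · exact h
  · exact h
  · exact ⟨η / 2, by linarith, η / 2, by linarith, by ring⟩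

lemma dom_of_lt {e e' : Bool} {γ γ' : ℝ} (h : γ' < γ) : Dom e γ e' γ' := by
  intro η' hη'
  obtain ⟨η, hη, h1⟩ := loss_small e (sub_pos.2 h)
  exact ⟨η, hη, by linarith [loss_nonneg hη']⟩

lemma dom_of_le {e : Bool} {γ γ' : ℝ} (h : γ' ≤ γ) : Dom e γ e γ' :=
  fun η hη => ⟨η, hη, by linarith⟩

lemma dom_true {e : Bool} {γ γ' : ℝ} (h : γ' ≤ γ) : Dom e γ true γ' := by
  cases e
  · intro η hη
    exact ⟨0, by simp [mem_loss_false], by linarith [loss_nonneg hη]⟩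
  · exact dom_of_le h

section

variable {S S' : Set ℝ} {e e' : Bool} {γ γ' : ℝ} {f g : Tan d × ℝ → ℝ}

lemma W.congr (h : EqOn f g (cyl d r)) (hg : W r S e γ g) : W r S e γ f where
  cont y hy := (hg.cont y hy).congr fun s hs => h (mk_mem_cyl.2 ⟨hy, hs.1, hs.2⟩)
  bd η hη := by
    obtain ⟨C, h0, hC⟩ := hg.bd η hη
    exact ⟨C, h0, fun x hx => by rw [h hx]; exact hC x hx⟩
  hol ε hε η hη := by
    obtain ⟨C, h0, hC⟩ := hg.hol ε hε η hη
    exact ⟨C, h0, fun x hx x' hx' => by rw [h hx, h hx']; exact hC x hx x' hx'⟩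

lemma W.weaken (hf : W r S e γ f) (hS : S' ⊆ S) (hd : Dom e γ e' γ') : W r S' e' γ' f where
  cont := hf.cont
  bd η' hη' := by
    obtain ⟨η, hη, hle⟩ := hd η' hη'
    obtain ⟨C, h0, hC⟩ := hf.bd η hη
    by_cases hr : 0 < r
    · refine ⟨C * r ^ (γ - η - (γ' - η')), by positivity, fun x hx => (hC x hx).trans ?_⟩
      have := mem_cyl.1 hx
      rw [mul_assoc]
      gcongr
      exact rpow_le_const this.2.1 this.2.2 hle
    · exact ⟨0, le_rfl, fun x hx => absurd ((mem_cyl.1 hx).2.1.trans (mem_cyl.1 hx).2.2) hr⟩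
  hol ε hε η' hη' := by
    obtain ⟨η, hη, hle⟩ := hd η' hη'
    obtain ⟨C, h0, hC⟩ := hf.hol ε (hS hε) η hη
    by_cases hr : 0 < r
    · refine ⟨C * r ^ (γ - ε - η - (γ' - ε - η')), by positivity,
        fun x hx x' hx' h1 h2 => (hC x hx x' hx' h1 h2).trans ?_⟩
      have := mem_cyl.1 hx
      have h3 := rpow_le_const (a := γ - ε - η) (b := γ' - ε - η') this.2.1 this.2.2 (by linarith)
      calc C * x.2 ^ (γ - ε - η) * ‖x - x'‖ ^ ε
          ≤ C * (r ^ (γ - ε - η - (γ' - ε - η')) * x.2 ^ (γ' - ε - η')) * ‖x - x'‖ ^ ε := by gcongr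
        _ = _ := by ring
    · exact ⟨0, le_rfl, fun x hx => absurd ((mem_cyl.1 hx).2.1.trans (mem_cyl.1 hx).2.2) hr⟩

lemma W.add (hf : W r S e γ f) (hg : W r S e γ g) : W r S e γ (fun x => f x + g x) where
  cont y hy := (hf.cont y hy).add (hg.cont y hy)
  bd η hη := by
    obtain ⟨C, h0, hC⟩ := hf.bd η hη
    obtain ⟨D, h0', hD⟩ := hg.bd η hη
    refine ⟨C + D, by positivity, fun x hx => (abs_add_le _ _).trans ?_⟩
    rw [add_mul]
    exact add_le_add (hC x hx) (hD x hx)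
  hol ε hε η hη := by
    obtain ⟨C, h0, hC⟩ := hf.hol ε hε η hη
    obtain ⟨D, h0', hD⟩ := hg.hol ε hε η hη
    refine ⟨C + D, by positivity, fun x hx x' hx' h1 h2 => ?_⟩
    rw [add_sub_add_comm, add_mul, add_mul]
    exact (abs_add_le _ _).trans (add_le_add (hC x hx x' hx' h1 h2) (hD x hx x' hx' h1 h2))

lemma W.const_mul (c : ℝ) (hf : W r S e γ f) : W r S e γ (fun x => c * f x) where
  cont y hy := continuousOn_const.mul (hf.cont y hy)
  bd η hη := by
    obtain ⟨C, h0, hC⟩ := hf.bd η hη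
    refine ⟨|c| * C, by positivity, fun x hx => ?_⟩
    rw [abs_mul, mul_assoc]
    gcongr
    exact hC x hx
  hol ε hε η hη := by
    obtain ⟨C, h0, hC⟩ := hf.hol ε hε η hη
    refine ⟨|c| * C, by positivity, fun x hx x' hx' h1 h2 => ?_⟩
    rw [← mul_sub, abs_mul, mul_assoc, mul_assoc]
    gcongr
    rw [← mul_assoc]
    exact hC x hx x' hx' h1 h2

lemma W.mul (hf : W r S e γ f) (hg : W r S e' γ' g) :
    W r S (e || e') (γ + γ') (fun x => f x * g x) where
  cont y hy := (hf.cont y hy).mul (hg.cont y hy)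
  bd η hη := by
    obtain ⟨η₁, h1, η₂, h2, rfl⟩ := loss_split hη
    obtain ⟨C, h0, hC⟩ := hf.bd η₁ h1
    obtain ⟨D, h0', hD⟩ := hg.bd η₂ h2
    refine ⟨C * D, by positivity, fun x hx => ?_⟩
    have hx2 := (mem_cyl.1 hx).2.1
    have : x.2 ^ (γ + γ' - (η₁ + η₂)) = x.2 ^ (γ - η₁) * x.2 ^ (γ' - η₂) := by
      rw [← Real.rpow_add hx2]; ring_nf
    rw [abs_mul, this]
    calc |f x| * |g x| ≤ (C * x.2 ^ (γ - η₁)) * (D * x.2 ^ (γ' - η₂)) := by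
          gcongr
          · exact hC x hx
          · exact hD x hx
      _ = _ := by ring
  hol ε hε η hη := by
    obtain ⟨η₁, h1, η₂, h2, rfl⟩ := loss_split hη
    obtain ⟨C, h0, hC⟩ := hf.bd η₁ h1
    obtain ⟨D, h0', hD⟩ := hg.bd η₂ h2
    obtain ⟨C', h0'', hC'⟩ := hf.hol ε hε η₁ h1
    obtain ⟨D', h0''', hD'⟩ := hg.hol ε hε η₂ h2
    refine ⟨C' * D + C * 2 ^ |γ - η₁| * D', by positivity, fun x hx x' hx' hl hl' => ?_⟩
    have hx2 := (mem_cyl.1 hx).2.1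
    have hx2' := (mem_cyl.1 hx').2.1
    have e1 : x.2 ^ (γ + γ' - ε - (η₁ + η₂)) = x.2 ^ (γ - ε - η₁) * x.2 ^ (γ' - η₂) := by
      rw [← Real.rpow_add hx2]; ring_nf
    have e2 : x.2 ^ (γ + γ' - ε - (η₁ + η₂)) = x.2 ^ (γ - η₁) * x.2 ^ (γ' - ε - η₂) := by
      rw [← Real.rpow_add hx2]; ring_nf
    have h3 := rpow_comparable (γ - η₁) hx2' hl hl'
    have hN : 0 ≤ ‖x - x'‖ ^ ε := by positivity
    calc |f x * g x - f x' * g x'| = |(f x - f x') * g x + f x' * (g x - g x')| := by ring_nf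
      _ ≤ |f x - f x'| * |g x| + |f x'| * |g x - g x'| := by
          rw [← abs_mul, ← abs_mul]; exact abs_add_le _ _
      _ ≤ (C' * x.2 ^ (γ - ε - η₁) * ‖x - x'‖ ^ ε) * (D * x.2 ^ (γ' - η₂)) +
          (C * (2 ^ |γ - η₁| * x.2 ^ (γ - η₁))) * (D' * x.2 ^ (γ' - ε - η₂) * ‖x - x'‖ ^ ε) := by
          gcongr
          · exact hC' x hx x' hx' hl hl'
          · exact hD x hx
          · exact (hC x' hx').trans (by gcongr)
          · exact hD' x hx x' hx' hl hl'
      _ = C' * D * (x.2 ^ (γ - ε - η₁) * x.2 ^ (γ' - η₂)) * ‖x - x'‖ ^ ε +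
          C * 2 ^ |γ - η₁| * D' * (x.2 ^ (γ - η₁) * x.2 ^ (γ' - ε - η₂)) * ‖x - x'‖ ^ ε := by ring
      _ = _ := by rw [← e1, ← e2]; ring

/-- If `t ∂_t f` has the size of `f`, then only the tangential Hölder quotients matter. -/
lemma W.of_theta (hS : S ⊆ Ioc 0 1) (hθ : IsTheta r f g)
    (hf : ∀ η ∈ loss e, ∃ C, 0 ≤ C ∧ ∀ x ∈ cyl d r, |f x| ≤ C * x.2 ^ (γ - η))
    (hg : ∀ η ∈ loss e, ∃ C, 0 ≤ C ∧ ∀ x ∈ cyl d r, |g x| ≤ C * x.2 ^ (γ - η))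
    (hy : ∀ ε ∈ S, ∀ η ∈ loss e, ∃ C, 0 ≤ C ∧ ∀ y ∈ tanBall d r, ∀ y' ∈ tanBall d r,
      ∀ t ∈ Ioo 0 r, |f (y, t) - f (y', t)| ≤ C * t ^ (γ - ε - η) * ‖y - y'‖ ^ ε) :
    W r S e γ f where
  cont y hy s hs :=
    (hθ (y, s) (mk_mem_cyl.2 ⟨hy, hs.1, hs.2⟩)).continuousAt.continuousWithinAt
  bd := hf
  hol ε hε η hη := by
    obtain ⟨C, hC0, hC⟩ := hy ε hε η hη
    obtain ⟨D, hD0, hD⟩ := hg η hη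
    have hε1 := hS hε
    refine ⟨C + D * 2 ^ |γ - η - 1|, by positivity, fun x hx x' hx' h1 h2 => ?_⟩
    obtain ⟨y, t⟩ := x
    obtain ⟨y', t'⟩ := x'
    simp only at h1 h2 ⊢
    have hx := mk_mem_cyl.1 hx
    have hx' := mk_mem_cyl.1 hx'
    have ny : ‖y - y'‖ ≤ ‖(y, t) - (y', t')‖ := by
      simp
    have nt : t - t' ≤ ‖(y, t) - (y', t')‖ := by
      refine (le_abs_self _).trans ?_
      simp
    -- the mean value theorem in `t`, at heights comparable to `t`
    have key : ‖f (y', t) - f (y', t')‖ ≤ D * 2 ^ |γ - η - 1| * t ^ (γ - η - 1) * ‖t - t'‖ := by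
      refine Convex.norm_image_sub_le_of_norm_hasDerivWithin_le (𝕜 := ℝ) (s := Icc t' t)
        (f := fun s => f (y', s)) (f' := fun s => g (y', s) / s)
        (fun s hs => ?_) (fun s hs => ?_) (convex_Icc t' t) ⟨le_rfl, h1⟩ ⟨h1, le_rfl⟩
      · exact (hθ (y', s) (mk_mem_cyl.2 ⟨hx'.1, hx'.2.1.trans_le hs.1,
          hs.2.trans_lt hx.2.2⟩)).hasDerivWithinAt
      · have s0 : 0 < s := hx'.2.1.trans_le hs.1
        have hm : (y', s) ∈ cyl d r := mk_mem_cyl.2 ⟨hx'.1, s0, hs.2.trans_lt hx.2.2⟩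
        rw [norm_div, Real.norm_eq_abs, Real.norm_eq_abs, abs_of_pos s0, div_le_iff₀ s0, mul_assoc,
          mul_assoc]
        refine (hD _ hm).trans (mul_le_mul_of_nonneg_left ?_ hD0)
        have := rpow_comparable (γ - η - 1) s0 hs.2 (by linarith [hs.1])
        rw [← mul_assoc]
        calc s ^ (γ - η) = s ^ (γ - η - 1) * s := by
              rw [← Real.rpow_add_one s0.ne']; ring_nf
          _ ≤ _ := by gcongr
    have h3 : t ^ (γ - η - 1) * ‖t - t'‖ ≤ t ^ (γ - ε - η) * ‖(y, t) - (y', t')‖ ^ ε := by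
      have hn : 0 ≤ t - t' := by linarith
      rw [Real.norm_eq_abs, abs_of_nonneg hn]
      have h4 : t - t' ≤ t ^ (1 - ε) * (t - t') ^ ε := by
        rcases hn.eq_or_lt with h | h
        · rw [← h]; have := hx.2.1; positivity
        · calc t - t' = (t - t') ^ (1 - ε) * (t - t') ^ ε := by
                rw [← Real.rpow_add h]; simp
            _ ≤ _ := by
              gcongr
              · linarith [hε1.2]
              · linarith [hx'.2.1]
      calc t ^ (γ - η - 1) * (t - t') ≤ t ^ (γ - η - 1) * (t ^ (1 - ε) * (t - t') ^ ε) := by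
            have := hx.2.1
            gcongr
        _ = t ^ (γ - ε - η) * (t - t') ^ ε := by
            rw [← mul_assoc, ← Real.rpow_add hx.2.1]; ring_nf
        _ ≤ _ := by
            have := hx.2.1
            gcongr
            exact hε1.1.le
    have h5 := hC y hx.1 y' hx'.1 t ⟨hx.2.1, hx.2.2⟩
    have ht0 := hx.2.1
    calc |f (y, t) - f (y', t')| ≤ |f (y, t) - f (y', t)| + |f (y', t) - f (y', t')| :=
          abs_sub_le _ _ _
      _ ≤ C * t ^ (γ - ε - η) * ‖y - y'‖ ^ ε +
          D * 2 ^ |γ - η - 1| * (t ^ (γ - η - 1) * ‖t - t'‖) := by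
          rw [← mul_assoc]; exact add_le_add h5 key
      _ ≤ C * t ^ (γ - ε - η) * ‖(y, t) - (y', t')‖ ^ ε +
          D * 2 ^ |γ - η - 1| * (t ^ (γ - ε - η) * ‖(y, t) - (y', t')‖ ^ ε) := by
          gcongr
          exact hε1.1.le
      _ = _ := by ring

lemma W.zero : W r S e γ (fun _ : Tan d × ℝ => 0) where
  cont y hy := continuousOn_const
  bd η hη := ⟨0, le_rfl, fun x hx => by simp⟩
  hol ε hε η hη := ⟨0, le_rfl, fun x hx x' hx' h1 h2 => by simp⟩

end

/-! ### Powers and logarithms -/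

lemma abs_log_pow_le (hr : 0 < r) (j : ℕ) {η : ℝ} (hη : 0 < η) :
    ∃ C, 0 ≤ C ∧ ∀ t ∈ Ioo 0 r, |Real.log t ^ j| ≤ C * t ^ (-η) := by
  -- `j + 1` instead of `j` covers `j = 0`
  obtain ⟨C, hC0, hC⟩ : ∃ C, 0 ≤ C ∧ ∀ t ∈ Ioo 0 r, |Real.log t| ≤ C * t ^ (-(η / (j + 1))) := by
    have hp : 0 < η / (j + 1) := by positivity
    set κ := η / (j + 1)
    refine ⟨1 / κ + r ^ (κ + κ) / κ, by positivity, fun t ht => ?_⟩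
    have h1 : |Real.log t| ≤ t ^ κ / κ + t ^ (-κ) / κ := by
      have a1 := Real.log_le_rpow_div ht.1.le hp
      have a2 := Real.log_le_rpow_div (inv_nonneg.2 ht.1.le) hp
      rw [Real.log_inv, Real.inv_rpow ht.1.le, ← Real.rpow_neg ht.1.le] at a2
      have b1 : 0 ≤ t ^ κ / κ := by have := ht.1; positivity
      have b2 : 0 ≤ t ^ (-κ) / κ := by have := ht.1; positivity
      rw [abs_le]; constructor <;> linarith
    have h2 : t ^ κ ≤ r ^ (κ + κ) * t ^ (-κ) := by
      have := rpow_le_const (a := κ) (b := -κ) ht.1 ht.2 (by linarith)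
      simpa using this
    calc |Real.log t| ≤ t ^ κ / κ + t ^ (-κ) / κ := h1
      _ ≤ (r ^ (κ + κ) * t ^ (-κ)) / κ + t ^ (-κ) / κ := by gcongr
      _ = _ := by ring
  refine ⟨C ^ j * r ^ (-(η / (j + 1)) * j + η), by positivity, fun t ht => ?_⟩
  rw [abs_pow]
  calc |Real.log t| ^ j ≤ (C * t ^ (-(η / (j + 1)))) ^ j := by gcongr; exact hC t ht
    _ = C ^ j * t ^ (-(η / (j + 1)) * j) := by
        rw [mul_pow, ← Real.rpow_natCast, ← Real.rpow_natCast, ← Real.rpow_mul ht.1.le]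
    _ ≤ C ^ j * (r ^ (-(η / (j + 1)) * j - (-η)) * t ^ (-η)) := by
        gcongr
        refine rpow_le_const ht.1 ht.2 ?_
        rw [neg_mul, neg_le_neg_iff, div_mul_eq_mul_div, div_le_iff₀ (by positivity)]
        nlinarith
    _ = _ := by ring_nf

lemma isTheta_mono (i j : ℕ) : IsTheta r (fun x : Tan d × ℝ => x.2 ^ i * Real.log x.2 ^ j)
    (fun x => i * (x.2 ^ i * Real.log x.2 ^ j) + j * (x.2 ^ i * Real.log x.2 ^ (j - 1))) := by
  intro x hx
  have h0 := (mem_cyl.1 hx).2.1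
  refine ((hasDerivAt_pow i x.2).mul ((Real.hasDerivAt_log h0.ne').pow j)).congr_deriv ?_
  rcases i with _ | i
  · simp; field_simp
  · simp; field_simp; ring

lemma W.mono_log {S : Set ℝ} (hr : 0 < r) (hS : S ⊆ Ioc 0 1) (i j : ℕ) (e : Bool)
    (he : e = true ∨ j = 0) :
    W r S e i (fun x : Tan d × ℝ => x.2 ^ i * Real.log x.2 ^ j) := by
  have bound : ∀ j, (e = true ∨ j = 0) → ∀ η ∈ loss e, ∃ C, 0 ≤ C ∧ ∀ x ∈ cyl d r,
      |x.2 ^ i * Real.log x.2 ^ j| ≤ C * x.2 ^ ((i : ℝ) - η) := by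
    intro j hj η hη
    rcases hj with rfl | rfl
    · rw [mem_loss_true] at hη
      obtain ⟨C, h0, hC⟩ := abs_log_pow_le hr j hη
      refine ⟨C, h0, fun x hx => ?_⟩
      have h := mem_cyl.1 hx
      have hp := h.2.1
      rw [abs_mul, abs_of_pos (by positivity), sub_eq_add_neg, Real.rpow_add hp, Real.rpow_natCast]
      calc x.2 ^ i * |Real.log x.2 ^ j| ≤ x.2 ^ i * (C * x.2 ^ (-η)) := by
            gcongr; exact hC _ h.2
        _ = _ := by ring
    · cases e
      · rw [mem_loss_false] at hη
        refine ⟨1, zero_le_one, fun x hx => ?_⟩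
        have hp := (mem_cyl.1 hx).2.1
        rw [hη, pow_zero, mul_one, one_mul, sub_zero, Real.rpow_natCast, abs_of_pos (by positivity)]
      · rw [mem_loss_true] at hη
        refine ⟨r ^ η, by positivity, fun x hx => ?_⟩
        have h := mem_cyl.1 hx
        have hp := h.2.1
        rw [pow_zero, mul_one, abs_of_pos (by positivity), ← Real.rpow_natCast]
        simpa using rpow_le_const (a := (i : ℝ)) (b := i - η) h.2.1 h.2.2 (by linarith)
  refine W.of_theta hS (isTheta_mono i j) (bound j he) (fun η hη => ?_)
    (fun ε hε η hη => ⟨0, le_rfl, fun y hy y' hy' t ht => by simp⟩)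
  obtain ⟨C, h0, hC⟩ := bound j he η hη
  obtain ⟨D, h0', hD⟩ := bound (j - 1) (he.imp_right fun h => by simp [h]) η hη
  refine ⟨i * C + j * D, by positivity, fun x hx => (abs_add_le _ _).trans ?_⟩
  rw [add_mul, mul_assoc, mul_assoc, abs_mul, abs_mul _ (_ * _), Nat.abs_cast, Nat.abs_cast]
  gcongr
  · exact hC x hx
  · exact hD x hx

/-! ### Inversion of first order Euler operators -/

/-- The integrals `∫_{t₀}^t s^(l - 1) ds` are dominated by `t^l`: either `t₀ = 0 < l`, or `t₀` is
the height of the cylinder and `l < 0`. -/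
def Adm (r t₀ l : ℝ) : Prop := (t₀ = 0 ∧ 0 < l) ∨ (t₀ = r ∧ l < 0)

/-- A right inverse of `t ∂_t + ν`, given by integration from the height `t₀`. -/
noncomputable def invOp (ν t₀ : ℝ) (ρ : Tan d × ℝ → ℝ) (x : Tan d × ℝ) : ℝ :=
  x.2 ^ (-ν) * ∫ s in t₀..x.2, s ^ (ν - 1) * ρ (x.1, s)

/-- Among the losses, small ones preserve `Adm`. -/
lemma adm_loss {t₀ l η : ℝ} {e : Bool} (h : Adm r t₀ l) (hη : η ∈ loss e) :
    ∃ η' ∈ loss e, η' ≤ η ∧ Adm r t₀ (l - η') := by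
  rcases h with ⟨h0, h⟩ | ⟨h0, h⟩
  · obtain ⟨η', h1, h2, h3⟩ := loss_small_le h hη
    exact ⟨η', h1, h2, Or.inl ⟨h0, by linarith⟩⟩
  · exact ⟨η, hη, le_rfl, Or.inr ⟨h0, by linarith [loss_nonneg hη]⟩⟩

section Integral

variable {ν κ t₀ C t : ℝ} {φ : ℝ → ℝ}

lemma ae_uIoc_mem (h : Adm r t₀ κ) (ht : t ∈ Ioo 0 r) :
    ∀ᵐ s ∂volume, s ∈ uIoc t₀ t → s ∈ Ioo 0 r := by
  have : ∀ᵐ s : ℝ, s ≠ r := by simp [ae_iff]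
  filter_upwards [this] with s hs hs'
  rcases h with ⟨rfl, _⟩ | ⟨rfl, _⟩
  · rw [uIoc_of_le ht.1.le] at hs'
    exact ⟨hs'.1, hs'.2.trans_lt ht.2⟩
  · rw [uIoc_of_ge ht.2.le] at hs'
    exact ⟨ht.1.trans hs'.1, lt_of_le_of_ne hs'.2 hs⟩

lemma aesm_uIoc {E : Type*} [NormedAddCommGroup E] {ψ : ℝ → E} (h : Adm r t₀ κ) (ht : t ∈ Ioo 0 r)
    (hψ : ContinuousOn ψ (Ioo 0 r)) : AEStronglyMeasurable ψ (volume.restrict (uIoc t₀ t)) := by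
  have h1 : AEStronglyMeasurable ψ (volume.restrict (Ioo 0 r)) :=
    hψ.aestronglyMeasurable measurableSet_Ioo
  refine h1.mono_measure ?_
  refine Measure.restrict_mono_ae ?_
  filter_upwards [ae_uIoc_mem h ht] with s hs using hs

lemma intervalIntegrable_weight (h : Adm r t₀ κ) (ht : t ∈ Ioo 0 r) :
    IntervalIntegrable (fun s : ℝ => s ^ (κ - 1)) volume t₀ t := by
  rcases h with ⟨rfl, h⟩ | ⟨rfl, _⟩
  · exact intervalIntegral.intervalIntegrable_rpow' (by linarith)
  · refine intervalIntegral.intervalIntegrable_rpow (Or.inr fun h => ?_)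
    rw [uIcc_of_ge ht.2.le] at h
    exact absurd h.1 (not_le.2 ht.1)

lemma abs_integral_weight_le (h : Adm r t₀ κ) (ht : t ∈ Ioo 0 r) :
    |∫ s in t₀..t, s ^ (κ - 1)| ≤ |κ|⁻¹ * t ^ κ := by
  have hκ : κ ≠ 0 := by rcases h with ⟨_, h⟩ | ⟨_, h⟩ <;> [exact h.ne'; exact h.ne]
  have ht0 := ht.1
  have hr : 0 < r := ht.1.trans ht.2
  rw [integral_rpow]
  · rw [sub_add_cancel, abs_div, div_eq_inv_mul]
    gcongr
    rcases h with ⟨rfl, h⟩ | ⟨rfl, h⟩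
    · rw [Real.zero_rpow hκ, sub_zero, abs_of_pos (by positivity)]
    · have h1 : t₀ ^ κ ≤ t ^ κ := Real.rpow_le_rpow_of_nonpos ht.1 ht.2.le h.le
      have h2 : 0 < t₀ ^ κ := by positivity
      rw [abs_of_nonneg (by linarith)]
      linarith
  · rcases h with ⟨rfl, h⟩ | ⟨rfl, h⟩
    · left; linarith
    · right
      refine ⟨fun h => hκ (by linarith), fun h => ?_⟩
      rw [uIcc_of_ge ht.2.le] at h
      exact absurd h.1 (not_le.2 ht.1)

lemma weight_bound (hφ : ∀ s ∈ Ioo 0 r, |φ s| ≤ C * s ^ κ) {s : ℝ} (hs : s ∈ Ioo 0 r) :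
    ‖s ^ (ν - 1) * φ s‖ ≤ C * s ^ (ν + κ - 1) := by
  have hs0 := hs.1
  rw [norm_mul, Real.norm_eq_abs, Real.norm_eq_abs, abs_of_pos (by positivity)]
  calc s ^ (ν - 1) * |φ s| ≤ s ^ (ν - 1) * (C * s ^ κ) := by gcongr; exact hφ s hs
    _ = C * (s ^ (ν - 1) * s ^ κ) := by ring
    _ = _ := by rw [← Real.rpow_add hs0]; ring_nf

lemma continuousOn_weight (hc : ContinuousOn φ (Ioo 0 r)) :
    ContinuousOn (fun s => s ^ (ν - 1) * φ s) (Ioo 0 r) :=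
  (ContinuousOn.rpow_const continuousOn_id fun _ hs => Or.inl (ne_of_gt hs.1)).mul hc

lemma intervalIntegrable_of_bound (h : Adm r t₀ (ν + κ)) (ht : t ∈ Ioo 0 r)
    (hc : ContinuousOn φ (Ioo 0 r)) (hφ : ∀ s ∈ Ioo 0 r, |φ s| ≤ C * s ^ κ) :
    IntervalIntegrable (fun s => s ^ (ν - 1) * φ s) volume t₀ t := by
  refine ((intervalIntegrable_weight h ht).const_mul C).mono_fun'
    (aesm_uIoc h ht (continuousOn_weight hc)) ?_
  rw [EventuallyLE, ae_restrict_iff' measurableSet_uIoc]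
  filter_upwards [ae_uIoc_mem h ht] with s hs hs'
  exact weight_bound hφ (hs hs')

lemma abs_integral_le_of_bound (h : Adm r t₀ (ν + κ)) (ht : t ∈ Ioo 0 r) (hC : 0 ≤ C)
    (hφ : ∀ s ∈ Ioo 0 r, |φ s| ≤ C * s ^ κ) :
    |∫ s in t₀..t, s ^ (ν - 1) * φ s| ≤ C * |ν + κ|⁻¹ * t ^ (ν + κ) := by
  have h1 := intervalIntegral.norm_integral_le_abs_of_norm_le
    (f := fun s => s ^ (ν - 1) * φ s) (g := fun s => C * s ^ (ν + κ - 1)) (a := t₀) (b := t)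
    (μ := volume) (by
      rw [ae_restrict_iff' measurableSet_uIoc]
      filter_upwards [ae_uIoc_mem h ht] with s hs hs'
      exact weight_bound hφ (hs hs')) ((intervalIntegrable_weight h ht).const_mul C)
  rw [Real.norm_eq_abs, intervalIntegral.integral_const_mul, abs_mul, abs_of_nonneg hC] at h1
  refine h1.trans ?_
  rw [mul_assoc]
  gcongr
  exact abs_integral_weight_le h ht

end Integral

section InvOp

variable {ν κ t₀ C : ℝ} {ρ : Tan d × ℝ → ℝ} {k : Fin d → Tan d × ℝ → ℝ}

lemma abs_invOp_le (h : Adm r t₀ (ν + κ)) (hC : 0 ≤ C) {φ : ℝ → ℝ} {t : ℝ} (ht : t ∈ Ioo 0 r)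
    (hφ : ∀ s ∈ Ioo 0 r, |φ s| ≤ C * s ^ κ) :
    |t ^ (-ν) * ∫ s in t₀..t, s ^ (ν - 1) * φ s| ≤ C * |ν + κ|⁻¹ * t ^ κ := by
  have ht0 := ht.1
  rw [abs_mul, abs_of_pos (by positivity)]
  calc _ ≤ t ^ (-ν) * (C * |ν + κ|⁻¹ * t ^ (ν + κ)) := by
        gcongr; exact abs_integral_le_of_bound h ht hC hφ
    _ = C * |ν + κ|⁻¹ * (t ^ (-ν) * t ^ (ν + κ)) := by ring
    _ = _ := by rw [← Real.rpow_add ht0]; ring_nf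

lemma isTheta_invOp (h : Adm r t₀ (ν + κ))
    (hc : ∀ y ∈ tanBall d r, ContinuousOn (fun s => ρ (y, s)) (Ioo 0 r))
    (hb : ∀ x ∈ cyl d r, |ρ x| ≤ C * x.2 ^ κ) :
    IsTheta r (invOp ν t₀ ρ) (fun x => ρ x + -ν * invOp ν t₀ ρ x) := by
  intro x hx
  have hx' := mem_cyl.1 hx
  have h0 := hx'.2.1
  have hI := intervalIntegrable_of_bound (φ := fun s => ρ (x.1, s)) h hx'.2 (hc _ hx'.1)
    (fun s hs => hb _ (mk_mem_cyl.2 ⟨hx'.1, hs⟩))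
  have hcw := continuousOn_weight (ν := ν) (hc _ hx'.1)
  have h1 := intervalIntegral.integral_hasDerivAt_right hI
    (hcw.stronglyMeasurableAtFilter isOpen_Ioo x.2 hx'.2)
    (hcw.continuousAt (isOpen_Ioo.mem_nhds hx'.2))
  refine ((Real.hasDerivAt_rpow_const (p := -ν) (Or.inl h0.ne')).mul h1).congr_deriv ?_
  have e1 : x.2 ^ (-ν - 1) = x.2 ^ (-ν) / x.2 := Real.rpow_sub_one h0.ne' _
  have e2 : x.2 ^ (-ν) * x.2 ^ (ν - 1) = x.2⁻¹ := by
    rw [← Real.rpow_add h0, ← Real.rpow_neg_one]; ring_nf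
  rw [e1, ← mul_assoc, e2]
  simp only [invOp]
  field_simp
  ring

lemma isGrad_invOp (h : Adm r t₀ (ν + κ)) (hk : IsGrad r ρ k)
    (hc : ∀ y ∈ tanBall d r, ContinuousOn (fun s => ρ (y, s)) (Ioo 0 r))
    (hb : ∀ x ∈ cyl d r, |ρ x| ≤ C * x.2 ^ κ)
    (hc' : ∀ a, ∀ y ∈ tanBall d r, ContinuousOn (fun s => k a (y, s)) (Ioo 0 r))
    (hb' : ∀ a, ∃ C, ∀ x ∈ cyl d r, |k a x| ≤ C * x.2 ^ κ) :
    IsGrad r (invOp ν t₀ ρ) (fun a => invOp ν t₀ (k a)) := by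
  choose D hD using hb'
  intro x hx
  have hx' := mem_cyl.1 hx
  have hI : ∀ a, IntervalIntegrable (fun s => s ^ (ν - 1) * k a (x.1, s)) volume t₀ x.2 := fun a =>
    intervalIntegrable_of_bound (φ := fun s => k a (x.1, s)) h hx'.2 (hc' a _ hx'.1)
      (fun s hs => hD a _ (mk_mem_cyl.2 ⟨hx'.1, hs⟩))
  have key := intervalIntegral.hasFDerivAt_integral_of_dominated_of_fderiv_le (𝕜 := ℝ)
    (μ := volume) (a := t₀) (b := x.2) (x₀ := x.1) (s := tanBall d r)
    (F := fun y s => s ^ (ν - 1) * ρ (y, s))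
    (F' := fun y s => ∑ a, (s ^ (ν - 1) * k a (y, s)) • (EuclideanSpace.proj a : Tan d →L[ℝ] ℝ))
    (bound := fun s => ∑ a, D a * s ^ (ν + κ - 1) *
      ‖(EuclideanSpace.proj a : Tan d →L[ℝ] ℝ)‖)
    (isOpen_tanBall.mem_nhds hx'.1) ?_ ?_ ?_ ?_ ?_ ?_
  · refine (key.const_mul (x.2 ^ (-ν))).congr_fderiv ?_
    rw [intervalIntegral.integral_finsetSum, Finset.smul_sum]
    · refine Finset.sum_congr rfl fun a _ => ?_
      rw [intervalIntegral.integral_smul_const, smul_smul]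
      rfl
    · intro a _
      exact ⟨(hI a).1.smul_const _, (hI a).2.smul_const _⟩
  · filter_upwards [isOpen_tanBall.mem_nhds hx'.1] with y hy
    exact aesm_uIoc h hx'.2 (continuousOn_weight (hc y hy))
  · exact intervalIntegrable_of_bound (φ := fun s => ρ (x.1, s)) h hx'.2 (hc _ hx'.1)
      (fun s hs => hb _ (mk_mem_cyl.2 ⟨hx'.1, hs⟩))
  · refine aesm_uIoc h hx'.2 (continuousOn_finsetSum _ fun a _ => ?_)
    exact (continuousOn_weight (hc' a _ hx'.1)).smul continuousOn_const
  · filter_upwards [ae_uIoc_mem h hx'.2] with s hs hs' y hy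
    refine (norm_sum_le _ _).trans (Finset.sum_le_sum fun a _ => ?_)
    rw [norm_smul]
    gcongr
    exact weight_bound (φ := fun s => k a (y, s))
      (fun s hs => hD a _ (mk_mem_cyl.2 ⟨hy, hs⟩)) (hs hs')
  · have : (fun s : ℝ => ∑ a, D a * s ^ (ν + κ - 1) *
        ‖(EuclideanSpace.proj a : Tan d →L[ℝ] ℝ)‖) =
        ∑ a, fun s : ℝ => D a * s ^ (ν + κ - 1) *
        ‖(EuclideanSpace.proj a : Tan d →L[ℝ] ℝ)‖ := by ext s; simp
    rw [this]
    refine IntervalIntegrable.sum _ fun a _ => ?_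
    exact ((intervalIntegrable_weight h hx'.2).const_mul (D a)).mul_const _
  · filter_upwards [ae_uIoc_mem h hx'.2] with s hs hs' y hy
    have := (hk (y, s) (mk_mem_cyl.2 ⟨hy, hs hs'⟩)).const_mul (s ^ (ν - 1))
    simpa only [Finset.smul_sum, smul_smul] using this

variable {S : Set ℝ} {e : Bool} {γ : ℝ}

lemma W.bd_le {η η' : ℝ} (hρ : ∃ C, 0 ≤ C ∧ ∀ x ∈ cyl d r, |ρ x| ≤ C * x.2 ^ (γ - η'))
    (h : η' ≤ η) : ∃ C, 0 ≤ C ∧ ∀ x ∈ cyl d r, |ρ x| ≤ C * x.2 ^ (γ - η) := by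
  obtain ⟨C, h0, hC⟩ := hρ
  by_cases hr : 0 < r
  · refine ⟨C * r ^ (γ - η' - (γ - η)), by positivity, fun x hx => (hC x hx).trans ?_⟩
    rw [mul_assoc]
    gcongr
    exact rpow_le_const (mem_cyl.1 hx).2.1 (mem_cyl.1 hx).2.2 (by linarith)
  · exact ⟨0, le_rfl, fun x hx => absurd ((mem_cyl.1 hx).2.1.trans (mem_cyl.1 hx).2.2) hr⟩

lemma W.isTheta_invOp (hρ : W r S e γ ρ) (h : Adm r t₀ (ν + γ)) :
    IsTheta r (invOp ν t₀ ρ) (fun x => ρ x + -ν * invOp ν t₀ ρ x) := by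
  obtain ⟨η, hη, _⟩ := loss_small e one_pos
  obtain ⟨η', h1, h2, h3⟩ := adm_loss h hη
  obtain ⟨C, _, hC⟩ := hρ.bd η' h1
  exact SingularExpansion.isTheta_invOp (κ := γ - η') (by convert h3 using 1; ring) hρ.cont hC

lemma W.isGrad_invOp (hρ : W r S e γ ρ) (hk : IsGrad r ρ k) (hk' : ∀ a, W r S e γ (k a))
    (h : Adm r t₀ (ν + γ)) :
    IsGrad r (invOp ν t₀ ρ) (fun a => invOp ν t₀ (k a)) := by
  obtain ⟨η, hη, _⟩ := loss_small e one_pos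
  obtain ⟨η', h1, h2, h3⟩ := adm_loss h hη
  obtain ⟨C, _, hC⟩ := hρ.bd η' h1
  refine SingularExpansion.isGrad_invOp (κ := γ - η') (by convert h3 using 1; ring) hk hρ.cont hC
    (fun a => (hk' a).cont) (fun a => ?_)
  obtain ⟨D, _, hD⟩ := (hk' a).bd η' h1
  exact ⟨D, hD⟩

lemma W.hol_tan {f : Tan d × ℝ → ℝ} (hf : W r S e γ f) {ε η : ℝ} (hε : ε ∈ S) (hη : η ∈ loss e) :
    ∃ C, 0 ≤ C ∧ ∀ y ∈ tanBall d r, ∀ y' ∈ tanBall d r,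
      ∀ t ∈ Ioo 0 r, |f (y, t) - f (y', t)| ≤ C * t ^ (γ - ε - η) * ‖y - y'‖ ^ ε := by
  obtain ⟨C, h0, hC⟩ := hf.hol ε hε η hη
  refine ⟨C, h0, fun y hy y' hy' t ht => ?_⟩
  have := hC (y, t) (mk_mem_cyl.2 ⟨hy, ht⟩) (y', t) (mk_mem_cyl.2 ⟨hy', ht⟩) le_rfl
    (by simp only; linarith [ht.1])
  simpa using this

lemma W.invOp (hS : S ⊆ Ioc 0 1) (hρ : W r S e γ ρ) (h : Adm r t₀ (ν + γ))
    (hA : ∀ ε ∈ S, Adm r t₀ (ν + γ - ε)) : W r S e γ (invOp ν t₀ ρ) := by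
  have hb : ∀ η ∈ loss e, ∃ C, 0 ≤ C ∧ ∀ x ∈ cyl d r,
      |SingularExpansion.invOp ν t₀ ρ x| ≤ C * x.2 ^ (γ - η) := by
    intro η hη
    obtain ⟨η', h1, h2, h3⟩ := adm_loss h hη
    obtain ⟨C, h0, hC⟩ := hρ.bd η' h1
    refine W.bd_le ⟨C * |ν + (γ - η')|⁻¹, by positivity, fun x hx => ?_⟩ h2
    have hx' := mem_cyl.1 hx
    exact abs_invOp_le (φ := fun s => ρ (x.1, s)) (by convert h3 using 1; ring) h0 hx'.2
      (fun s hs => hC _ (mk_mem_cyl.2 ⟨hx'.1, hs⟩))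
  refine W.of_theta hS (hρ.isTheta_invOp h) hb (fun η hη => ?_) (fun ε hε η hη => ?_)
  · obtain ⟨C, h0, hC⟩ := hb η hη
    obtain ⟨D, h0', hD⟩ := hρ.bd η hη
    refine ⟨D + |ν| * C, by positivity, fun x hx => (abs_add_le _ _).trans ?_⟩
    rw [add_mul, abs_mul, abs_neg, mul_assoc]
    exact add_le_add (hD x hx) (mul_le_mul_of_nonneg_left (hC x hx) (abs_nonneg _))
  · obtain ⟨η', h1, h2, h3⟩ := adm_loss (hA ε hε) hη
    obtain ⟨η₀, g1, g2, g3⟩ := adm_loss h hη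
    obtain ⟨C₀, _, hC₀⟩ := hρ.bd η₀ g1
    obtain ⟨C, h0, hC⟩ := hρ.hol_tan hε h1
    by_cases hr : 0 < r
    swap
    · exact ⟨0, le_rfl, fun y hy y' hy' t ht => absurd (ht.1.trans ht.2) hr⟩
    refine ⟨C * |ν + (γ - ε - η')|⁻¹ * r ^ (γ - ε - η' - (γ - ε - η)), by positivity,
      fun y hy y' hy' t ht => ?_⟩
    have i1 : ∀ y ∈ tanBall d r, IntervalIntegrable (fun s => s ^ (ν - 1) * ρ (y, s)) volume t₀ t :=
      fun y hy => intervalIntegrable_of_bound (φ := fun s => ρ (y, s)) (κ := γ - η₀)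
      (by convert g3 using 1; ring) ht (hρ.cont y hy)
      (fun s hs => hC₀ _ (mk_mem_cyl.2 ⟨hy, hs⟩))
    have e1 : SingularExpansion.invOp ν t₀ ρ (y, t) - SingularExpansion.invOp ν t₀ ρ (y', t) =
        t ^ (-ν) * ∫ s in t₀..t, s ^ (ν - 1) * (ρ (y, s) - ρ (y', s)) := by
      simp only [SingularExpansion.invOp]
      rw [← mul_sub, ← intervalIntegral.integral_sub (i1 y hy) (i1 y' hy')]
      simp only [mul_sub]
    rw [e1]
    have ht0 := ht.1
    refine (abs_invOp_le (φ := fun s => ρ (y, s) - ρ (y', s)) (κ := γ - ε - η')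
      (C := C * ‖y - y'‖ ^ ε) (by convert h3 using 1; ring) (by positivity) ht
      (fun s hs => ?_)).trans ?_
    · refine (hC y hy y' hy' s hs).trans (le_of_eq (by ring))
    · have := rpow_le_const (a := γ - ε - η') (b := γ - ε - η) ht.1 ht.2 (by linarith)
      calc _ ≤ C * ‖y - y'‖ ^ ε * |ν + (γ - ε - η')|⁻¹ *
            (r ^ (γ - ε - η' - (γ - ε - η)) * t ^ (γ - ε - η)) := by gcongr
        _ = _ := by ring

end InvOp

lemma W.congr' {S : Set ℝ} {e : Bool} {γ : ℝ} (f g : Tan d × ℝ → ℝ) (h : EqOn f g (cyl d r))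
    (hg : W r S e γ g) : W r S e γ f := hg.congr h

section RegW

variable {S S' : Set ℝ} {e e' : Bool} {γ γ' : ℝ} {f g ρ : Tan d × ℝ → ℝ} {m s : ℕ} {ν t₀ : ℝ}

lemma Reg.addW (h : Reg r (W r S e γ) m s f) (h' : Reg r (W r S e γ) m s g) :
    Reg r (W r S e γ) m s (fun x => f x + g x) := h.add (fun _ _ => W.add) h'

lemma Reg.const_mulW (c : ℝ) (h : Reg r (W r S e γ) m s f) :
    Reg r (W r S e γ) m s (fun x => c * f x) := h.const_mul (fun c _ => W.const_mul c) c

lemma Reg.mulW (h : Reg r (W r S e γ) m s f) (h' : Reg r (W r S e' γ') m s g) :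
    Reg r (W r S (e || e') (γ + γ')) m s (fun x => f x * g x) :=
  h.mul (fun _ _ => W.add) (fun _ _ => W.mul) h'

lemma Reg.congrW (h : Reg r (W r S e γ) m s g) (hfg : EqOn f g (cyl d r)) :
    Reg r (W r S e γ) m s f := h.congr W.congr' hfg

lemma Reg.weakenW (h : Reg r (W r S e γ) m s f) (hS : S' ⊆ S) (hd : Dom e γ e' γ') :
    Reg r (W r S' e' γ') m s f := h.imp fun _ hf => hf.weaken hS hd

lemma Reg.zeroW : Reg r (W r S e γ) m s (fun _ : Tan d × ℝ => 0) := by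
  refine Reg.of_family (fun _ _ f => f = fun _ => 0) ?_ ?_ ?_ _ _ _ rfl
  · rintro _ _ _ rfl; exact W.zero
  · rintro _ _ _ rfl; exact ⟨_, IsTheta.const 0, rfl⟩
  · rintro _ _ _ rfl; exact ⟨_, IsGrad.const 0, fun _ => rfl⟩

lemma Reg.sumW {ι : Type*} (A : Finset ι) {F : ι → Tan d × ℝ → ℝ}
    (h : ∀ i ∈ A, Reg r (W r S e γ) m s (F i)) :
    Reg r (W r S e γ) m s (fun x => ∑ i ∈ A, F i x) := by
  classical
  induction A using Finset.induction_on with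
  | empty => simpa using Reg.zeroW
  | insert i A hi ih =>
    simp only [Finset.sum_insert hi]
    exact (h i (Finset.mem_insert_self _ _)).addW
      (ih fun j hj => h j (Finset.mem_insert_of_mem hj))

lemma Reg.mono_logW (hr : 0 < r) (hS : S ⊆ Ioc 0 1) (i j : ℕ) (he : e = true ∨ j = 0) :
    Reg r (W r S e i) m s (fun x : Tan d × ℝ => x.2 ^ i * Real.log x.2 ^ j) := by
  refine Reg.of_family (fun _ _ f => ∃ (J : Finset ℕ) (c : ℕ → ℝ), (∀ j ∈ J, e = true ∨ j = 0) ∧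
    f = fun x => ∑ j ∈ J, c j * (x.2 ^ i * Real.log x.2 ^ j)) ?_ ?_ ?_ _ _ _
    ⟨{j}, fun _ => 1, by simpa using he, by ext; simp⟩
  · rintro _ _ _ ⟨J, c, hJ, rfl⟩
    have : Reg r (W r S e i) 0 0
        (fun x : Tan d × ℝ => ∑ j ∈ J, c j * (x.2 ^ i * Real.log x.2 ^ j)) :=
      Reg.sumW J fun j hj => (Reg.mk_zero (W.mono_log hr hS i j e (hJ j hj))).const_mulW (c j)
    exact this.base
  · rintro _ _ _ ⟨J, c, hJ, rfl⟩
    classical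
    refine ⟨fun x => ∑ j ∈ J, c j * (i * (x.2 ^ i * Real.log x.2 ^ j) +
      j * (x.2 ^ i * Real.log x.2 ^ (j - 1))), ?_, J ∪ J.image (· - 1),
      fun l => (if l ∈ J then c l * i else 0) + ∑ j ∈ J with j - 1 = l, c j * j, ?_, ?_⟩
    · intro x hx
      have := HasDerivAt.fun_sum (u := J) fun j hj =>
        (((isTheta_mono (d := d) (r := r) i j).const_mul (c j)) x hx)
      refine this.congr_deriv ?_
      rw [Finset.sum_div]
    · intro l hl
      rcases Finset.mem_union.1 hl with hl | hl
      · exact hJ l hl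
      · obtain ⟨j, hj, rfl⟩ := Finset.mem_image.1 hl
        exact (hJ j hj).imp_right fun h => by simp [h]
    · ext x
      simp only [mul_add, add_mul, Finset.sum_add_distrib]
      congr 1
      · simp only [ite_mul, zero_mul]
        rw [← Finset.sum_filter]
        refine Finset.sum_congr ?_ fun l _ => by ring
        ext l
        simp
      · have := Finset.sum_fiberwise_of_maps_to (s := J) (t := J ∪ J.image (· - 1))
          (g := fun j => j - 1)
          (fun j hj => Finset.mem_union_right _ (Finset.mem_image_of_mem _ hj))
          (fun j => c j * (j * (x.2 ^ i * Real.log x.2 ^ (j - 1))))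
        rw [← this]
        refine Finset.sum_congr rfl fun l _ => ?_
        rw [Finset.sum_mul]
        refine Finset.sum_congr rfl fun j hj => ?_
        rw [(Finset.mem_filter.1 hj).2]
        ring
  · rintro _ _ _ ⟨J, c, hJ, rfl⟩
    exact ⟨_, IsGrad.time (fun t => ∑ j ∈ J, c j * (t ^ i * Real.log t ^ j)),
      fun _ => ⟨∅, fun _ => 0, by simp, by simp⟩⟩

lemma Reg.powW (hr : 0 < r) (hS : S ⊆ Ioc 0 1) (i : ℕ) :
    Reg r (W r S e i) m s (fun x : Tan d × ℝ => x.2 ^ i) := by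
  have := Reg.mono_logW (d := d) (m := m) (s := s) (e := e) hr hS i 0 (Or.inr rfl)
  simpa using this

lemma Reg.invOp (hS : S ⊆ Ioc 0 1) (h : Adm r t₀ (ν + γ)) (hA : ∀ ε ∈ S, Adm r t₀ (ν + γ - ε))
    (hρ : Reg r (W r S e γ) m s ρ) : Reg r (W r S e γ) (m + 1) s (invOp ν t₀ ρ) := by
  have A : ∀ n m s ρ, m + s = n → Reg r (W r S e γ) m s ρ →
      Reg r (W r S e γ) m s (SingularExpansion.invOp (d := d) ν t₀ ρ) := by
    intro n
    induction n with
    | zero =>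
      intro m s ρ hn hρ
      obtain ⟨rfl, rfl⟩ : m = 0 ∧ s = 0 := by omega
      exact Reg.mk_zero (hρ.base.invOp hS h hA)
    | succ n ih =>
      intro m s ρ hn hρ
      rw [Reg]
      refine ⟨hρ.base.invOp hS h hA, ?_, ?_⟩
      · rintro m' rfl
        have h1 := hρ.mono (Nat.le_succ m') le_rfl
        exact ⟨_, hρ.base.isTheta_invOp h, h1.addW ((ih _ _ _ (by omega) h1).const_mulW (-ν))⟩
      · rintro s' rfl
        obtain ⟨k, hk, hk'⟩ := hρ.grad
        exact ⟨_, hρ.base.isGrad_invOp hk (fun a => (hk' a).base) h,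
          fun a => ih _ _ _ (by omega) (hk' a)⟩
  induction s generalizing ρ with
  | zero =>
    rw [Reg]
    refine ⟨hρ.base.invOp hS h hA, ?_, fun s' hs' => by omega⟩
    intro m' hm'
    obtain rfl : m = m' := by omega
    exact ⟨_, hρ.base.isTheta_invOp h, hρ.addW ((A _ _ _ _ rfl hρ).const_mulW (-ν))⟩
  | succ s ih =>
    rw [Reg]
    refine ⟨hρ.base.invOp hS h hA, ?_, ?_⟩
    · intro m' hm'
      obtain rfl : m = m' := by omega
      exact ⟨_, hρ.base.isTheta_invOp h, hρ.addW ((A _ _ _ _ rfl hρ).const_mulW (-ν))⟩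
    · intro s' hs'
      obtain rfl : s = s' := by omega
      obtain ⟨k, hk, hk'⟩ := hρ.grad
      exact ⟨_, hρ.base.isGrad_invOp hk (fun a => (hk' a).base) h, fun a => ih (hk' a)⟩

end RegW

/-! ### Coefficients: functions of the tangential variables -/

/-- Hölder regularity of order `s`, with exponents in `S`, of a function of the tangential
variables: as a function on the cylinder it has weight `0`. -/
def RegC (r : ℝ) (S : Set ℝ) (s : ℕ) (c : Tan d → ℝ) : Prop :=
  ∀ m, Reg r (W r S false 0) m s (fun x => c x.1)

section RegC

variable {S S' : Set ℝ} {s s' : ℕ} {c c' : Tan d → ℝ} {e : Bool} {γ : ℝ} {f : Tan d × ℝ → ℝ}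

lemma RegC.add (h : RegC r S s c) (h' : RegC r S s c') : RegC r S s (fun y => c y + c' y) :=
  fun m => (h m).addW (h' m)

lemma RegC.const_mul (b : ℝ) (h : RegC r S s c) : RegC r S s (fun y => b * c y) :=
  fun m => (h m).const_mulW b

lemma RegC.mul (h : RegC r S s c) (h' : RegC r S s c') : RegC r S s (fun y => c y * c' y) :=
  fun m => by simpa using (h m).mulW (h' m)

lemma RegC.zero : RegC r S s (fun _ : Tan d => 0) := fun _ => Reg.zeroW

lemma RegC.weaken (h : RegC r S s c) (hS : S' ⊆ S) (hs : s' ≤ s) : RegC r S' s' c :=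
  fun m => ((h m).weakenW hS (dom_of_le le_rfl)).mono le_rfl hs

lemma RegC.congr (h : RegC r S s c) (hc : EqOn c' c (tanBall d r)) : RegC r S s c' :=
  fun m => (h m).congrW fun _ hx => hc (mem_cyl.1 hx).1

/-- Restriction of a function on the cylinder to a horizontal slice. -/
lemma Reg.slice (hS : S ⊆ Ioc 0 1) {t₀ : ℝ} (ht₀ : t₀ ∈ Ioo 0 r)
    (h : Reg r (W r S e γ) 0 s f) : RegC r S s (fun y => f (y, t₀)) := by
  intro m
  have hr : 0 < r := ht₀.1.trans ht₀.2
  refine Reg.of_family (fun _ s F => ∃ f, Reg r (W r S e γ) 0 s f ∧ F = fun x => f (x.1, t₀))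
    ?_ ?_ ?_ _ _ _ ⟨f, h, rfl⟩
  · rintro _ _ _ ⟨f, hf, rfl⟩
    refine ⟨fun y _ => continuousOn_const (c := f (y, t₀)), fun η hη => ?_, fun ε hε η hη => ?_⟩
    · obtain ⟨η', hη', _⟩ := loss_small e one_pos
      obtain ⟨C, h0, hC⟩ := hf.base.bd η' hη'
      rw [mem_loss_false] at hη
      have := ht₀.1
      refine ⟨C * t₀ ^ (γ - η'), by positivity, fun x hx => ?_⟩
      rw [hη]
      simpa using hC (x.1, t₀) (mk_mem_cyl.2 ⟨(mem_cyl.1 hx).1, ht₀⟩)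
    · obtain ⟨η', hη', _⟩ := loss_small e one_pos
      obtain ⟨C, h0, hC⟩ := hf.base.hol_tan hε hη'
      rw [mem_loss_false] at hη
      have := ht₀.1
      refine ⟨C * t₀ ^ (γ - ε - η') * r ^ ε, by positivity, fun x hx x' hx' _ _ => ?_⟩
      have hm := mem_cyl.1 hx
      have h1 := rpow_le_const (a := 0) (b := -ε) hm.2.1 hm.2.2 (by linarith [(hS hε).1])
      rw [Real.rpow_zero, sub_neg_eq_add, zero_add] at h1
      have h2 : ‖x.1 - x'.1‖ ≤ ‖x - x'‖ := norm_fst_le (x - x')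
      have hx2 := hm.2.1
      rw [hη, zero_sub, sub_zero]
      calc |f (x.1, t₀) - f (x'.1, t₀)|
          ≤ C * t₀ ^ (γ - ε - η') * ‖x.1 - x'.1‖ ^ ε := hC _ hm.1 _ (mem_cyl.1 hx').1 _ ht₀
        _ = C * t₀ ^ (γ - ε - η') * 1 * ‖x.1 - x'.1‖ ^ ε := by ring
        _ ≤ C * t₀ ^ (γ - ε - η') * (r ^ ε * x.2 ^ (-ε)) * ‖x - x'‖ ^ ε := by
            gcongr
            exact (hS hε).1.le
        _ = _ := by ring
  · rintro _ _ _ ⟨f, hf, rfl⟩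
    refine ⟨fun _ => 0, fun x hx => ?_, fun _ => 0, Reg.zeroW, rfl⟩
    simpa using hasDerivAt_const x.2 (f (x.1, t₀))
  · rintro _ _ _ ⟨f, hf, rfl⟩
    obtain ⟨k, hk, hk'⟩ := hf.grad
    exact ⟨fun a x => k a (x.1, t₀),
      fun x hx => hk (x.1, t₀) (mk_mem_cyl.2 ⟨(mem_cyl.1 hx).1, ht₀⟩), fun a => ⟨_, hk' a, rfl⟩⟩

lemma half_mem (hr : 0 < r) : r / 2 ∈ Ioo 0 r := ⟨by linarith, by linarith⟩

lemma RegC.hasFDerivAt (hr : 0 < r) (h : RegC r S (s + 1) c) {y : Tan d} (hy : y ∈ tanBall d r) :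
    HasFDerivAt c (∑ a, fderiv ℝ c y (EuclideanSpace.single a 1) •
      (EuclideanSpace.proj a : Tan d →L[ℝ] ℝ)) y := by
  obtain ⟨k, hk, _⟩ := (h 0).grad
  have h1 : DifferentiableAt ℝ c y :=
    (hk (y, r / 2) (mk_mem_cyl.2 ⟨hy, half_mem hr⟩)).differentiableAt
  rw [← clm_eq_sum_proj]
  exact h1.hasFDerivAt

lemma RegC.grad (hr : 0 < r) (hS : S ⊆ Ioc 0 1) (h : RegC r S (s + 1) c) (a : Fin d) :
    RegC r S s (fun y => fderiv ℝ c y (EuclideanSpace.single a 1)) := by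
  obtain ⟨k, hk, hk'⟩ := (h 0).grad
  refine ((hk' a).slice hS (half_mem hr)).congr fun y hy => ?_
  have := (hk (y, r / 2) (mk_mem_cyl.2 ⟨hy, half_mem hr⟩)).fderiv
  simp only at this
  rw [this, sum_proj_single]

end RegC

/-! ### Polyhomogeneous expansions -/

/-- The truncated polyhomogeneous series `∑_{i ≤ m} ∑_{j < n i} c i j t^i (log t)^j`. -/
noncomputable def polyLog (n : ℕ → ℕ) (m : ℕ) (c : ℕ → ℕ → Tan d → ℝ) (x : Tan d × ℝ) : ℝ :=
  ∑ i ∈ Finset.range (m + 1), ∑ j ∈ Finset.range (n i),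
    c i j x.1 * (x.2 ^ i * Real.log x.2 ^ j)

/-- `f` has the expansion of order `m` with coefficients `c` and remainder `R`: at most `n i` powers
of the logarithm accompany `t^i`, the coefficients are of class `C^{s,ε}` for all `ε < α`, those
with indices in `X` even of class `C^{s,α}`, and the remainder has weight `γ` together with
`q` derivatives `t ∂_t` and `s` tangential ones. -/
structure IsExp (r α : ℝ) (n : ℕ → ℕ) (X : ℕ → ℕ → Prop) (e : Bool) (m : ℕ) (γ : ℝ) (q s : ℕ)
    (c : ℕ → ℕ → Tan d → ℝ) (R f : Tan d × ℝ → ℝ) : Prop where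
  coeff : ∀ i j, RegC r (Ioo 0 α) s (c i j)
  exact_coeff : ∀ i j, X i j → RegC r (Ioc 0 α) s (c i j)
  rem : Reg r (W r (Ioo 0 α) e γ) q s R
  eq : ∀ x ∈ cyl d r, f x = polyLog n m c x + R x

/-- Existence of an expansion in the sense of `IsExp`. -/
def HasExp (r α : ℝ) (n : ℕ → ℕ) (X : ℕ → ℕ → Prop) (e : Bool) (m : ℕ) (γ : ℝ) (q s : ℕ)
    (f : Tan d × ℝ → ℝ) : Prop :=
  ∃ c R, IsExp r α n X e m γ q s c R f

section HasExp

variable {α : ℝ} {n n' n₁ n₂ n₃ : ℕ → ℕ} {X X' X₁ X₂ X₃ : ℕ → ℕ → Prop} {e e' e₁ e₂ e₃ : Bool}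
  {m m' q q' s s' i j : ℕ} {γ γ' γ₁ γ₂ γ₃ : ℝ} {f g R : Tan d × ℝ → ℝ} {c : Tan d → ℝ}

lemma Ioo_sub (hα1 : α < 1) : Ioo 0 α ⊆ Ioc 0 1 := fun _ h => ⟨h.1, (h.2.trans hα1).le⟩

lemma Ioc_sub (hα1 : α < 1) : Ioc 0 α ⊆ Ioc 0 1 := fun _ h => ⟨h.1, h.2.trans hα1.le⟩

lemma HasExp.congr (h : HasExp r α n X e m γ q s g) (hf : EqOn f g (cyl d r)) :
    HasExp r α n X e m γ q s f := by
  obtain ⟨c, R, h1, h2, h3, h4⟩ := h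
  exact ⟨c, R, h1, h2, h3, fun x hx => by rw [hf hx]; exact h4 x hx⟩

lemma HasExp.add (h : HasExp r α n X e m γ q s f) (h' : HasExp r α n X e m γ q s g) :
    HasExp r α n X e m γ q s (fun x => f x + g x) := by
  obtain ⟨c, R, h1, h2, h3, h4⟩ := h
  obtain ⟨c', R', h1', h2', h3', h4'⟩ := h'
  refine ⟨fun i j y => c i j y + c' i j y, fun x => R x + R' x,
    fun i j => (h1 i j).add (h1' i j), fun i j hX => (h2 i j hX).add (h2' i j hX), h3.addW h3',
    fun x hx => ?_⟩
  rw [h4 x hx, h4' x hx]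
  simp only [polyLog, add_mul, Finset.sum_add_distrib]
  ring

lemma HasExp.const_mul (b : ℝ) (h : HasExp r α n X e m γ q s f) :
    HasExp r α n X e m γ q s (fun x => b * f x) := by
  obtain ⟨c, R, h1, h2, h3, h4⟩ := h
  refine ⟨fun i j y => b * c i j y, fun x => b * R x,
    fun i j => (h1 i j).const_mul b, fun i j hX => (h2 i j hX).const_mul b, h3.const_mulW b,
    fun x hx => ?_⟩
  rw [h4 x hx]
  simp only [polyLog, mul_add, Finset.mul_sum, mul_assoc]

lemma HasExp.of_rem (h : Reg r (W r (Ioo 0 α) e γ) q s R) : HasExp r α n X e m γ q s R :=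
  ⟨fun _ _ _ => 0, R, fun _ _ => RegC.zero, fun _ _ _ => RegC.zero, h,
    fun x hx => by simp [polyLog]⟩

lemma HasExp.sum {ι : Type*} (A : Finset ι) {F : ι → Tan d × ℝ → ℝ}
    (h : ∀ i ∈ A, HasExp r α n X e m γ q s (F i)) :
    HasExp r α n X e m γ q s (fun x => ∑ i ∈ A, F i x) := by
  classical
  induction A using Finset.induction_on with
  | empty => simpa using HasExp.of_rem Reg.zeroW
  | insert i A hi ih =>
    simp only [Finset.sum_insert hi]
    exact (h i (Finset.mem_insert_self _ _)).add
      (ih fun j hj => h j (Finset.mem_insert_of_mem hj))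

lemma RegC.mono_logW (hr : 0 < r) {S : Set ℝ} (hS : S ⊆ Ioc 0 1) (hc : RegC r S s c)
    (he : e = true ∨ j = 0) :
    Reg r (W r S e i) q s (fun x : Tan d × ℝ => c x.1 * (x.2 ^ i * Real.log x.2 ^ j)) := by
  have := (hc q).mulW (Reg.mono_logW (d := d) (m := q) (s := s) hr hS i j he)
  simpa using this

/-- A single term belongs to every class of expansions that allows for it; a term of high order is
part of the remainder. -/
lemma HasExp.of_term (hr : 0 < r) (hα1 : α < 1) (hc : RegC r (Ioo 0 α) s c)
    (hl : i ≤ m → j < n i ∧ (X i j → RegC r (Ioc 0 α) s c)) (hh : m < i → γ < i) :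
    HasExp r α n X e m γ q s
      (fun x : Tan d × ℝ => c x.1 * (x.2 ^ i * Real.log x.2 ^ j)) := by
  by_cases him : i ≤ m
  · obtain ⟨hj, hX⟩ := hl him
    refine ⟨fun i' j' => if i' = i ∧ j' = j then c else fun _ => 0, fun _ => 0, ?_, ?_,
      Reg.zeroW, fun x hx => ?_⟩
    · intro i' j'
      split_ifs
      exacts [hc, RegC.zero]
    · intro i' j' hX'
      split_ifs with h
      · exact hX (h.1 ▸ h.2 ▸ hX')
      · exact RegC.zero
    · rw [add_zero, polyLog, Finset.sum_eq_single_of_mem i (by simp; omega),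
        Finset.sum_eq_single_of_mem j (by simpa using hj)]
      · simp
      · intro j' _ hj'
        simp [hj']
      · intro i' _ hi'
        simp [hi']
  · push Not at him
    exact HasExp.of_rem ((hc.mono_logW hr (Ioo_sub hα1) (e := true) (Or.inl rfl)).weakenW
      Subset.rfl (dom_of_lt (hh him)))

lemma HasExp.of_polyLog (hr : 0 < r) (hα1 : α < 1) {c : ℕ → ℕ → Tan d → ℝ}
    (hc : ∀ i j, RegC r (Ioo 0 α) s (c i j)) (hcX : ∀ i j, X i j → RegC r (Ioc 0 α) s (c i j))
    (hn : ∀ i ≤ m', n i ≤ n' i) (hX : ∀ i j, j < n i → X' i j → X i j)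
    (hh : m' < m → γ < m' + 1) : HasExp r α n' X' e m' γ q s (polyLog n m c) := by
  refine HasExp.sum _ fun i hi => HasExp.sum _ fun j hj => ?_
  refine HasExp.of_term hr hα1 (hc i j)
    (fun h => ⟨?_, fun hx => hcX i j (hX i j (Finset.mem_range.1 hj) hx)⟩) fun h => ?_
  · exact (Finset.mem_range.1 hj).trans_le (hn i h)
  · rw [Finset.mem_range] at hi
    have h1 := hh (by omega)
    have : ((m' + 1 : ℕ) : ℝ) ≤ i := by exact_mod_cast h
    push_cast at this
    linarith

lemma HasExp.weaken (hr : 0 < r) (hα1 : α < 1) (h : HasExp r α n X e m γ q s f)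
    (hn : ∀ i ≤ m', n i ≤ n' i) (hX : ∀ i j, j < n i → X' i j → X i j) (hd : Dom e γ e' γ')
    (hh : m' < m → γ' < m' + 1) (hq : q' ≤ q) (hs : s' ≤ s) :
    HasExp r α n' X' e' m' γ' q' s' f := by
  obtain ⟨c, R, h1, h2, h3, h4⟩ := h
  refine HasExp.congr (HasExp.add (HasExp.of_polyLog hr hα1
    (fun i j => (h1 i j).weaken Subset.rfl hs)
    (fun i j hX => (h2 i j hX).weaken Subset.rfl hs) hn hX hh)
    (HasExp.of_rem ((h3.weakenW Subset.rfl hd).mono hq hs))) h4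

lemma Reg.mul_termW (hr : 0 < r) {S : Set ℝ} (hS : S ⊆ Ioc 0 1) (hc : RegC r S s c)
    (hR : Reg r (W r S e γ) q s R) (hj : j < n i)
    (h : (Dom e γ e' γ' ∧ n 0 ≤ 1) ∨ Dom true γ e' γ') :
    Reg r (W r S e' γ') q s (fun x => R x * (c x.1 * (x.2 ^ i * Real.log x.2 ^ j))) := by
  rcases h with ⟨h1, h2⟩ | h
  · have h3 : Reg r (W r S false 0) q s
        (fun x : Tan d × ℝ => c x.1 * (x.2 ^ i * Real.log x.2 ^ j)) := by
      rcases Nat.eq_zero_or_pos i with rfl | hi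
      · obtain rfl : j = 0 := by omega
        simpa using hc.mono_logW (q := q) (i := 0) (j := 0) (e := false) hr hS (Or.inr rfl)
      · refine (hc.mono_logW hr hS (e := true) (Or.inl rfl)).weakenW Subset.rfl (dom_of_lt ?_)
        exact_mod_cast hi
    have h4 := hR.mulW h3
    rw [Bool.or_false, add_zero] at h4
    exact h4.weakenW Subset.rfl h1
  · have h4 := hR.mulW (hc.mono_logW (q := q) (i := i) (j := j) hr hS (e := true) (Or.inl rfl))
    rw [Bool.or_true] at h4
    refine (h4.weakenW Subset.rfl (dom_of_le ?_)).weakenW Subset.rfl h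
    linarith [Nat.cast_nonneg (α := ℝ) i]

/-- Products of expansions. A logarithm at order `0` in one factor spoils the exact weight of the
remainder of the other one, unless there is room between the weights. -/
lemma HasExp.mul (hr : 0 < r) (hα1 : α < 1)
    (h : HasExp r α n₁ X₁ e₁ m γ₁ q s f) (h' : HasExp r α n₂ X₂ e₂ m γ₂ q s g)
    (hn : ∀ i j a b, a < n₁ i → b < n₂ j → i + j ≤ m → a + b < n₃ (i + j))
    (hX : ∀ i j a b, X₃ (i + j) (a + b) → X₁ i a ∧ X₂ j b)
    (hγ₂ : 0 < γ₂) (hγ₁ : γ₃ ≤ γ₁) (hγ₃ : γ₃ < m + 1)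
    (h₁ : (Dom e₁ γ₁ e₃ γ₃ ∧ n₂ 0 ≤ 1) ∨ Dom true γ₁ e₃ γ₃)
    (h₂ : (Dom e₂ γ₂ e₃ γ₃ ∧ n₁ 0 ≤ 1) ∨ Dom true γ₂ e₃ γ₃) :
    HasExp r α n₃ X₃ e₃ m γ₃ q s (fun x => f x * g x) := by
  obtain ⟨c, R, c1, c2, c3, c4⟩ := h
  obtain ⟨c', R', c1', c2', c3', c4'⟩ := h'
  have hS := Ioo_sub hα1
  have hPP : HasExp r α n₃ X₃ e₃ m γ₃ q s (fun x => polyLog n₁ m c x * polyLog n₂ m c' x) := by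
    have : (fun x => polyLog n₁ m c x * polyLog n₂ m c' x) = fun x =>
        ∑ i ∈ Finset.range (m + 1), ∑ a ∈ Finset.range (n₁ i), ∑ j ∈ Finset.range (m + 1),
          ∑ b ∈ Finset.range (n₂ j),
          (c i a x.1 * c' j b x.1) * (x.2 ^ (i + j) * Real.log x.2 ^ (a + b)) := by
      ext x
      simp only [polyLog, Finset.sum_mul]
      simp only [Finset.mul_sum]
      refine Finset.sum_congr rfl fun i _ => Finset.sum_congr rfl fun a _ =>
        Finset.sum_congr rfl fun j _ => Finset.sum_congr rfl fun b _ => by ring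
    rw [this]
    refine HasExp.sum _ fun i _ => HasExp.sum _ fun a ha => HasExp.sum _ fun j _ =>
      HasExp.sum _ fun b hb => ?_
    refine HasExp.of_term (c := fun y => c i a y * c' j b y) hr hα1 ((c1 i a).mul (c1' j b))
      (fun hm => ⟨hn i j a b (Finset.mem_range.1 ha) (Finset.mem_range.1 hb) hm, fun hx => ?_⟩)
      (fun hm => ?_)
    · obtain ⟨x1, x2⟩ := hX i j a b hx
      exact (c2 i a x1).mul (c2' j b x2)
    · have : ((m + 1 : ℕ) : ℝ) ≤ (i + j : ℕ) := by exact_mod_cast hm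
      rw [Nat.cast_add_one] at this
      linarith
  have hRP : Reg r (W r (Ioo 0 α) e₃ γ₃) q s (fun x => R x * polyLog n₂ m c' x) := by
    simp only [polyLog, Finset.mul_sum]
    exact Reg.sumW _ fun j _ => Reg.sumW _ fun b hb =>
      Reg.mul_termW hr hS (c1' j b) c3 (Finset.mem_range.1 hb) h₁
  have hPR : Reg r (W r (Ioo 0 α) e₃ γ₃) q s (fun x => R' x * polyLog n₁ m c x) := by
    simp only [polyLog, Finset.mul_sum]
    exact Reg.sumW _ fun j _ => Reg.sumW _ fun b hb =>
      Reg.mul_termW hr hS (c1 j b) c3' (Finset.mem_range.1 hb) h₂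
  have hRR : Reg r (W r (Ioo 0 α) e₃ γ₃) q s (fun x => R x * R' x) :=
    (c3.mulW c3').weakenW Subset.rfl (dom_of_lt (by linarith))
  refine (hPP.add (HasExp.of_rem ((hRP.addW hPR).addW hRR))).congr fun x hx => ?_
  rw [c4 x hx, c4' x hx]
  ring

lemma HasExp.time_mul (hr : 0 < r) (hα1 : α < 1) (h : HasExp r α n X e m γ q s f)
    (hn : ∀ i ≤ m, n i ≤ n' (i + 1)) (hX : ∀ i j, X' (i + 1) j → X i j) :
    HasExp r α n' X' e (m + 1) (γ + 1) q s (fun x => x.2 * f x) := by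
  obtain ⟨c, R, c1, c2, c3, c4⟩ := h
  have h1 : HasExp r α n' X' e (m + 1) (γ + 1) q s (fun x => x.2 * polyLog n m c x) := by
    simp only [polyLog, Finset.mul_sum]
    refine HasExp.sum _ fun i hi => HasExp.sum _ fun j hj => ?_
    rw [Finset.mem_range] at hi hj
    have := HasExp.of_term (n := n') (X := X') (e := e) (q := q) (m := m + 1) (i := i + 1) (j := j)
      (γ := γ + 1) hr hα1 (c1 i j)
      (fun _ => ⟨hj.trans_le (hn i (by omega)), fun hx => c2 i j (hX i j hx)⟩) (fun h => by omega)
    exact this.congr fun x _ => by ring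
  have h2 : Reg r (W r (Ioo 0 α) e (γ + 1)) q s (fun x : Tan d × ℝ => x.2 ^ 1 * R x) := by
    have := (Reg.powW (d := d) (m := q) (s := s) (e := false) hr (Ioo_sub hα1) 1).mulW c3
    rw [Bool.false_or] at this
    exact this.weakenW Subset.rfl (dom_of_le (by push_cast; linarith))
  refine (h1.add (HasExp.of_rem h2)).congr fun x hx => ?_
  rw [c4 x hx]
  ring

lemma IsTheta.sum {ι : Type*} (A : Finset ι) {F G : ι → Tan d × ℝ → ℝ}
    (h : ∀ i ∈ A, IsTheta r (F i) (G i)) :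
    IsTheta r (fun x => ∑ i ∈ A, F i x) (fun x => ∑ i ∈ A, G i x) := fun x hx => by
  refine (HasDerivAt.fun_sum fun i hi => h i hi x hx).congr_deriv ?_
  rw [Finset.sum_div]

lemma IsGrad.sum {ι : Type*} (A : Finset ι) {F : ι → Tan d × ℝ → ℝ}
    {G : ι → Fin d → Tan d × ℝ → ℝ} (h : ∀ i ∈ A, IsGrad r (F i) (G i)) :
    IsGrad r (fun x => ∑ i ∈ A, F i x) (fun a x => ∑ i ∈ A, G i a x) := fun x hx => by
  refine (HasFDerivAt.fun_sum fun i hi => h i hi x hx).congr_fderiv ?_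
  rw [Finset.sum_comm]
  simp only [Finset.sum_smul]

lemma isTheta_term (c : Tan d → ℝ) (i j : ℕ) :
    IsTheta r (fun x : Tan d × ℝ => c x.1 * (x.2 ^ i * Real.log x.2 ^ j))
      (fun x => i * (c x.1 * (x.2 ^ i * Real.log x.2 ^ j)) +
        j * (c x.1 * (x.2 ^ i * Real.log x.2 ^ (j - 1)))) := fun x hx => by
  refine (((isTheta_mono (d := d) (r := r) i j) x hx).const_mul (c x.1)).congr_deriv ?_
  ring

lemma HasExp.theta (hr : 0 < r) (hα1 : α < 1) (h : HasExp r α n X e m γ (q + 1) s f)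
    (hX : ∀ i j, X i j → X i (j + 1)) :
    ∃ g, IsTheta r f g ∧ HasExp r α n X e m γ q s g := by
  obtain ⟨c, R, c1, c2, c3, c4⟩ := h
  obtain ⟨g, hg, hg'⟩ := c3.theta
  refine ⟨_, ((IsTheta.sum _ fun i hi => IsTheta.sum _ fun j hj =>
    isTheta_term (c i j) i j).add hg).congr (fun x hx => c4 x hx) (eqOn_refl _ _), ?_⟩
  refine HasExp.add (HasExp.sum _ fun i hi => HasExp.sum _ fun j hj => ?_) (HasExp.of_rem hg')
  rw [Finset.mem_range] at hi hj
  refine HasExp.add (HasExp.const_mul _ ?_) ?_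
  · exact HasExp.of_term hr hα1 (c1 i j) (fun _ => ⟨hj, c2 i j⟩) (fun h => by omega)
  · rcases Nat.eq_zero_or_pos j with rfl | hj0
    · simpa using HasExp.of_rem Reg.zeroW
    · refine HasExp.const_mul _ ?_
      refine HasExp.of_term hr hα1 (c1 i j) (fun _ => ⟨by omega, fun hx => c2 i j ?_⟩)
        (fun h => by omega)
      have := hX i (j - 1) hx
      rwa [Nat.sub_add_cancel hj0] at this

lemma HasExp.grad (hr : 0 < r) (hα1 : α < 1) (h : HasExp r α n X e m γ q (s + 1) f) :
    ∃ k : Fin d → Tan d × ℝ → ℝ, IsGrad r f k ∧ ∀ a, HasExp r α n X e m γ q s (k a) := by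
  obtain ⟨c, R, c1, c2, c3, c4⟩ := h
  obtain ⟨k, hk, hk'⟩ := c3.grad
  have hg : ∀ i j, IsGrad r (fun x : Tan d × ℝ => c i j x.1 * (x.2 ^ i * Real.log x.2 ^ j))
      (fun a x => fderiv ℝ (c i j) x.1 (EuclideanSpace.single a 1) *
        (x.2 ^ i * Real.log x.2 ^ j)) := fun i j x hx => by
    have := ((c1 i j).hasFDerivAt hr (mem_cyl.1 hx).1).mul_const (x.2 ^ i * Real.log x.2 ^ j)
    refine this.congr_fderiv ?_
    simp only [Finset.smul_sum, smul_smul]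
    exact Finset.sum_congr rfl fun a _ => by rw [mul_comm]
  refine ⟨_, ((IsGrad.sum _ fun i hi => IsGrad.sum _ fun j hj => hg i j).add hk).congr
    (fun x hx => c4 x hx) (fun a => eqOn_refl _ _), fun a => ?_⟩
  refine HasExp.add (HasExp.sum _ fun i hi => HasExp.sum _ fun j hj => ?_)
    (HasExp.of_rem (hk' a))
  rw [Finset.mem_range] at hi hj
  exact HasExp.of_term (c := fun y => fderiv ℝ (c i j) y (EuclideanSpace.single a 1)) hr hα1
    ((c1 i j).grad hr (Ioo_sub hα1) a)
    (fun _ => ⟨hj, fun hx => (c2 i j hx).grad hr (Ioc_sub hα1) a⟩) (fun h => by omega)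

end HasExp

/-! ### Euler operators on expansions -/

section Inversion

variable {α : ℝ} {n n' : ℕ → ℕ} {X X' : ℕ → ℕ → Prop} {e e' : Bool}
  {m m' q q' s s' i j : ℕ} {γ γ' μ t₀ : ℝ} {f g h p w R : Tan d × ℝ → ℝ} {c : Tan d → ℝ}

lemma HasExp.reg (hr : 0 < r) (hα1 : α < 1) (h : HasExp r α n X e m γ q s f)
    (hn : ∀ i ≤ m, ∀ j < n i, Dom true i e' γ' ∨ (j = 0 ∧ Dom false i e' γ')) (hd : Dom e γ e' γ') :
    Reg r (W r (Ioo 0 α) e' γ') q s f := by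
  obtain ⟨c, R, c1, c2, c3, c4⟩ := h
  have h1 : Reg r (W r (Ioo 0 α) e' γ') q s (polyLog n m c) := by
    refine Reg.sumW _ fun i hi => Reg.sumW _ fun j hj => ?_
    rw [Finset.mem_range] at hi hj
    rcases hn i (by omega) j hj with h | ⟨h, h'⟩
    · exact ((c1 i j).mono_logW hr (Ioo_sub hα1) (e := true) (Or.inl rfl)).weakenW Subset.rfl h
    · exact ((c1 i j).mono_logW hr (Ioo_sub hα1) (e := false) (Or.inr h)).weakenW Subset.rfl h'
  exact (h1.addW (c3.weakenW Subset.rfl hd)).congrW c4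

lemma HasExp.reg_zero (hr : 0 < r) (hα1 : α < 1) (h : HasExp r α n X e m γ q s f) (hγ : 0 ≤ γ) :
    Reg r (W r (Ioo 0 α) true 0) q s f :=
  h.reg hr hα1 (fun i _ _ _ => Or.inl (dom_true (Nat.cast_nonneg i))) (dom_true hγ)

/-- The equation `(t ∂_t + μ) p = c t^i (log t)^j` has a solution of the same type, with an
additional logarithm in the resonant case `i = -μ`. -/
lemma HasExp.inv_term (hr : 0 < r) (hα1 : α < 1) (hc : RegC r (Ioo 0 α) s c) (hi : i ≤ m)
    (hj : j < n i) (hX : ∀ j', X' i j' → RegC r (Ioc 0 α) s c) (hn : n i ≤ n' i)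
    (hμ : i + μ = 0 → n i < n' i) :
    ∃ p, IsTheta r p (fun x => c x.1 * (x.2 ^ i * Real.log x.2 ^ j) + -μ * p x) ∧
      HasExp r α n' X' e m γ q s p := by
  have term : ∀ j < n' i, HasExp r α n' X' e m γ q s
      (fun x : Tan d × ℝ => c x.1 * (x.2 ^ i * Real.log x.2 ^ j)) := fun j hj =>
    HasExp.of_term hr hα1 hc (fun _ => ⟨hj, hX j⟩) (fun h => by omega)
  by_cases h0 : i + μ = 0
  · refine ⟨_, (isTheta_term c i (j + 1)).const_mul ((j : ℝ) + 1)⁻¹ |>.congr (eqOn_refl _ _) ?_,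
      (term (j + 1) (by have := hμ h0; omega)).const_mul _⟩
    intro x _
    have hμ' : -μ = i := by linarith
    have : (j : ℝ) + 1 ≠ 0 := by positivity
    simp only [hμ', Nat.add_sub_cancel]
    push_cast
    field_simp
    ring
  · induction j with
    | zero =>
      refine ⟨_, (isTheta_term c i 0).const_mul ((i : ℝ) + μ)⁻¹ |>.congr (eqOn_refl _ _) ?_,
        (term 0 (by omega)).const_mul _⟩
      intro x _
      simp
      field_simp
      ring
    | succ j ih =>
      obtain ⟨p, hp, hp'⟩ := ih (by omega)
      refine ⟨_, ((isTheta_term c i (j + 1)).add (hp.const_mul (-((j : ℝ) + 1)))).const_mul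
        ((i : ℝ) + μ)⁻¹ |>.congr (eqOn_refl _ _) ?_,
        ((term (j + 1) (by omega)).add (hp'.const_mul _)).const_mul _⟩
      intro x _
      simp only [Nat.add_sub_cancel]
      push_cast
      field_simp
      ring

/-- A particular solution of `(t ∂_t + μ) p = h` in the class of expansions. -/
lemma HasExp.inv (hr : 0 < r) (hα1 : α < 1) (h' : HasExp r α n X e m γ q s h)
    (hn : ∀ i ≤ m, n i ≤ n' i) (hμ : ∀ i : ℕ, i ≤ m → i + μ = 0 → n i = 0 ∨ n i < n' i)
    (hX : ∀ i j j', X' i j' → X i j) (hA : Adm r t₀ (μ + γ))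
    (hA' : ∀ ε ∈ Ioo 0 α, Adm r t₀ (μ + γ - ε)) :
    ∃ p, IsTheta r p (fun x => h x + -μ * p x) ∧ HasExp r α n' X' e m γ (q + 1) s p := by
  obtain ⟨c, R, c1, c2, c3, c4⟩ := h'
  have H : ∀ i j, ∃ p, i ≤ m → j < n i →
      IsTheta r p (fun x => c i j x.1 * (x.2 ^ i * Real.log x.2 ^ j) + -μ * p x) ∧
      HasExp r α n' X' e m γ (q + 1) s p := by
    intro i j
    by_cases hij : i ≤ m ∧ j < n i
    · obtain ⟨p, hp⟩ := HasExp.inv_term (q := q + 1) (m := m) (e := e) (γ := γ) (μ := μ)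
        hr hα1 (c1 i j) hij.1 hij.2
        (fun j' hj' => c2 i j (hX i j j' hj')) (hn i hij.1)
        (fun h => (hμ i hij.1 h).resolve_left (by omega))
      exact ⟨p, fun _ _ => hp⟩
    · exact ⟨0, fun h1 h2 => absurd ⟨h1, h2⟩ hij⟩
  choose p hp using H
  refine ⟨fun x => (∑ i ∈ Finset.range (m + 1), ∑ j ∈ Finset.range (n i), p i j x) +
    invOp μ t₀ R x, ?_, ?_⟩
  · refine ((IsTheta.sum _ fun i hi => IsTheta.sum _ fun j hj =>
      (hp i j (by rw [Finset.mem_range] at hi; omega) (Finset.mem_range.1 hj)).1).add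
      (c3.base.isTheta_invOp hA)).congr (eqOn_refl _ _) fun x hx => ?_
    simp only [c4 x hx, polyLog, mul_add, Finset.mul_sum, Finset.sum_add_distrib]
    ring
  · refine HasExp.add (HasExp.sum _ fun i hi => HasExp.sum _ fun j hj =>
      (hp i j (by rw [Finset.mem_range] at hi; omega) (Finset.mem_range.1 hj)).2)
      (HasExp.of_rem (c3.invOp (Ioo_sub hα1) hA hA'))

/-- Solutions of `(t ∂_t + μ) w = 0` are multiples of `t^(-μ)`. -/
lemma IsTheta.eq_of_homogeneous (hw : IsTheta r w (fun x => -μ * w x)) {y : Tan d}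
    (hy : y ∈ tanBall d r) {t t' : ℝ} (ht : t ∈ Ioo 0 r) (ht' : t' ∈ Ioo 0 r) :
    t ^ μ * w (y, t) = t' ^ μ * w (y, t') := by
  have hd : ∀ s ∈ Ioo 0 r, HasDerivAt (fun s => s ^ μ * w (y, s)) 0 s := by
    intro s hs
    refine ((Real.hasDerivAt_rpow_const (p := μ) (Or.inl hs.1.ne')).mul
      (hw (y, s) (mk_mem_cyl.2 ⟨hy, hs⟩))).congr_deriv ?_
    rw [Real.rpow_sub_one hs.1.ne']
    simp only
    ring
  exact isOpen_Ioo.is_const_of_deriv_eq_zero isPreconnected_Ioo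
    (fun s hs => (hd s hs).differentiableAt.differentiableWithinAt)
    (fun s hs => (hd s hs).deriv) ht ht'

lemma time_neBot (hr : 0 < r) : (𝓝[Ioo 0 r] (0 : ℝ)).NeBot := by
  rw [nhdsWithin_Ioo_eq_nhdsGT hr]; infer_instance

lemma IsTheta.eq_zero_of_homogeneous (hw : IsTheta r w (fun x => -μ * w x)) (hr : 0 < r)
    (h0 : ∀ y ∈ tanBall d r, Tendsto (fun t => t ^ μ * w (y, t)) (𝓝[Ioo 0 r] 0) (𝓝 0)) :
    EqOn w 0 (cyl d r) := by
  intro x hx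
  have hx' := mem_cyl.1 hx
  have h1 : Tendsto (fun t => t ^ μ * w (x.1, t)) (𝓝[Ioo 0 r] 0) (𝓝 (x.2 ^ μ * w x)) := by
    refine tendsto_const_nhds.congr' ?_
    filter_upwards [self_mem_nhdsWithin] with t ht
    exact hw.eq_of_homogeneous hx'.1 hx'.2 ht
  have := time_neBot hr
  have h2 := tendsto_nhds_unique h1 (h0 _ hx'.1)
  have h3 := hx'.2.1
  have h4 : x.2 ^ μ ≠ 0 := by positivity
  simpa [h4] using h2

lemma tendsto_rpow_time {a : ℝ} (ha : 0 < a) :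
    Tendsto (fun t : ℝ => t ^ a) (𝓝[Ioo 0 r] 0) (𝓝 0) := by
  have := (Real.continuousAt_rpow_const 0 a (Or.inr ha.le)).tendsto
  rw [Real.zero_rpow ha.ne'] at this
  exact this.mono_left nhdsWithin_le_nhds

lemma tendsto_zero_of_le {φ : ℝ → ℝ} {C a : ℝ} (ha : 0 < a)
    (h : ∀ t ∈ Ioo 0 r, |φ t| ≤ C * t ^ a) : Tendsto φ (𝓝[Ioo 0 r] 0) (𝓝 0) := by
  refine squeeze_zero_norm' ?_ (by simpa using (tendsto_rpow_time ha).const_mul C)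
  filter_upwards [self_mem_nhdsWithin] with t ht using h t ht

lemma W.tendsto {S : Set ℝ} (hf : W r S e γ f) {μ : ℝ} (hμ : 0 < μ + γ) {y : Tan d}
    (hy : y ∈ tanBall d r) : Tendsto (fun t => t ^ μ * f (y, t)) (𝓝[Ioo 0 r] 0) (𝓝 0) := by
  obtain ⟨η, hη, h1⟩ := loss_small e hμ
  obtain ⟨C, h0, hC⟩ := hf.bd η hη
  refine tendsto_zero_of_le (C := C) (a := μ + γ - η) (by linarith) fun t ht => ?_
  have ht0 := ht.1
  rw [abs_mul, abs_of_pos (by positivity)]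
  calc t ^ μ * |f (y, t)| ≤ t ^ μ * (C * t ^ (γ - η)) := by
        gcongr; exact hC (y, t) (mk_mem_cyl.2 ⟨hy, ht⟩)
    _ = C * (t ^ μ * t ^ (γ - η)) := by ring
    _ = _ := by rw [← Real.rpow_add ht0]; ring_nf

lemma IsTheta.sub_homogeneous (hg : IsTheta r g (fun x => h x + -μ * g x))
    (hp : IsTheta r p (fun x => h x + -μ * p x)) :
    IsTheta r (fun x => g x + -1 * p x) (fun x => -μ * (g x + -1 * p x)) :=
  (hg.add (hp.const_mul (-1))).congr (eqOn_refl _ _) fun x _ => by ring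

/-- Solutions of `(t ∂_t + μ) g = h` with `μ > 0` that do not contain the singular homogeneous
solution `t^(-μ)`. -/
lemma HasExp.solve_pos (hr : 0 < r) (hα : 0 < α) (hα1 : α < 1) (h' : HasExp r α n X e m γ q s h)
    (hX : ∀ i j j', X i j' → X i j) (hμ : 0 < μ) (hγ : α ≤ γ)
    (hg : IsTheta r g (fun x => h x + -μ * g x))
    (h0 : ∀ y ∈ tanBall d r, Tendsto (fun t => t ^ μ * g (y, t)) (𝓝[Ioo 0 r] 0) (𝓝 0)) :
    HasExp r α n X e m γ (q + 1) s g := by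
  obtain ⟨p, hp, hp'⟩ := h'.inv (n' := n) (X' := X) (μ := μ) (t₀ := 0) hr hα1 (fun i _ => le_rfl)
    (fun i _ hi => absurd hi (by positivity)) hX (Or.inl ⟨rfl, by linarith⟩)
    (fun ε hε => Or.inl ⟨rfl, by linarith [hε.2]⟩)
  refine hp'.congr fun x hx => ?_
  have hw := hg.sub_homogeneous hp
  have := hw.eq_zero_of_homogeneous hr (fun y hy => ?_) hx
  · simp only [Pi.zero_apply] at this; linarith
  · have h1 := (hp'.reg_zero hr hα1 (hα.le.trans hγ)).base.tendsto (μ := μ) (by linarith) hy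
    have h2 := (h0 y hy).add (h1.const_mul (-1))
    simp only [mul_zero, add_zero] at h2
    refine h2.congr fun t => by ring

/-- Solutions of `(t ∂_t - i₀) g = h`, for an integer `i₀ ≥ 0`. The constant of integration is the
coefficient of `t^{i₀}`. -/
lemma HasExp.solve_nonpos (hr : 0 < r) (hα : 0 < α) (hα1 : α < 1) (i₀ : ℕ)
    (h' : HasExp r α n X e m (m + α) q s h)
    (hn : ∀ i ≤ m, n i ≤ n' i) (hn' : n i₀ < n' i₀) (hX : ∀ i j j', X i j' → X i j)
    (hg : IsTheta r g (fun x => h x + i₀ * g x))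
    (hs : RegC r (Ioo 0 α) s (fun y => g (y, r / 2))) :
    HasExp r α n' (fun i j => X i j ∧ (i, j) ≠ (i₀, 0)) e m (m + α) (q + 1) s g := by
  obtain ⟨t₀, hA, hA'⟩ : ∃ t₀, Adm r t₀ (-(i₀ : ℝ) + (m + α)) ∧
      ∀ ε ∈ Ioo 0 α, Adm r t₀ (-(i₀ : ℝ) + (m + α) - ε) := by
    rcases le_or_gt i₀ m with h | h
    · have : (i₀ : ℝ) ≤ m := by exact_mod_cast h
      exact ⟨0, Or.inl ⟨rfl, by linarith⟩, fun ε hε => Or.inl ⟨rfl, by linarith [hε.2]⟩⟩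
    · have : ((m + 1 : ℕ) : ℝ) ≤ i₀ := by exact_mod_cast h
      push_cast at this
      exact ⟨r, Or.inr ⟨rfl, by linarith⟩, fun ε hε => Or.inr ⟨rfl, by linarith [hε.1]⟩⟩
  obtain ⟨p, hp, hp'⟩ := h'.inv (n' := n') (X' := X) (μ := -(i₀ : ℝ)) (t₀ := t₀) hr hα1 hn
    (fun i _ hi => by
      have : (i : ℝ) = i₀ := by linarith
      rw [Nat.cast_inj] at this
      rw [this]
      exact Or.inr hn') hX hA hA'
  have hw := (hg.congr (eqOn_refl _ _) (g' := fun x => h x + -(-(i₀ : ℝ)) * g x)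
    fun x _ => by ring).sub_homogeneous hp
  have hC : RegC r (Ioo 0 α) s
      (fun y => (r / 2) ^ (-(i₀ : ℝ)) * (g (y, r / 2) + -1 * p (y, r / 2))) := by
    have hp2 := ((hp'.reg_zero hr hα1 (by positivity)).mono (Nat.zero_le _) le_rfl).slice
      (Ioo_sub hα1) (half_mem hr)
    exact (hs.add (hp2.const_mul (-1))).const_mul _
  have h1 : HasExp r α n' (fun i j => X i j ∧ (i, j) ≠ (i₀, 0)) e m (m + α) (q + 1) s
      (fun x : Tan d × ℝ => (r / 2) ^ (-(i₀ : ℝ)) * (g (x.1, r / 2) + -1 * p (x.1, r / 2)) *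
        (x.2 ^ i₀ * Real.log x.2 ^ 0)) := by
    refine HasExp.of_term hr hα1 hC (fun hm => ⟨by omega, fun h => absurd rfl h.2⟩) fun h => ?_
    have : ((m + 1 : ℕ) : ℝ) ≤ i₀ := by exact_mod_cast h
    push_cast at this
    linarith
  refine ((hp'.weaken hr hα1 (fun i _ => le_rfl) (fun i j _ h => h.1) (dom_of_le le_rfl)
    (fun h => absurd h (lt_irrefl _)) le_rfl le_rfl).add h1).congr fun x hx => ?_
  have hx' := mem_cyl.1 hx
  have h2 := hw.eq_of_homogeneous hx'.1 hx'.2 (half_mem hr)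
  have h3 := hx'.2.1
  have h4 : x.2 ^ (-(i₀ : ℝ)) * x.2 ^ i₀ = 1 := by
    rw [Real.rpow_neg h3.le, Real.rpow_natCast]
    field_simp
  beta_reduce
  rw [← h2, pow_zero, mul_one]
  linear_combination (-(g x + -1 * p x)) * h4

/-- Integration of `t ∂_t g = t h`: the constant of integration is the boundary value of `g`. -/
lemma HasExp.integrate (hr : 0 < r) (hα : 0 < α) (hα1 : α < 1)
    (h' : HasExp r α n X e m (m + α) q s h)
    (hn : ∀ i ≤ m, n i ≤ n' (i + 1)) (hn0 : 0 < n' 0)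
    (hX : ∀ i j j', X' (i + 1) j' → X i j)
    (hg : IsTheta r g (fun x => x.2 * h x)) (hc : RegC r (Ioc 0 α) s c)
    (hlim : ∀ y ∈ tanBall d r, Tendsto (fun t => g (y, t)) (𝓝[Ioo 0 r] 0) (𝓝 (c y))) :
    HasExp r α n' X' e (m + 1) ((m + 1 : ℕ) + α) (q + 1) s g := by
  -- no logarithm-free term of order zero is allowed for `t h`, so that there is no resonance
  set n₀ : ℕ → ℕ := fun i => if i = 0 then 0 else n' i
  have h1 : HasExp r α n₀ (fun i j => i ≠ 0 ∧ ∃ j, X' i j) e (m + 1) ((m + 1 : ℕ) + α) q s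
      (fun x => x.2 * h x) := by
    have := h'.time_mul (n' := n₀) (X' := fun i j => i ≠ 0 ∧ ∃ j, X' i j) hr hα1
      (fun i hi => by simpa [n₀] using hn i hi) (fun i j h => by
        obtain ⟨_, j', h⟩ := h
        exact hX i j j' h)
    convert this using 1
    push_cast
    ring
  obtain ⟨p, hp, hp'⟩ := h1.inv (n' := n₀) (X' := fun i j => i ≠ 0 ∧ X' i j) (μ := 0) (t₀ := 0) hr
    hα1 (fun i _ => le_rfl)
    (fun i _ hi => Or.inl (by
      have : i = 0 := by exact_mod_cast (by linarith : (i : ℝ) = 0)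
      simp [n₀, this])) (fun i j j' h => ⟨h.1, j', h.2⟩)
    (Or.inl ⟨rfl, by positivity⟩) (fun ε hε => Or.inl ⟨rfl, by push_cast; linarith [hε.2]⟩)
  have hw := (hg.congr (eqOn_refl _ _) (g' := fun x => x.2 * h x + -0 * g x)
    fun x _ => by ring).sub_homogeneous hp
  have hp1 : Reg r (W r (Ioo 0 α) true 1) (q + 1) s p := by
    refine hp'.reg hr hα1 (fun i _ j hj => Or.inl (dom_true ?_)) (dom_true ?_)
    · have : i ≠ 0 := by rintro rfl; simp [n₀] at hj
      exact_mod_cast Nat.one_le_iff_ne_zero.2 this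
    · push_cast; linarith [Nat.cast_nonneg (α := ℝ) m]
  have h2 : HasExp r α n' X' e (m + 1) ((m + 1 : ℕ) + α) (q + 1) s
      (fun x : Tan d × ℝ => c x.1 * (x.2 ^ 0 * Real.log x.2 ^ 0)) :=
    HasExp.of_term hr hα1 (hc.weaken Ioo_subset_Ioc_self le_rfl) (fun _ => ⟨hn0, fun _ => hc⟩)
      (fun h => by omega)
  refine ((hp'.weaken (n' := n') (X' := X') hr hα1 (fun i _ => ?_) (fun i j hj h => ⟨?_, h⟩)
    (dom_of_le le_rfl) (fun h => absurd h (lt_irrefl _)) le_rfl le_rfl).add h2).congr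
    fun x hx => ?_
  · simp only [n₀]; split_ifs <;> omega
  · rintro rfl; simp [n₀] at hj
  have hx' := mem_cyl.1 hx
  have := time_neBot hr
  have h3 : Tendsto (fun t => g (x.1, t) + -1 * (t ^ (0 : ℝ) * p (x.1, t))) (𝓝[Ioo 0 r] 0)
      (𝓝 (c x.1 + -1 * 0)) :=
    (hlim _ hx'.1).add ((hp1.base.tendsto (by norm_num) hx'.1).const_mul (-1))
  have h4 : Tendsto (fun t => g (x.1, t) + -1 * (t ^ (0 : ℝ) * p (x.1, t))) (𝓝[Ioo 0 r] 0)
      (𝓝 (g x + -1 * p x)) := by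
    refine tendsto_const_nhds.congr' ?_
    filter_upwards [self_mem_nhdsWithin] with t ht
    simpa using hw.eq_of_homogeneous hx'.1 hx'.2 ht
  have h5 := tendsto_nhds_unique h3 h4
  simp only [pow_zero, mul_one]
  linarith

end Inversion

/-! ### Uniqueness of the coefficients -/

/-- Uniqueness of polyhomogeneous series, in the variable `x = -log t`. -/
lemma eq_zero_of_sum_exp_le {m : ℕ} {κ C : ℝ} (hκ : m < κ) (p : ℕ → Polynomial ℝ)
    (h : ∀ᶠ x : ℝ in atTop, |∑ i ∈ Finset.range (m + 1), (p i).eval x * Real.exp (-x) ^ i| ≤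
      C * Real.exp (-x) ^ κ) : ∀ i ≤ m, p i = 0 := by
  intro i
  induction i using Nat.strong_induction_on with
  | _ i ih =>
  intro him
  have hexp : ∀ a : ℝ, 0 < a → Tendsto (fun x => Real.exp (-x) ^ a) atTop (𝓝 0) := fun a ha => by
    have := (Real.tendsto_exp_neg_atTop_nhds_zero).rpow_const (p := a) (Or.inr ha.le)
    rwa [Real.zero_rpow ha.ne'] at this
  have h1 : Tendsto (fun x => (∑ i' ∈ Finset.range (m + 1), (p i').eval x * Real.exp (-x) ^ i') *
      Real.exp (-x) ^ (-(i : ℝ))) atTop (𝓝 0) := by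
    have hi : (i : ℝ) ≤ m := by exact_mod_cast him
    refine squeeze_zero_norm' ?_ (by simpa using (hexp (κ - i) (by linarith)).const_mul C)
    filter_upwards [h] with x hx
    rw [norm_mul, Real.norm_eq_abs, Real.norm_eq_abs, abs_of_pos (by positivity : 0 <
      Real.exp (-x) ^ (-(i : ℝ))), sub_eq_add_neg, Real.rpow_add (Real.exp_pos _), ← mul_assoc]
    gcongr
  have h2 : ∀ i' ∈ Finset.range (m + 1), i' ≠ i → Tendsto
      (fun x => (p i').eval x * Real.exp (-x) ^ i' * Real.exp (-x) ^ (-(i : ℝ))) atTop (𝓝 0) := by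
    intro i' hi' hne
    rcases lt_or_gt_of_ne hne with hlt | hgt
    · simp [ih i' hlt (by omega)]
    · obtain ⟨l, rfl⟩ : ∃ l, i' = i + (l + 1) := ⟨i' - i - 1, by omega⟩
      have h3 := (p (i + (l + 1))).tendsto_div_exp_atTop.mul
        ((Real.tendsto_exp_neg_atTop_nhds_zero).pow l)
      rw [zero_mul] at h3
      refine h3.congr fun x => ?_
      rw [Real.rpow_neg (Real.exp_pos _).le, Real.rpow_natCast, pow_add, pow_succ, div_eq_mul_inv,
        ← Real.exp_neg]
      have := Real.exp_pos (-x)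
      field_simp
  have h3 : Tendsto (fun x => (p i).eval x) atTop (𝓝 0) := by
    have h4 := tendsto_finsetSum ((Finset.range (m + 1)).erase i) fun i' hi' =>
      h2 i' (Finset.mem_of_mem_erase hi') (Finset.ne_of_mem_erase hi')
    have h5 := h1.sub h4
    simp only [Finset.sum_const_zero, sub_zero] at h5
    refine h5.congr fun x => ?_
    rw [← Finset.add_sum_erase _ _ (Finset.mem_range.2 (Nat.lt_succ_of_le him)), add_mul,
      Finset.sum_mul, add_sub_cancel_right, Real.rpow_neg (Real.exp_pos _).le, Real.rpow_natCast,
      mul_assoc, mul_inv_cancel₀ (by positivity), mul_one]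
  have h4 := (Polynomial.tendsto_nhds_iff _).1 h3
  exact Polynomial.leadingCoeff_eq_zero.1 h4.1

section Unique

variable {α : ℝ} {n : ℕ → ℕ} {X X' : ℕ → ℕ → Prop} {e e' : Bool}
  {m m' q q' s s' : ℕ} {γ γ' : ℝ} {f R R' : Tan d × ℝ → ℝ} {c c' : ℕ → ℕ → Tan d → ℝ}

/-- A truncated series that is smaller than its last power of `t` vanishes. -/
lemma polyLog_eq_zero (hr : 0 < r) {κ C : ℝ} (hκ : m < κ) {y : Tan d} (hy : y ∈ tanBall d r)
    (h : ∀ x ∈ cyl d r, |polyLog n m c x| ≤ C * x.2 ^ κ) {i j : ℕ} (hi : i ≤ m) (hj : j < n i) :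
    c i j y = 0 := by
  have h1 := eq_zero_of_sum_exp_le (C := C) hκ
    (fun i => ∑ j ∈ Finset.range (n i), Polynomial.monomial j (c i j y * (-1) ^ j)) (by
      filter_upwards [eventually_gt_atTop (-Real.log r)] with x hx
      have hm : (y, Real.exp (-x)) ∈ cyl d r := mk_mem_cyl.2 ⟨hy, Real.exp_pos _, by
        rw [← Real.lt_log_iff_exp_lt hr]; linarith⟩
      have := h _ hm
      convert this using 2
      simp only [polyLog, Polynomial.eval_finsetSum, Polynomial.eval_monomial, Real.log_exp,
        Finset.sum_mul]
      refine Finset.sum_congr rfl fun i _ => Finset.sum_congr rfl fun j _ => ?_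
      rw [neg_eq_neg_one_mul x, mul_pow]
      ring) i hi
  have h2 := congrArg (fun p => p.coeff j) h1
  simp only [Polynomial.finsetSum_coeff, Polynomial.coeff_monomial, Finset.sum_ite_eq',
    Finset.mem_range, hj, if_true, Polynomial.coeff_zero] at h2
  simpa using h2

lemma IsExp.trunc (hr : 0 < r) (hα1 : α < 1) (h : IsExp r α n X e m γ q s c R f) (hm : m' ≤ m)
    (hd : Dom e γ e' γ') (hh : γ' < m' + 1) :
    ∃ R', IsExp r α n X e' m' γ' q s c R' f := by
  refine ⟨fun x => (∑ i ∈ Finset.Ico (m' + 1) (m + 1), ∑ j ∈ Finset.range (n i),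
    c i j x.1 * (x.2 ^ i * Real.log x.2 ^ j)) + R x, h.coeff, h.exact_coeff,
    (Reg.sumW _ fun i hi => Reg.sumW _ fun j _ => ?_).addW (h.rem.weakenW Subset.rfl hd),
    fun x hx => ?_⟩
  · refine ((h.coeff i j).mono_logW hr (Ioo_sub hα1) (e := true) (Or.inl rfl)).weakenW Subset.rfl
      (dom_of_lt (hh.trans_le ?_))
    exact_mod_cast (Finset.mem_Ico.1 hi).1
  · rw [h.eq x hx, polyLog, polyLog, ← add_assoc,
      Finset.sum_range_add_sum_Ico _ (by omega : m' + 1 ≤ m + 1)]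

/-- The coefficients of an expansion are unique. -/
lemma IsExp.coeff_unique (hr : 0 < r) (h : IsExp r α n X e m γ q s c R f)
    (h' : IsExp r α n X' e' m γ' q' s' c' R' f) (hγ : m < γ) (hγ' : m < γ') {i j : ℕ}
    (hi : i ≤ m) (hj : j < n i) : EqOn (c i j) (c' i j) (tanBall d r) := by
  intro y hy
  obtain ⟨κ, hκ, hκ'⟩ := exists_between (lt_min hγ hγ')
  have h1 := h.rem.base.weaken (S' := ∅) (e' := false) (γ' := κ) (empty_subset _)
    (dom_of_lt (hκ'.trans_le (min_le_left _ _)))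
  have h2 := h'.rem.base.weaken (S' := ∅) (e' := false) (γ' := κ) (empty_subset _)
    (dom_of_lt (hκ'.trans_le (min_le_right _ _)))
  obtain ⟨C, _, hC⟩ := (h2.add (h1.const_mul (-1))).bd 0 (by simp [mem_loss_false])
  have := polyLog_eq_zero (n := n) (m := m) (c := fun i j y => c i j y + -1 * c' i j y) hr hκ hy
    (C := C) (fun x hx => ?_) hi hj
  · linarith
  · have h3 := hC x hx
    rw [sub_zero] at h3
    convert h3 using 2
    have e1 := h.eq x hx
    have e2 := h'.eq x hx
    have e3 : polyLog n m (fun i j y => c i j y + -1 * c' i j y) x =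
        polyLog n m c x + -1 * polyLog n m c' x := by
      simp only [polyLog, add_mul, Finset.sum_add_distrib, Finset.mul_sum, mul_assoc]
    rw [e3]
    linarith

end Unique

/-! ### Composition with nonlinear functions -/

section Comp

variable {Z : Type*} [NormedAddCommGroup Z] [NormedSpace ℝ Z] {ι : Type*} [Fintype ι]

/-- `F` and its partial derivatives up to order `s`, along all directions, have the property `P`. -/
def CY (R : ℝ) (D : Set Z) (P : (Tan d × Z → ℝ) → Prop) : ℕ → (Tan d × Z → ℝ) → Prop
  | 0, F => P F
  | s + 1, F => P F ∧ ∃ L : Tan d × Z → (Tan d × Z →L[ℝ] ℝ),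
      (∀ x ∈ tanBall d R ×ˢ D, HasFDerivWithinAt F (L x) (tanBall d R ×ˢ D) x) ∧
        ∀ v, CY R D P s (fun x => L x v)

/-- The derivatives of `F` of order up to `m` along directions in `Z` exist and have the property
`CY R D P s`. -/
def CFz (R : ℝ) (D : Set Z) (P : (Tan d × Z → ℝ) → Prop) : ℕ → ℕ → (Tan d × Z → ℝ) → Prop
  | 0, s, F => CY R D P s F
  | m + 1, s, F => CY R D P s F ∧ ∃ L : Tan d × Z → (Z →L[ℝ] ℝ),
      (∀ y ∈ tanBall d R, ∀ z ∈ D, HasFDerivWithinAt (fun z => F (y, z)) (L (y, z)) D z) ∧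
        ∀ v, CFz R D P m s (fun x => L x v)

variable {R : ℝ} {D : Set Z} {P : (Tan d × Z → ℝ) → Prop} {F : Tan d × Z → ℝ} {m s : ℕ}

lemma CY.base (h : CY R D P s F) : P F := by
  cases s with
  | zero => exact h
  | succ s => exact h.1

lemma CFz.toCY (h : CFz R D P m s F) : CY R D P s F := by
  cases m with
  | zero => exact h
  | succ m => exact h.1

lemma CY.mono {s' : ℕ} (hs : s' ≤ s) (h : CY R D P s F) : CY R D P s' F := by
  induction s generalizing F s' with
  | zero => rwa [Nat.le_zero.1 hs]
  | succ s ih =>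
    cases s' with
    | zero => exact h.base
    | succ s' =>
      obtain ⟨h0, L, hL, hL'⟩ := h
      exact ⟨h0, L, hL, fun v => ih (Nat.le_of_succ_le_succ hs) (hL' v)⟩

lemma CFz.mono {s' : ℕ} (hs : s' ≤ s) (h : CFz R D P m s F) : CFz R D P m s' F := by
  induction m generalizing F with
  | zero => exact CY.mono hs h
  | succ m ih =>
    obtain ⟨h0, L, hL, hL'⟩ := h
    exact ⟨h0.mono hs, L, hL, fun v => ih (hL' v)⟩

lemma Reg.mk_space {Q : (Tan d × ℝ → ℝ) → Prop} {f : Tan d × ℝ → ℝ}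
    {k : Fin d → Tan d × ℝ → ℝ} (h : Q f) (hk : IsGrad r f k) (hk' : ∀ a, Reg r Q 0 s (k a)) :
    Reg r Q 0 (s + 1) f := by
  rw [Reg]
  refine ⟨h, fun m' hm => by omega, fun s' hs' => ?_⟩
  obtain rfl : s = s' := by omega
  exact ⟨k, hk, hk'⟩

variable (b : Module.Basis ι ℝ Z) {z : Tan d × ℝ → Z}

lemma hasDerivAt_of_coord {g : ι → Tan d × ℝ → ℝ}
    (hg : ∀ i, IsTheta r (fun x => b.repr (z x) i) (g i)) {x : Tan d × ℝ} (hx : x ∈ cyl d r) :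
    HasDerivAt (fun s => z (x.1, s)) (∑ i, (g i x / x.2) • b i) x.2 := by
  have h := HasDerivAt.fun_sum (u := Finset.univ) fun i _ => (hg i x hx).smul_const (b i)
  refine h.congr_of_eventuallyEq (Eventually.of_forall fun s => ?_)
  exact (b.sum_repr (z (x.1, s))).symm

lemma hasFDerivAt_of_coord {k : ι → Fin d → Tan d × ℝ → ℝ}
    (hk : ∀ i, IsGrad r (fun x => b.repr (z x) i) (k i)) {x : Tan d × ℝ} (hx : x ∈ cyl d r) :
    HasFDerivAt (fun y => z (y, x.2))
      (∑ i, (∑ a, k i a x • (EuclideanSpace.proj a : Tan d →L[ℝ] ℝ)).smulRight (b i)) x.1 := by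
  have h := HasFDerivAt.fun_sum (u := Finset.univ) fun i _ => (hk i x hx).smul_const (b i)
  refine h.congr_of_eventuallyEq (Eventually.of_forall fun y => ?_)
  exact (b.sum_repr (z (y, x.2))).symm

lemma isTheta_comp {L : Tan d × Z → (Z →L[ℝ] ℝ)} {g : ι → Tan d × ℝ → ℝ}
    (hR : r ≤ R) (hz : ∀ x ∈ cyl d r, z x ∈ D)
    (hL : ∀ y ∈ tanBall d R, ∀ z ∈ D, HasFDerivWithinAt (fun z => F (y, z)) (L (y, z)) D z)
    (hg : ∀ i, IsTheta r (fun x => b.repr (z x) i) (g i)) :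
    IsTheta r (fun x => F (x.1, z x)) (fun x => ∑ i, L (x.1, z x) (b i) * g i x) := by
  intro x hx
  have hx' := mem_cyl.1 hx
  have h1 := hL x.1 (ball_subset_ball hR hx'.1) (z x) (hz x hx)
  have h2 := h1.comp_hasDerivAt_of_eq x.2 (hasDerivAt_of_coord b hg hx)
    (by filter_upwards [eventually_time hx] with s hs using hz _ hs) rfl
  refine h2.congr_deriv ?_
  rw [map_sum, Finset.sum_div]
  refine Finset.sum_congr rfl fun i _ => ?_
  rw [map_smul, smul_eq_mul]
  ring

lemma isGrad_comp {L : Tan d × Z → (Tan d × Z →L[ℝ] ℝ)} {k : ι → Fin d → Tan d × ℝ → ℝ}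
    (hR : r ≤ R) (hz : ∀ x ∈ cyl d r, z x ∈ D)
    (hL : ∀ x ∈ tanBall d R ×ˢ D, HasFDerivWithinAt F (L x) (tanBall d R ×ˢ D) x)
    (hk : ∀ i, IsGrad r (fun x => b.repr (z x) i) (k i)) :
    IsGrad r (fun x => F (x.1, z x)) (fun a x => L (x.1, z x) (EuclideanSpace.single a 1, 0) +
      ∑ i, L (x.1, z x) (0, b i) * k i a x) := by
  intro x hx
  have hx' := mem_cyl.1 hx
  have h1 := hL (x.1, z x) ⟨ball_subset_ball hR hx'.1, hz x hx⟩
  have h2 := h1.comp_hasFDerivAt_of_eq x.1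
    ((hasFDerivAt_id x.1).prodMk (hasFDerivAt_of_coord b hk hx))
    (by
      filter_upwards [eventually_space hx] with y hy
      exact ⟨ball_subset_ball hR (mem_cyl.1 hy).1, hz _ hy⟩) rfl
  refine h2.congr_fderiv ?_
  rw [clm_eq_sum_proj ((L (x.1, z x)).comp _)]
  refine Finset.sum_congr rfl fun a _ => ?_
  congr 1
  have : ∀ w : Z, L (x.1, z x) (EuclideanSpace.single a 1, w) =
      L (x.1, z x) (EuclideanSpace.single a 1, 0) + L (x.1, z x) (0, w) := fun w => by
    rw [← map_add]; simp
  simp only [ContinuousLinearMap.comp_apply, ContinuousLinearMap.prod_apply]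
  rw [ContinuousLinearMap.id_apply, this]
  congr 1
  have h3 : ∀ w : Z, L (x.1, z x) (0, w) =
      ((L (x.1, z x)).comp (ContinuousLinearMap.inr ℝ (Tan d) Z)) w := fun w => rfl
  rw [h3, sum_apply, map_sum]
  refine Finset.sum_congr rfl fun i _ => ?_
  rw [ContinuousLinearMap.smulRight_apply, sum_proj_single, map_smul, smul_eq_mul, mul_comm, ← h3]

/-- The property of nonlinearities that starts the induction: `F ∘ z` is Hölder continuous with
boundary values `F(·, 0)`, both with the sharp exponent. -/
def CompBase (r α : ℝ) (z : Tan d × ℝ → Z) (F : Tan d × Z → ℝ) : Prop :=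
  W r (Ioo 0 α) false α (fun x => F (x.1, z x) + -1 * F (x.1, 0)) ∧
    W r (Ioc 0 α) false 0 (fun x : Tan d × ℝ => F (x.1, 0))

variable {α : ℝ}

include b in
/-- The property `CompBase` passes to tangential derivatives of `F ∘ z`. -/
lemma comp_reg (hR : r ≤ R) (hα : 0 < α) (hα1 : α < 1) (hr : 0 < r)
    (hz : ∀ x ∈ cyl d r, z x ∈ D) (h0 : (0 : Z) ∈ D)
    (hz' : ∀ i, Reg r (W r (Ioo 0 α) false α) 0 s (fun x => b.repr (z x) i))
    (hF : CY R D (CompBase r α z) s F) :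
    Reg r (W r (Ioo 0 α) false α) 0 s (fun x => F (x.1, z x) + -1 * F (x.1, 0)) ∧
      RegC r (Ioc 0 α) s (fun y => F (y, 0)) := by
  suffices H : Reg r (W r (Ioo 0 α) false α) 0 s (fun x => F (x.1, z x) + -1 * F (x.1, 0)) ∧
      Reg r (W r (Ioc 0 α) false 0) 0 s (fun x : Tan d × ℝ => F (x.1, 0)) from
    ⟨H.1, H.2.slice (Ioc_sub hα1) (half_mem hr)⟩
  induction s generalizing F with
  | zero => exact ⟨Reg.mk_zero hF.1, Reg.mk_zero hF.2⟩
  | succ s ih =>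
    obtain ⟨hF0, L, hL, hL'⟩ := hF
    choose k hk hk' using fun i => (hz' i).grad
    have hzero : IsGrad r (fun x : Tan d × ℝ => F (x.1, 0))
        (fun a x => L (x.1, 0) (EuclideanSpace.single a 1, 0)) := by
      intro x hx
      have := isGrad_comp (r := r) b (z := fun _ => (0 : Z)) (k := fun _ _ _ => 0) hR
        (fun _ _ => h0) hL (fun i => by simpa using IsGrad.const (d := d) (r := r) 0) x hx
      simpa using this
    have ih' := fun v => ih (F := fun x => L x v) (fun i => (hz' i).mono le_rfl (Nat.le_succ s))
      (hL' v)
    refine ⟨Reg.mk_space hF0.1 ((isGrad_comp b hR hz hL hk).add (hzero.const_mul (-1)))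
      fun a => ?_, Reg.mk_space hF0.2 hzero fun a => (ih' _).2⟩
    have h1 : ∀ i, Reg r (W r (Ioo 0 α) false α) 0 s
        (fun x => L (x.1, z x) (0, b i) * k i a x) := by
      intro i
      have h2 := ((ih' (0, b i)).1.weakenW Subset.rfl (e' := false) (γ' := 0)
        (dom_of_le hα.le)).addW
        ((ih' (0, b i)).2.weakenW Ioo_subset_Ioc_self (e' := false) (γ' := 0) (dom_of_le le_rfl))
      have h3 := h2.mulW (hk' i a)
      rw [Bool.or_false, zero_add] at h3
      exact h3.congrW fun x _ => by ring
    refine ((ih' (EuclideanSpace.single a 1, 0)).1.addW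
      (Reg.sumW Finset.univ fun i _ => h1 i)).congrW fun x _ => by ring

include b in
/-- Composition with a nonlinearity preserves boundedness of the tangential derivatives. -/
lemma comp_bounded (hR : r ≤ R) (hz : ∀ x ∈ cyl d r, z x ∈ D)
    (hz' : ∀ i, Reg r (W r ∅ false 0) 0 s (fun x => b.repr (z x) i))
    (hF : CY R D (fun F => W r ∅ false 0 (fun x => F (x.1, z x))) s F) :
    Reg r (W r ∅ false 0) 0 s (fun x => F (x.1, z x)) := by
  induction s generalizing F with
  | zero => exact Reg.mk_zero hF
  | succ s ih =>
    obtain ⟨hF0, L, hL, hL'⟩ := hF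
    choose k hk hk' using fun i => (hz' i).grad
    have ih' := fun v => ih (F := fun x => L x v) (fun i => (hz' i).mono le_rfl (Nat.le_succ s))
      (hL' v)
    refine Reg.mk_space hF0 (isGrad_comp b hR hz hL hk) fun a => (ih' _).addW
      (Reg.sumW Finset.univ fun i _ => ?_)
    simpa using (ih' (0, b i)).mulW (hk' i a)

lemma dom_false {e : Bool} {γ : ℝ} : Dom false γ e γ := by
  cases e
  · exact dom_of_le le_rfl
  · exact dom_true le_rfl

omit [NormedSpace ℝ Z] in
lemma comp_tendsto (hα : 0 < α) (hF : CompBase r α z F) {y : Tan d} (hy : y ∈ tanBall d r) :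
    Tendsto (fun t => F (y, z (y, t))) (𝓝[Ioo 0 r] 0) (𝓝 (F (y, 0))) := by
  have h := hF.1.tendsto (μ := 0) (by linarith) hy
  simp only [Real.rpow_zero, one_mul] at h
  have := h.add (tendsto_const_nhds (x := F (y, 0)))
  simpa using this

variable {n n' : ℕ → ℕ} {X X' : ℕ → ℕ → Prop} {e : Bool} {h : ι → Tan d × ℝ → ℝ}

include b in
/-- The expansion of order `0` has the single coefficient `F(·, 0)`. -/
lemma comp_hasExp_zero (hR : r ≤ R) (hα : 0 < α) (hα1 : α < 1) (hr : 0 < r)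
    (hz : ∀ x ∈ cyl d r, z x ∈ D) (h0 : (0 : Z) ∈ D)
    (hz' : ∀ i, Reg r (W r (Ioo 0 α) false α) 0 s (fun x => b.repr (z x) i))
    (hn0 : n 0 = 1) (hF : CY R D (CompBase r α z) s F) :
    HasExp r α n X e 0 ((0 : ℕ) + α) 0 s (fun x => F (x.1, z x)) := by
  obtain ⟨h1, h2⟩ := comp_reg b hR hα hα1 hr hz h0 hz' hF
  have h3 : HasExp r α n X e 0 ((0 : ℕ) + α) 0 s
      (fun x : Tan d × ℝ => F (x.1, 0) * (x.2 ^ 0 * Real.log x.2 ^ 0)) :=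
    HasExp.of_term (c := fun y => F (y, 0)) hr hα1 (h2.weaken Ioo_subset_Ioc_self le_rfl)
      (fun _ => ⟨by omega, fun _ => h2⟩) (fun h => by omega)
  refine (h3.add (HasExp.of_rem (h1.weakenW Subset.rfl ?_))).congr fun x _ => ?_
  · simpa using dom_false
  · simp

include b in
/-- Composition with a nonlinearity preserves expansions: one integrates
`t ∂_t (F ∘ z) = ∑ (∂_i F ∘ z) · t ∂_t z_i`. -/
lemma comp_hasExp (hR : r ≤ R) (hα : 0 < α) (hα1 : α < 1) (hr : 0 < r)
    (hz : ∀ x ∈ cyl d r, z x ∈ D) (h0 : (0 : Z) ∈ D)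
    (hz' : ∀ i, Reg r (W r (Ioo 0 α) false α) 0 s (fun x => b.repr (z x) i))
    (hh : ∀ i, IsTheta r (fun x => b.repr (z x) i) (fun x => x.2 * h i x))
    (hn0 : n 0 = 1)
    (hnn : ∀ i j a b, a < n i → b < n' j → a + b < n' (i + j))
    (hXX : ∀ i j a b, X' (i + j) (a + b) → X i a ∧ X' j b)
    (hn : ∀ i, n' i ≤ n (i + 1)) (hX : ∀ i j j', X (i + 1) j' → X' i j)
    (he : e = true ∨ n' 0 ≤ 1) {M : ℕ}
    (hE : ∀ i, ∀ m < M, HasExp r α n' X' e m (m + α) m s (h i)) :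
    ∀ m ≤ M, ∀ F : Tan d × Z → ℝ, CFz R D (CompBase r α z) m s F →
      HasExp r α n X e m (m + α) m s (fun x => F (x.1, z x)) := by
  intro m
  induction m with
  | zero =>
    intro _ F hF
    exact comp_hasExp_zero b hR hα hα1 hr hz h0 hz' hn0 hF
  | succ m ih =>
    intro hm F hF
    obtain ⟨hF0, L, hL, hL'⟩ := hF
    have h1 : HasExp r α n' X' e m (m + α) m s
        (fun x => ∑ i, L (x.1, z x) (b i) * h i x) := by
      refine HasExp.sum _ fun i _ => ?_
      refine HasExp.mul hr hα1 (ih (by omega) _ (hL' (b i))) (hE i m (by omega))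
        (fun i j a b ha hb _ => hnn i j a b ha hb) hXX (by positivity) le_rfl (by linarith) ?_
        (Or.inl ⟨dom_of_le le_rfl, hn0.le⟩)
      rcases he with rfl | he
      · exact Or.inr (dom_of_le le_rfl)
      · exact Or.inl ⟨dom_of_le le_rfl, he⟩
    have h2 := (comp_reg b hR hα hα1 hr hz h0 hz' hF0).2
    refine h1.integrate hr hα hα1 (fun i _ => hn i) (by omega) hX ?_ h2
      fun y hy => comp_tendsto hα hF0.base hy
    refine (isTheta_comp b hR hz hL hh).congr (eqOn_refl _ _) fun x _ => ?_
    simp only [Finset.mul_sum]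
    exact Finset.sum_congr rfl fun i _ => by ring

include b in
/-- Sharp weights for the composition, from the composition with lossy weights and one order more:
this allows for a logarithm in the leading term of `∂_t z`. -/
lemma comp_hasExp_sharp (hR : r ≤ R) (hα : 0 < α) (hα1 : α < 1) (hr : 0 < r)
    (hz : ∀ x ∈ cyl d r, z x ∈ D) (h0 : (0 : Z) ∈ D)
    (hz' : ∀ i, Reg r (W r (Ioo 0 α) false α) 0 s (fun x => b.repr (z x) i))
    (hh : ∀ i, IsTheta r (fun x => b.repr (z x) i) (fun x => x.2 * h i x))
    (hn0 : n 0 = 1)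
    (hnn : ∀ i j a b, a < n i → b < n' j → a + b < n' (i + j))
    (hXX : ∀ i j a b, X' (i + j) (a + b) → X i a ∧ X' j b)
    (hn : ∀ i, n' i ≤ n (i + 1)) (hX : ∀ i j j', X (i + 1) j' → X' i j) {m : ℕ}
    (hE : ∀ i, HasExp r α n' X' false m (m + α) m s (h i))
    (hE' : ∀ F : Tan d × Z → ℝ, CFz R D (CompBase r α z) (m + 1) s F →
      HasExp r α n X true (m + 1) ((m + 1 : ℕ) + α) (m + 1) s (fun x => F (x.1, z x)))
    (hF : CFz R D (CompBase r α z) (m + 2) s F) :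
    HasExp r α n X false (m + 1) ((m + 1 : ℕ) + α) (m + 1) s (fun x => F (x.1, z x)) := by
  obtain ⟨hF0, L, hL, hL'⟩ := hF
  have h1 : HasExp r α n' X' false m (m + α) m s
      (fun x => ∑ i, L (x.1, z x) (b i) * h i x) := by
    refine HasExp.sum _ fun i _ => ?_
    have h3 := (hE' _ (hL' (b i))).weaken (e' := false) (γ' := m + (1 + α) / 2) (m' := m) (q' := m)
      hr hα1 (fun i _ => le_rfl) (fun i j _ h => h) (dom_of_lt (by push_cast; linarith))
      (fun _ => by linarith) (Nat.le_succ m) le_rfl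
    exact HasExp.mul hr hα1 h3 (hE i) (fun i j a b ha hb _ => hnn i j a b ha hb) hXX
      (by positivity) (by linarith) (by linarith) (Or.inr (dom_of_lt (by linarith)))
      (Or.inl ⟨dom_of_le le_rfl, hn0.le⟩)
  have h2 := (comp_reg b hR hα hα1 hr hz h0 hz' hF0).2
  refine h1.integrate hr hα hα1 (fun i _ => hn i) (by omega) hX ?_ h2
    fun y hy => comp_tendsto hα hF0.base hy
  refine (isTheta_comp b hR hz hL hh).congr (eqOn_refl _ _) fun x _ => ?_
  simp only [Finset.mul_sum]
  exact Finset.sum_congr rfl fun i _ => by ring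

end Comp

/-! ### Hölder classes and iterated tangential derivatives -/

section Holder

variable {X Y Y' : Type*} [NormedAddCommGroup X]
  [NormedAddCommGroup Y] [NormedAddCommGroup Y']
  {a : ℝ≥0} {f g : X → Y} {U : Set X}

lemma isHolder_iff :
    IsHolder a f U ↔ ∃ C : ℝ, 0 ≤ C ∧ ∀ x ∈ U, ∀ y ∈ U, ‖f x - f y‖ ≤ C * ‖x - y‖ ^ (a : ℝ) := by
  constructor
  · rintro ⟨C, hC⟩
    exact ⟨C, C.2, fun x hx y hy => by
      simpa [dist_eq_norm] using HolderOnWith.dist_le hC hx hy⟩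
  · rintro ⟨C, hC, h⟩
    lift C to ℝ≥0 using hC
    refine ⟨C, fun x hx y hy => ?_⟩
    rw [edist_nndist, edist_nndist, ← ENNReal.coe_rpow_of_nonneg _ a.coe_nonneg, ← ENNReal.coe_mul,
      ENNReal.coe_le_coe, ← NNReal.coe_le_coe]
    simpa [dist_eq_norm] using h x hx y hy

lemma IsHolder.congr (h : IsHolder a f U) (hg : EqOn g f U) : IsHolder a g U := by
  obtain ⟨C, hC⟩ := h
  exact ⟨C, fun x hx y hy => by rw [hg hx, hg hy]; exact hC x hx y hy⟩

lemma IsHolder.of_norm_le {g : X → Y'} {K : ℝ} (hK : 0 ≤ K)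
    (h : IsHolder a f U) (hg : ∀ x ∈ U, ∀ y ∈ U, ‖g x - g y‖ ≤ K * ‖f x - f y‖) :
    IsHolder a g U := by
  rw [isHolder_iff] at h ⊢
  obtain ⟨C, h0, hC⟩ := h
  refine ⟨K * C, by positivity, fun x hx y hy => (hg x hx y hy).trans ?_⟩
  rw [mul_assoc]
  gcongr
  exact hC x hx y hy

lemma IsHolder.add (hf : IsHolder a f U) (hg : IsHolder a g U) :
    IsHolder a (fun x => f x + g x) U := by
  rw [isHolder_iff] at hf hg ⊢
  obtain ⟨C, h0, hC⟩ := hf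
  obtain ⟨D, h0', hD⟩ := hg
  refine ⟨C + D, by positivity, fun x hx y hy => ?_⟩
  rw [add_sub_add_comm, add_mul]
  exact (norm_add_le _ _).trans (add_le_add (hC x hx y hy) (hD x hx y hy))

lemma IsHolder.sum {ι : Type*} (A : Finset ι) {F : ι → X → Y} (h : ∀ i ∈ A, IsHolder a (F i) U) :
    IsHolder a (fun x => ∑ i ∈ A, F i x) U := by
  classical
  induction A using Finset.induction_on with
  | empty =>
    rw [isHolder_iff]
    exact ⟨0, le_rfl, fun x _ y _ => by simp⟩
  | insert i A hi ih =>
    simp only [Finset.sum_insert hi]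
    exact (h i (by simp)).add (ih fun j hj => h j (by simp [hj]))

lemma IsHolder.clm_comp [NormedSpace ℝ Y] [NormedSpace ℝ Y'] (L : Y →L[ℝ] Y') (h : IsHolder a f U) :
    IsHolder a (fun x => L (f x)) U :=
  h.of_norm_le (norm_nonneg L) fun x _ y _ => by rw [← map_sub]; exact L.le_opNorm _

end Holder

section Slices

variable {Q : (Tan d × ℝ → ℝ) → Prop} {f h : Tan d × ℝ → ℝ} {s τ : ℕ}

lemma Reg.contDiffOn_slice
    (hQ : ∀ f, Q f → ∀ t ∈ Ioo 0 r, ContinuousOn (fun z => f (z, t)) (tanBall d r))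
    (h : Reg r Q 0 s f) {t : ℝ} (ht : t ∈ Ioo 0 r) :
    ContDiffOn ℝ s (fun z => f (z, t)) (tanBall d r) := by
  induction s generalizing f with
  | zero => simpa [contDiffOn_zero] using hQ f h.base t ht
  | succ s ih =>
    obtain ⟨k, hk, hk'⟩ := h.grad
    have h1 : ∀ z ∈ tanBall d r, HasFDerivAt (fun z => f (z, t))
        (∑ a, k a (z, t) • (EuclideanSpace.proj a : Tan d →L[ℝ] ℝ)) z :=
      fun z hz => hk (z, t) (mk_mem_cyl.2 ⟨hz, ht⟩)
    rw [Nat.cast_succ, contDiffOn_succ_iff_fderiv_of_isOpen isOpen_tanBall]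
    refine ⟨fun z hz => (h1 z hz).differentiableAt.differentiableWithinAt, by simp, ?_⟩
    refine ContDiffOn.congr (f := fun z => ∑ a, k a (z, t) •
      (EuclideanSpace.proj a : Tan d →L[ℝ] ℝ)) ?_ fun z hz => (h1 z hz).fderiv
    exact ContDiffOn.sum fun a _ => (ih (hk' a)).smul contDiffOn_const

/-- Iterated tangential derivatives are combinations, with constant coefficients, of functions
obtained by successive partial derivatives. -/
lemma Reg.dTanIter_eq (h : Reg r Q 0 s f) (hτ : τ ≤ s) :
    ∃ (ι : Type) (_ : Fintype ι) (F : ι → Tan d × ℝ → ℝ)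
      (A : ι → ContinuousMultilinearMap ℝ (fun _ : Fin τ => Tan d) ℝ),
      (∀ i, Reg r Q 0 (s - τ) (F i)) ∧ ∀ x ∈ cyl d r, dTanIter τ f x = ∑ i, F i x • A i := by
  induction τ with
  | zero =>
    refine ⟨Unit, inferInstance, fun _ => f,
      fun _ => (continuousMultilinearCurryFin0 ℝ (Tan d) ℝ).symm 1, fun _ => h, fun x _ => ?_⟩
    simp only [dTanIter, iteratedFDeriv_zero_eq_comp, Function.comp, Finset.univ_unique,
      Finset.sum_singleton, ← map_smul]
    simp
  | succ τ ih =>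
    obtain ⟨ι, _, F, A, hF, hA⟩ := ih (by omega)
    have hF' : ∀ i, Reg r Q 0 ((s - (τ + 1)) + 1) (F i) := fun i => by
      rw [show s - (τ + 1) + 1 = s - τ by omega]; exact hF i
    choose k hk hk' using fun i => (hF' i).grad
    refine ⟨ι × Fin d, inferInstance, fun p => k p.1 p.2, fun p =>
      (continuousMultilinearCurryLeftEquiv ℝ (fun _ : Fin (τ + 1) => Tan d) ℝ).symm
        ((EuclideanSpace.proj p.2 : Tan d →L[ℝ] ℝ).smulRight (A p.1)),
      fun p => hk' p.1 p.2, fun x hx => ?_⟩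
    have h1 : HasFDerivAt (iteratedFDeriv ℝ τ fun z => f (z, x.2))
        (∑ i, (∑ a, k i a x • (EuclideanSpace.proj a : Tan d →L[ℝ] ℝ)).smulRight (A i)) x.1 := by
      have h2 := HasFDerivAt.fun_sum (u := Finset.univ) fun i _ => (hk i x hx).smul_const (A i)
      refine h2.congr_of_eventuallyEq ?_
      filter_upwards [eventually_space hx] with z hz
      exact hA (z, x.2) hz
    have h3 : (∑ i, (∑ a, k i a x • (EuclideanSpace.proj a : Tan d →L[ℝ] ℝ)).smulRight (A i)) =
        ∑ p : ι × Fin d, k p.1 p.2 x •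
          (EuclideanSpace.proj p.2 : Tan d →L[ℝ] ℝ).smulRight (A p.1) := by
      rw [Fintype.sum_prod_type]
      refine Finset.sum_congr rfl fun i _ => ?_
      ext v w
      simp only [ContinuousLinearMap.smulRight_apply, sum_apply,
        smul_apply, smul_eq_mul, Finset.sum_mul]
      exact Finset.sum_congr rfl fun a _ => by ring
    simp only [dTanIter, iteratedFDeriv_succ_eq_comp_left, Function.comp]
    rw [h1.fderiv, h3]
    ext m
    simp [sum_apply]

lemma dTanIter_isHolder {a : ℝ≥0} (hQ : ∀ f, Q f → IsHolder a f (cyl d r))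
    (h : Reg r Q 0 s f) (hτ : τ ≤ s) : IsHolder a (dTanIter τ f) (cyl d r) := by
  obtain ⟨ι, _, F, A, hF, hA⟩ := h.dTanIter_eq hτ
  refine IsHolder.congr ?_ hA
  refine IsHolder.sum _ fun i _ => ?_
  exact (hQ _ (hF i).base).clm_comp (ContinuousLinearMap.toSpanSingleton ℝ (A i))

/-- The tangential derivatives of `f` inherit Hölder continuity from the iterated ones. -/
lemma reg_of_isHolder {a : ℝ≥0}
    (hc : ∀ t ∈ Ioo 0 r, ContDiffOn ℝ s (fun z => f (z, t)) (tanBall d r))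
    (hf : ∀ τ ≤ s, IsHolder a (dTanIter τ f) (cyl d r)) :
    Reg r (fun f => IsHolder a f (cyl d r)) 0 s f := by
  refine Reg.of_family (fun m s f => m = 0 ∧
    (∀ t ∈ Ioo 0 r, ContDiffOn ℝ s (fun z => f (z, t)) (tanBall d r)) ∧
    ∀ τ ≤ s, IsHolder a (dTanIter τ f) (cyl d r)) ?_ ?_ ?_ _ _ _ ⟨rfl, hc, hf⟩
  · rintro _ _ f ⟨-, -, h⟩
    have h1 := (h 0 (Nat.zero_le _)).clm_comp
      (continuousMultilinearCurryFin0 ℝ (Tan d) ℝ).toContinuousLinearEquiv.toContinuousLinearMap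
    refine h1.congr fun x _ => ?_
    simp [dTanIter]
  · rintro m s f ⟨h, -⟩
    omega
  · rintro m s f ⟨rfl, hc, h⟩
    have hd : ∀ x ∈ cyl d r, ContDiffAt ℝ (s + 1 : ℕ) (fun z => f (z, x.2)) x.1 := fun x hx =>
      (hc x.2 (mem_cyl.1 hx).2).contDiffAt (isOpen_tanBall.mem_nhds (mem_cyl.1 hx).1)
    refine ⟨fun a x => fderiv ℝ (fun z => f (z, x.2)) x.1 (EuclideanSpace.single a 1),
      fun x hx => ?_, fun b => ⟨rfl, fun t ht => ?_, fun τ hτ => ?_⟩⟩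
    · rw [← clm_eq_sum_proj]
      exact ((hd x hx).differentiableAt (by simp)).hasFDerivAt
    · have h1 := hc t ht
      rw [Nat.cast_succ, contDiffOn_succ_iff_fderiv_of_isOpen isOpen_tanBall] at h1
      exact h1.2.2.clm_apply contDiffOn_const
    · set L := ContinuousLinearMap.apply ℝ ℝ (EuclideanSpace.single b (1 : ℝ) : Tan d)
      refine (h (τ + 1) (by omega)).of_norm_le (norm_nonneg L) fun x hx x' hx' => ?_
      have h3 : ∀ x ∈ cyl d r, dTanIter τ (fun x => fderiv ℝ (fun z => f (z, x.2)) x.1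
          (EuclideanSpace.single b 1)) x = L.compContinuousMultilinearMap
            (iteratedFDeriv ℝ τ (fun y => fderiv ℝ (fun z => f (z, x.2)) y) x.1) := fun x hx => by
        have h4 : ContDiffAt ℝ s (fun y => fderiv ℝ (fun z => f (z, x.2)) y) x.1 :=
          (hd x hx).fderiv_right (by push_cast; rfl)
        exact L.iteratedFDeriv_comp_left h4 (by exact_mod_cast hτ)
      rw [h3 x hx, h3 x' hx']
      simp only [dTanIter, iteratedFDeriv_succ_eq_comp_right, Function.comp]
      have h5 : ∀ M M' : ContinuousMultilinearMap ℝ (fun _ : Fin τ => Tan d) (Tan d →L[ℝ] ℝ),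
          ‖L.compContinuousMultilinearMap M - L.compContinuousMultilinearMap M'‖ ≤ ‖L‖ *
            ‖(continuousMultilinearCurryRightEquiv' ℝ τ (Tan d) ℝ).symm M -
              (continuousMultilinearCurryRightEquiv' ℝ τ (Tan d) ℝ).symm M'‖ := fun M M' => by
        rw [← dist_eq_norm (((continuousMultilinearCurryRightEquiv' ℝ τ (Tan d) ℝ).symm M)),
          LinearIsometryEquiv.dist_map, dist_eq_norm]
        have h6 : L.compContinuousMultilinearMap M - L.compContinuousMultilinearMap M' =
            L.compContinuousMultilinearMap (M - M') := by
          ext m; simp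
        rw [h6]
        exact L.norm_compContinuousMultilinearMap_le _
      exact h5 _ _

end Slices

section Convert

variable {S : Set ℝ} {e : Bool} {γ α : ℝ} {f g h : Tan d × ℝ → ℝ} {m s τ : ℕ} {c : Tan d → ℝ}

lemma W.continuousOn_slice (hS : S ⊆ Ioc 0 1) (hS' : S.Nonempty) (h : W r S e γ f) {t : ℝ}
    (ht : t ∈ Ioo 0 r) : ContinuousOn (fun z => f (z, t)) (tanBall d r) := by
  obtain ⟨ε, hε⟩ := hS'
  obtain ⟨η, hη, _⟩ := loss_small e one_pos
  obtain ⟨C, h0, hC⟩ := h.hol_tan hε hη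
  intro y hy
  rw [ContinuousWithinAt, tendsto_iff_dist_tendsto_zero]
  have h1 : Tendsto (fun z : Tan d => C * t ^ (γ - ε - η) * ‖z - y‖ ^ ε)
      (𝓝[tanBall d r] y) (𝓝 0) := by
    have : ContinuousAt (fun z : Tan d => C * t ^ (γ - ε - η) * ‖z - y‖ ^ ε) y := by
      have h2 : ContinuousAt (fun z : Tan d => ‖z - y‖ ^ ε) y :=
        ContinuousAt.rpow_const (by fun_prop) (Or.inr (hS hε).1.le)
      exact continuousAt_const.mul h2
    have h3 := this.tendsto.mono_left (nhdsWithin_le_nhds (s := tanBall d r))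
    simpa [Real.zero_rpow (hS hε).1.ne'] using h3
  refine squeeze_zero' (Eventually.of_forall fun _ => dist_nonneg) ?_ h1
  filter_upwards [self_mem_nhdsWithin] with z hz
  rw [Real.dist_eq]
  exact hC z hz y hy t ht

lemma norm_sub_le_of_cyl {x x' : Tan d × ℝ} (hx : x ∈ cyl d r) (hx' : x' ∈ cyl d r) :
    ‖x - x'‖ ≤ 2 * r := by
  have h1 := mem_cyl.1 hx
  have h2 := mem_cyl.1 hx'
  rw [tanBall, mem_ball_zero_iff] at h1 h2
  rw [Prod.norm_def]
  refine max_le ?_ ?_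
  · exact (norm_sub_le _ _).trans (by linarith [h1.1, h2.1])
  · rw [Prod.snd_sub, Real.norm_eq_abs, abs_le]
    constructor <;> linarith [h1.2.1, h1.2.2, h2.2.1, h2.2.2]

/-- A weight at least as large as the Hölder exponent yields uniform Hölder continuity. -/
lemma W.isHolder (h : W r S false γ f) {ε : ℝ≥0} (hε : (ε : ℝ) ∈ S) (hε0 : 0 < ε)
    (hεγ : (ε : ℝ) ≤ γ) : IsHolder ε f (cyl d r) := by
  rw [isHolder_iff]
  obtain ⟨C, h0, hC⟩ := h.bd 0 (mem_loss_false.2 rfl)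
  obtain ⟨D, h0', hD⟩ := h.hol ε hε 0 (mem_loss_false.2 rfl)
  simp only [sub_zero] at hC hD
  rcases le_or_gt r 0 with hr | hr
  · exact ⟨0, le_rfl, fun x hx => absurd ((mem_cyl.1 hx).2.1.trans (mem_cyl.1 hx).2.2) hr.not_gt⟩
  suffices H : ∀ x ∈ cyl d r, ∀ x' ∈ cyl d r, x'.2 ≤ x.2 →
      ‖f x - f x'‖ ≤ (D * r ^ (γ - ε) + 2 * C * r ^ (γ - ε) * 2 ^ (ε : ℝ)) *
        ‖x - x'‖ ^ (ε : ℝ) by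
    refine ⟨D * r ^ (γ - ε) + 2 * C * r ^ (γ - ε) * 2 ^ (ε : ℝ), by positivity,
      fun x hx x' hx' => ?_⟩
    rcases le_total x'.2 x.2 with h1 | h1
    · exact H x hx x' hx' h1
    · rw [norm_sub_rev, norm_sub_rev x]
      exact H x' hx' x hx h1
  intro x hx x' hx' h1
  have hx2 := (mem_cyl.1 hx).2
  have hx2' := (mem_cyl.1 hx').2
  have hp := hx2.1
  have hw : x.2 ^ (γ - ε) ≤ r ^ (γ - ε) :=
    Real.rpow_le_rpow hx2.1.le hx2.2.le (by linarith)
  rw [add_mul]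
  -- if the heights are not comparable, then they are bounded by the distance
  rcases le_or_gt x.2 (2 * x'.2) with h2 | h2
  · refine (hD x hx x' hx' h1 h2).trans (le_add_of_le_of_nonneg ?_ (by positivity))
    gcongr
  · refine le_add_of_nonneg_of_le (by positivity) ?_
    have h3 : x.2 ≤ 2 * ‖x - x'‖ := by
      have : x.2 - x'.2 ≤ ‖x - x'‖ := (le_abs_self _).trans (norm_snd_le (x - x'))
      linarith
    have h4 : |f x'| ≤ C * x.2 ^ γ := (hC x' hx').trans (by
      have := Real.rpow_le_rpow hx2'.1.le h1 (by linarith [show (0 : ℝ) < ε from hε0] : 0 ≤ γ)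
      gcongr)
    have h5 : x.2 ^ γ = x.2 ^ (γ - ε) * x.2 ^ (ε : ℝ) := by
      rw [← Real.rpow_add hx2.1]; ring_nf
    have h6 : x.2 ^ (ε : ℝ) ≤ 2 ^ (ε : ℝ) * ‖x - x'‖ ^ (ε : ℝ) := by
      rw [← Real.mul_rpow (by norm_num) (norm_nonneg _)]
      exact Real.rpow_le_rpow hx2.1.le h3 ε.2
    calc ‖f x - f x'‖ ≤ |f x| + |f x'| := norm_sub_le _ _
      _ ≤ 2 * C * (x.2 ^ (γ - ε) * x.2 ^ (ε : ℝ)) := by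
          rw [← h5]; linarith [hC x hx]
      _ ≤ 2 * C * (r ^ (γ - ε) * (2 ^ (ε : ℝ) * ‖x - x'‖ ^ (ε : ℝ))) := by gcongr
      _ = _ := by ring

lemma RegC.isCHolder (hr : 0 < r) (hS : S ⊆ Ioc 0 1) (h : RegC r S s c) {ε : ℝ≥0}
    (hε : (ε : ℝ) ∈ S) : IsCHolder s ε c (tanBall d r) := by
  have hh := half_mem hr
  refine ⟨(h 0).contDiffOn_slice (fun f hf t ht => hf.continuousOn_slice hS ⟨_, hε⟩ ht) hh, ?_⟩
  obtain ⟨ι, _, F, A, hF, hA⟩ := (h 0).dTanIter_eq le_rfl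
  have h1 : ∀ i, IsHolder ε (fun y => F i (y, r / 2)) (tanBall d r) := fun i => by
    obtain ⟨C, h0, hC⟩ := (hF i).base.hol_tan hε (mem_loss_false.2 rfl)
    rw [isHolder_iff]
    have := hh.1
    exact ⟨C * (r / 2) ^ (0 - (ε : ℝ) - 0), by positivity, fun x hx y hy => hC x hx y hy _ hh⟩
  refine (IsHolder.sum Finset.univ fun i _ => (h1 i).clm_comp
    (ContinuousLinearMap.toSpanSingleton ℝ (A i))).congr fun y hy => ?_
  rw [iteratedFDerivWithin_of_isOpen s isOpen_tanBall hy]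
  exact hA (y, r / 2) (mk_mem_cyl.2 ⟨hy, hh⟩)

lemma norm_dTanIter_le (h : Reg r (W r S false γ) 0 s f) (hτ : τ ≤ s) :
    ∃ C : ℝ, ∀ x ∈ cyl d r, ‖dTanIter τ f x‖ ≤ C * x.2 ^ γ := by
  obtain ⟨ι, _, F, A, hF, hA⟩ := h.dTanIter_eq hτ
  choose C h0 hC using fun i => (hF i).base.bd 0 (mem_loss_false.2 rfl)
  refine ⟨∑ i, C i * ‖A i‖, fun x hx => ?_⟩
  rw [hA x hx, Finset.sum_mul]
  refine (norm_sum_le _ _).trans (Finset.sum_le_sum fun i _ => ?_)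
  rw [norm_smul]
  calc ‖F i x‖ * ‖A i‖ ≤ (C i * x.2 ^ (γ - 0)) * ‖A i‖ := by gcongr; exact hC i x hx
    _ = _ := by rw [sub_zero]; ring

/-- Hölder continuity on pairs of points with comparable heights, together with the corresponding
decay, yields the weight. -/
lemma W.of_pairs {a C : ℝ} (ha : 0 < a) (hC0 : 0 ≤ C) (hb : ∀ x ∈ cyl d r, |f x| ≤ C * x.2 ^ a)
    (hC : ∀ x ∈ cyl d r, ∀ x' ∈ cyl d r, x'.2 ≤ x.2 → x.2 ≤ 2 * x'.2 →
      |f x - f x'| ≤ C * ‖x - x'‖ ^ a) : W r (Ioc 0 a) false a f := by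
  refine ⟨fun y hy s hs => ?_, fun η hη => ?_, fun ε hε η hη => ?_⟩
  · rw [ContinuousWithinAt, tendsto_iff_dist_tendsto_zero]
    have h1 : ContinuousAt (fun t : ℝ => C * |t - s| ^ a) s :=
      continuousAt_const.mul (ContinuousAt.rpow_const (by fun_prop) (Or.inr ha.le))
    have h3 := h1.tendsto.mono_left (nhdsWithin_le_nhds (s := Ioo 0 r))
    simp only [sub_self, abs_zero, Real.zero_rpow ha.ne', mul_zero] at h3
    refine squeeze_zero' (Eventually.of_forall fun _ => dist_nonneg) ?_ h3
    have hs0 := hs.1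
    filter_upwards [self_mem_nhdsWithin, mem_nhdsWithin_of_mem_nhds
      (Ioo_mem_nhds (show s / 2 < s by linarith) (show s < 2 * s by linarith))] with t ht ht'
    have hm := mk_mem_cyl.2 ⟨hy, ht⟩
    have hm' := mk_mem_cyl.2 ⟨hy, hs⟩
    rcases le_total s t with h | h
    · have := hC _ hm _ hm' h ht'.2.le
      simpa [Prod.norm_def, dist_eq_norm] using this
    · have := hC _ hm' _ hm h (by linarith [ht'.1])
      simpa [Prod.norm_def, dist_eq_norm, abs_sub_comm] using this
  · rw [mem_loss_false.1 hη, sub_zero]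
    exact ⟨C, hC0, hb⟩
  · rw [mem_loss_false.1 hη]
    refine ⟨C + 2 * C, by positivity, fun x hx x' hx' h1 h2 => ?_⟩
    have hp := (mem_cyl.1 hx).2.1
    have hp' := (mem_cyl.1 hx').2.1
    have hA : 0 ≤ x.2 ^ (a - ε) * ‖x - x'‖ ^ ε := by positivity
    rw [sub_zero, mul_assoc, add_mul]
    -- for distances larger than the height, the decay suffices
    rcases le_or_gt ‖x - x'‖ x.2 with h3 | h3
    · refine le_add_of_le_of_nonneg ((hC x hx x' hx' h1 h2).trans ?_) (by positivity)
      rcases (norm_nonneg (x - x')).eq_or_lt with h4 | h4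
      · rw [← h4, Real.zero_rpow ha.ne', mul_zero]; rw [← h4] at hA; positivity
      · have h5 : ‖x - x'‖ ^ a = ‖x - x'‖ ^ (a - ε) * ‖x - x'‖ ^ ε := by
          rw [← Real.rpow_add h4]; ring_nf
        rw [h5]
        gcongr
        exact sub_nonneg.2 hε.2
    · refine le_add_of_nonneg_of_le (by positivity) ?_
      have h4 : |f x'| ≤ C * x.2 ^ a := (hb x' hx').trans (by gcongr)
      have h5 : x.2 ^ a = x.2 ^ (a - ε) * x.2 ^ ε := by
        rw [← Real.rpow_add hp]; ring_nf
      calc |f x - f x'| ≤ |f x| + |f x'| := abs_sub _ _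
        _ ≤ 2 * C * (x.2 ^ (a - ε) * x.2 ^ ε) := by
            rw [← h5]; linarith [hb x hx]
        _ ≤ _ := by
            gcongr
            exact hε.1.le

/-- A uniformly Hölder continuous function that tends to `0` at the bottom of the cylinder has the
corresponding weight. -/
lemma W.of_isHolder {a : ℝ≥0} (ha : 0 < a) (h : IsHolder a f (cyl d r))
    (h0 : ∀ y ∈ tanBall d r, Tendsto (fun t => f (y, t)) (𝓝[Ioo 0 r] 0) (𝓝 0)) :
    W r (Ioc 0 (a : ℝ)) false a f := by
  rw [isHolder_iff] at h
  obtain ⟨C, hC0, hC⟩ := h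
  have hb : ∀ x ∈ cyl d r, |f x| ≤ C * x.2 ^ (a : ℝ) := by
    intro x hx
    have hx' := mem_cyl.1 hx
    have hr : 0 < r := hx'.2.1.trans hx'.2.2
    have := time_neBot hr
    have h1 : Tendsto (fun t => C * |x.2 - t| ^ (a : ℝ) + |f (x.1, t)|) (𝓝[Ioo 0 r] 0)
        (𝓝 (C * |x.2 - 0| ^ (a : ℝ) + |0|)) := by
      refine Tendsto.add ?_ (h0 x.1 hx'.1).abs
      have : ContinuousAt (fun t : ℝ => C * |x.2 - t| ^ (a : ℝ)) 0 :=
        continuousAt_const.mul (ContinuousAt.rpow_const (by fun_prop) (Or.inr a.2))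
      exact this.tendsto.mono_left nhdsWithin_le_nhds
    rw [sub_zero, abs_zero, add_zero, abs_of_pos hx'.2.1] at h1
    refine ge_of_tendsto h1 ?_
    filter_upwards [self_mem_nhdsWithin] with t ht
    have h2 := hC x hx (x.1, t) (mk_mem_cyl.2 ⟨hx'.1, ht⟩)
    have h3 : ‖x - (x.1, t)‖ = |x.2 - t| := by
      rw [Prod.norm_def]; simp
    rw [h3] at h2
    have := abs_sub_abs_le_abs_sub (f x) (f (x.1, t))
    rw [Real.norm_eq_abs] at h2
    linarith
  exact W.of_pairs ha hC0 hb fun x hx x' hx' _ _ => hC x hx x' hx'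

/-- A uniformly Hölder continuous function has weight `0`. -/
lemma W.of_isHolder_zero {a : ℝ≥0} (ha : 0 < a) (h : IsHolder a f (cyl d r)) :
    W r (Ioc 0 (a : ℝ)) false 0 f := by
  have hcont : ContinuousOn f (cyl d r) := by
    obtain ⟨C, hC⟩ := h
    exact hC.continuousOn ha
  rw [isHolder_iff] at h
  obtain ⟨C, hC0, hC⟩ := h
  refine ⟨fun y hy => hcont.comp (by fun_prop) fun t ht => mk_mem_cyl.2 ⟨hy, ht⟩,
    fun η hη => ?_, fun ε hε η hη => ?_⟩
  · rw [mem_loss_false.1 hη]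
    refine ⟨|f (0, r / 2)| + C * |2 * r| ^ (a : ℝ), by positivity, fun x hx => ?_⟩
    have hr := (mem_cyl.1 hx).2.1.trans (mem_cyl.1 hx).2.2
    have hm : ((0, r / 2) : Tan d × ℝ) ∈ cyl d r :=
      mk_mem_cyl.2 ⟨by simpa [tanBall] using hr, half_mem hr⟩
    have h1 := hC x hx _ hm
    have h2 := abs_sub_abs_le_abs_sub (f x) (f (0, r / 2))
    have h3 : ‖x - (0, r / 2)‖ ^ (a : ℝ) ≤ |2 * r| ^ (a : ℝ) := by
      have := (norm_sub_le_of_cyl hx hm).trans (le_abs_self _)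
      gcongr
    rw [Real.norm_eq_abs] at h1
    rw [sub_zero, Real.rpow_zero, mul_one]
    linarith [mul_le_mul_of_nonneg_left h3 hC0]
  · rw [mem_loss_false.1 hη]
    refine ⟨C * |2 * r| ^ ((a : ℝ) - ε) * |r| ^ ε, by positivity, fun x hx x' hx' _ _ => ?_⟩
    have hx0 := (mem_cyl.1 hx).2.1
    have hr := hx0.trans (mem_cyl.1 hx).2.2
    have h1 : 1 ≤ |r| ^ ε * x.2 ^ (0 - ε - 0) := by
      have := rpow_le_const (a := 0) (b := -ε) hx0 (mem_cyl.1 hx).2.2 (by linarith [hε.1])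
      rw [Real.rpow_zero, sub_neg_eq_add, zero_add] at this
      rwa [abs_of_pos hr, zero_sub, sub_zero]
    refine (hC x hx x' hx').trans ?_
    rcases (norm_nonneg (x - x')).eq_or_lt with h4 | h4
    · rw [← h4, Real.zero_rpow (by exact_mod_cast ha.ne'), Real.zero_rpow hε.1.ne']; simp
    · have h5 : ‖x - x'‖ ^ (a : ℝ) = ‖x - x'‖ ^ ((a : ℝ) - ε) * ‖x - x'‖ ^ ε := by
        rw [← Real.rpow_add h4]; ring_nf
      have h6 : ‖x - x'‖ ^ ((a : ℝ) - ε) ≤ |2 * r| ^ ((a : ℝ) - ε) :=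
        Real.rpow_le_rpow h4.le ((norm_sub_le_of_cyl hx hx').trans (le_abs_self _))
          (sub_nonneg.2 hε.2)
      calc C * ‖x - x'‖ ^ (a : ℝ) = C * ‖x - x'‖ ^ ((a : ℝ) - ε) * ‖x - x'‖ ^ ε * 1 := by
            rw [h5]; ring
        _ ≤ C * |2 * r| ^ ((a : ℝ) - ε) * ‖x - x'‖ ^ ε * (|r| ^ ε * x.2 ^ (0 - ε - 0)) := by
            gcongr
        _ = _ := by ring

/-- The tangential derivatives of a function that tends to `0` at the bottom of the cylinder do so
as well, if they are uniformly Hölder continuous. -/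
lemma IsGrad.tendsto_zero {a : ℝ≥0} (ha : 0 < a) {k : Fin d → Tan d × ℝ → ℝ} (hk : IsGrad r f k)
    {i : Fin d} (h : IsHolder a (k i) (cyl d r))
    (h0 : ∀ y ∈ tanBall d r, Tendsto (fun t => f (y, t)) (𝓝[Ioo 0 r] 0) (𝓝 0))
    {y : Tan d} (hy : y ∈ tanBall d r) :
    Tendsto (fun t => k i (y, t)) (𝓝[Ioo 0 r] 0) (𝓝 0) := by
  rw [isHolder_iff] at h
  obtain ⟨C, hC0, hC⟩ := h
  have ha' : (0 : ℝ) < a := ha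
  set v : Tan d := EuclideanSpace.single i 1
  have hv : ‖v‖ = 1 := by simp [v]
  obtain ⟨δ, hδ, hδy⟩ : ∃ δ > 0, ∀ σ ∈ Icc (0 : ℝ) δ, y + σ • v ∈ tanBall d r := by
    obtain ⟨δ, hδ, h⟩ := Metric.isOpen_iff.1 (isOpen_tanBall (d := d) (r := r)) y hy
    refine ⟨δ / 2, by positivity, fun σ hσ => h ?_⟩
    rw [mem_ball, dist_eq_norm, add_sub_cancel_left, norm_smul, hv, mul_one, Real.norm_eq_abs,
      abs_of_nonneg hσ.1]
    linarith [hσ.2]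
  -- the difference quotient with step `η` differs from the derivative by at most `C η^a`
  have key : ∀ η ∈ Ioc 0 δ, ∀ t ∈ Ioo 0 r,
      |k i (y, t)| ≤ C * η ^ (a : ℝ) + |f (y + η • v, t) - f (y, t)| / η := by
    intro η hη t ht
    have h1 : ∀ σ ∈ Icc (0 : ℝ) η, HasDerivWithinAt (fun σ : ℝ => f (y + σ • v, t) - σ * k i (y, t))
        (k i (y + σ • v, t) - k i (y, t)) (Icc 0 η) σ := by
      intro σ hσ
      have h2 := hk (y + σ • v, t) (mk_mem_cyl.2 ⟨hδy σ ⟨hσ.1, hσ.2.trans hη.2⟩, ht⟩)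
      have h3 : HasDerivAt (fun σ : ℝ => y + σ • v) v σ := by
        simpa using ((hasDerivAt_id σ).smul_const v).const_add y
      have h4 := h2.comp_hasDerivAt σ h3
      rw [sum_proj_single] at h4
      have h5 := h4.sub ((hasDerivAt_id σ).mul_const (k i (y, t)))
      rw [one_mul] at h5
      exact h5.hasDerivWithinAt
    have h2 := Convex.norm_image_sub_le_of_norm_hasDerivWithin_le h1 (C := C * η ^ (a : ℝ))
      (fun σ hσ => by
        refine (hC _ (mk_mem_cyl.2 ⟨hδy σ ⟨hσ.1, hσ.2.trans hη.2⟩, ht⟩) _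
          (mk_mem_cyl.2 ⟨hy, ht⟩)).trans ?_
        have h3 : ‖(y + σ • v, t) - (y, t)‖ = σ := by
          rw [Prod.norm_def]
          simp [norm_smul, hv, abs_of_nonneg hσ.1, hσ.1]
        rw [h3]
        gcongr
        exacts [hσ.1, hσ.2]) (convex_Icc 0 η) (x := 0) (y := η) ⟨le_rfl, hη.1.le⟩ ⟨hη.1.le, le_rfl⟩
    simp only [zero_smul, add_zero, zero_mul, sub_zero, Real.norm_eq_abs, abs_of_pos hη.1] at h2
    have h6 : |η * k i (y, t)| ≤ C * η ^ (a : ℝ) * η + |f (y + η • v, t) - f (y, t)| := by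
      have := abs_sub_abs_le_abs_sub (η * k i (y, t)) (f (y + η • v, t) - f (y, t))
      rw [abs_sub_comm (η * k i (y, t))] at this
      have h7 : f (y + η • v, t) - f (y, t) - η * k i (y, t) =
        f (y + η • v, t) - η * k i (y, t) - f (y, t) := by ring
      rw [h7] at this
      linarith
    rw [abs_mul, abs_of_pos hη.1] at h6
    have hη0 := hη.1
    rw [← mul_le_mul_iff_right₀ hη0]
    calc η * |k i (y, t)| ≤ _ := h6
      _ = _ := by field_simp
  rw [Metric.tendsto_nhds]
  intro ε hε
  obtain ⟨η, hη, hη'⟩ : ∃ η ∈ Ioc 0 δ, C * η ^ (a : ℝ) < ε / 2 := by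
    have h1 : Tendsto (fun η : ℝ => C * η ^ (a : ℝ)) (𝓝[>] 0) (𝓝 0) := by
      have : ContinuousAt (fun η : ℝ => C * η ^ (a : ℝ)) 0 :=
        continuousAt_const.mul (ContinuousAt.rpow_const (by fun_prop) (Or.inr a.2))
      have h3 := this.tendsto.mono_left (nhdsWithin_le_nhds (s := Ioi 0))
      simpa [Real.zero_rpow ha'.ne'] using h3
    exact ((Ioc_mem_nhdsGT hδ : Ioc 0 δ ∈ 𝓝[>] (0 : ℝ)) |> fun h2 =>
      (Filter.Eventually.and h2 (h1.eventually (gt_mem_nhds (half_pos hε))))).exists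
  have h2 : Tendsto (fun t => |f (y + η • v, t) - f (y, t)| / η) (𝓝[Ioo 0 r] 0) (𝓝 0) := by
    have := (((h0 _ (hδy η ⟨hη.1.le, hη.2⟩)).sub (h0 y hy)).abs).div_const η
    simpa using this
  filter_upwards [self_mem_nhdsWithin, h2.eventually (gt_mem_nhds (half_pos hε))] with t ht h3
  rw [dist_zero_right, Real.norm_eq_abs]
  linarith [key η hη t ht]

lemma Reg.of_isHolder {a : ℝ≥0} (ha : 0 < a)
    (h : Reg r (fun f => IsHolder a f (cyl d r)) 0 s f)
    (h0 : ∀ y ∈ tanBall d r, Tendsto (fun t => f (y, t)) (𝓝[Ioo 0 r] 0) (𝓝 0)) :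
    Reg r (W r (Ioc 0 (a : ℝ)) false a) 0 s f := by
  refine Reg.of_family (fun m s f => m = 0 ∧ Reg r (fun f => IsHolder a f (cyl d r)) 0 s f ∧
    ∀ y ∈ tanBall d r, Tendsto (fun t => f (y, t)) (𝓝[Ioo 0 r] 0) (𝓝 0))
    ?_ ?_ ?_ _ _ _ ⟨rfl, h, h0⟩
  · rintro _ _ f ⟨-, h, h0⟩
    exact W.of_isHolder ha h.base h0
  · rintro m s f ⟨h, -⟩
    omega
  · rintro m s f ⟨rfl, h, h0⟩
    obtain ⟨k, hk, hk'⟩ := h.grad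
    exact ⟨k, hk, fun a => ⟨rfl, hk' a, fun y hy => hk.tendsto_zero ha (hk' a).base h0 hy⟩⟩

/-- Solutions of `(t ∂_t - N) f = g` with an integer `N` larger than the weight. They are compared
with the solution that is given by integration from the top of the cylinder. -/
lemma Reg.solve_neg (hr : 0 < r) (hS : S ⊆ Ioc 0 1) {N : ℕ} (hN : γ < N)
    (hg : Reg r (W r S e γ) m s g) (h : IsTheta r f (fun x => g x + N * f x))
    (hs : RegC r S s (fun y => f (y, r / 2))) : Reg r (W r S e γ) (m + 1) s f := by
  have hA : Adm r r (-N + γ) := Or.inr ⟨rfl, by linarith⟩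
  have hp := hg.invOp hS hA fun ε hε => Or.inr ⟨rfl, by linarith [(hS hε).1]⟩
  have hpt := hg.base.isTheta_invOp hA
  set p := SingularExpansion.invOp (-N : ℝ) r g with hpdef
  have hw := (h.congr (eqOn_refl _ _) fun x _ => by ring :
    IsTheta r f (fun x => g x + -(-N : ℝ) * f x)).sub_homogeneous hpt
  have hc : RegC r S s (fun y => (r / 2) ^ (-N : ℝ) * (f (y, r / 2) + -1 * p (y, r / 2))) :=
    (hs.add (((hp.mono (Nat.zero_le _) le_rfl).slice hS (half_mem hr)).const_mul
      (-1))).const_mul _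
  have hterm := (hc.mono_logW (e := false) (q := m + 1) (i := N) (j := 0) hr hS
    (Or.inr rfl)).weakenW Subset.rfl (e' := e) (γ' := γ) (dom_of_lt hN)
  refine (hp.addW hterm).congrW fun x hx => ?_
  have hx' := mem_cyl.1 hx
  have h1 := hw.eq_of_homogeneous hx'.1 hx'.2 (half_mem hr)
  have h2 : x.2 ^ N * x.2 ^ (-N : ℝ) = 1 := by
    rw [← Real.rpow_natCast, ← Real.rpow_add hx'.2.1]; simp
  simp only [pow_zero, mul_one]
  rw [← h1]
  calc f x = p x + (f x + -1 * p x) * (x.2 ^ N * x.2 ^ (-N : ℝ)) := by rw [h2]; ring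
    _ = _ := by ring

/-- An exchange of derivatives: if `f` and `g = t ∂_t f` have tangential derivatives, then
`t ∂_t` may be applied to those of `f`. -/
lemma Reg.of_isTheta (hr : 0 < r) (hS : S ⊆ Ioc 0 1) (hf : Reg r (W r S e γ) 0 s f)
    (hg : Reg r (W r S e γ) m s g) (h : IsTheta r f g) : Reg r (W r S e γ) (m + 1) s f := by
  have H : ∀ m' ≤ m + 1, Reg r (W r S e γ) m' s f := by
    intro m'
    induction m' with
    | zero => exact fun _ => hf
    | succ m' ih =>
      intro hm'
      obtain ⟨N, hN⟩ := exists_nat_gt γ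
      exact Reg.solve_neg hr hS hN ((hg.mono (by omega) le_rfl).addW
        ((ih (by omega)).const_mulW (-N : ℝ))) (h.congr (eqOn_refl _ _) fun x _ => by ring)
        (hf.slice hS (half_mem hr))
  exact H (m + 1) le_rfl

/-- Solutions of `(t ∂_t + μ) f = g` with `μ > 0` that do not contain the singular homogeneous
solution `t^(-μ)`. -/
lemma Reg.solve_pos (hr : 0 < r) (hS : S ⊆ Ioc 0 1) {μ : ℝ} (hμ : 0 < μ + γ)
    (hμ' : ∀ ε ∈ S, 0 < μ + γ - ε)
    (hg : Reg r (W r S e γ) m s g) (h : IsTheta r f (fun x => g x + -μ * f x))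
    (h0 : ∀ y ∈ tanBall d r, Tendsto (fun t => t ^ μ * f (y, t)) (𝓝[Ioo 0 r] 0) (𝓝 0)) :
    Reg r (W r S e γ) (m + 1) s f := by
  have hA : Adm r 0 (μ + γ) := Or.inl ⟨rfl, hμ⟩
  have hp := hg.invOp hS hA fun ε hε => Or.inl ⟨rfl, hμ' ε hε⟩
  have hw := h.sub_homogeneous (hg.base.isTheta_invOp hA)
  refine hp.congrW fun x hx => ?_
  have := hw.eq_zero_of_homogeneous hr (fun y hy => ?_) hx
  · simp only [Pi.zero_apply] at this; linarith
  · have h2 := (h0 y hy).add ((hp.base.tendsto hμ hy).const_mul (-1))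
    simp only [mul_zero, add_zero] at h2
    exact h2.congr fun t => by ring

end Convert

/-! ### Local Hölder classes and the nonlinearity -/

section LocCHolder

variable {X Y Y' : Type*} [NormedAddCommGroup X] [NormedSpace ℝ X]
  [NormedAddCommGroup Y] [NormedSpace ℝ Y] [NormedAddCommGroup Y'] [NormedSpace ℝ Y']
  {a : ℝ≥0} {f g : X → Y} {U K : Set X} {n : ℕ}

lemma IsLocCHolder.clm_comp (hU : UniqueDiffOn ℝ U) (L : Y →L[ℝ] Y')
    (h : IsLocCHolder n a f U) : IsLocCHolder n a (fun x => L (f x)) U := by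
  refine ⟨L.contDiff.comp_contDiffOn h.1, fun K hK hKc => ?_⟩
  refine (h.2 K hK hKc).of_norm_le (norm_nonneg L) fun x hx y hy => ?_
  have h1 : ∀ x ∈ U, iteratedFDerivWithin ℝ n (fun x => L (f x)) U x =
      L.compContinuousMultilinearMap (iteratedFDerivWithin ℝ n f U x) := fun x hx =>
    L.iteratedFDerivWithin_comp_left (h.1 x hx) hU hx le_rfl
  rw [h1 x (hK hx), h1 y (hK hy)]
  refine le_trans (le_of_eq ?_) (L.norm_compContinuousMultilinearMap_le _)
  congr 1
  ext m; simp

lemma IsLocCHolder.isLocCHolder_fderivWithin (hU : UniqueDiffOn ℝ U)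
    (h : IsLocCHolder (n + 1) a f U) : IsLocCHolder n a (fderivWithin ℝ f U) U := by
  have h1 := h.1
  rw [Nat.cast_succ, contDiffOn_succ_iff_fderivWithin hU] at h1
  refine ⟨h1.2.2, fun K hK hKc => ?_⟩
  refine (h.2 K hK hKc).of_norm_le zero_le_one fun x hx y hy => ?_
  rw [iteratedFDerivWithin_succ_eq_comp_right hU (hK hx),
    iteratedFDerivWithin_succ_eq_comp_right hU (hK hy)]
  simp only [Function.comp]
  rw [one_mul, ← dist_eq_norm, ← dist_eq_norm, LinearIsometryEquiv.dist_map]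

lemma IsLocCHolder.add (hU : UniqueDiffOn ℝ U) (h : IsLocCHolder n a f U)
    (h' : IsLocCHolder n a g U) : IsLocCHolder n a (fun x => f x + g x) U := by
  refine ⟨h.1.add h'.1, fun K hK hKc => ((h.2 K hK hKc).add (h'.2 K hK hKc)).congr fun x hx => ?_⟩
  exact iteratedFDerivWithin_add_apply (h.1 x (hK hx)) (h'.1 x (hK hx)) hU (hK hx)

/-- On convex compact sets, functions of class `C^{n,a}` are Hölder continuous. -/
lemma IsLocCHolder.isHolder (ha : a ≤ 1) (hU : UniqueDiffOn ℝ U) (hK : K ⊆ U) (hKc : IsCompact K)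
    (hKv : Convex ℝ K) (h : IsLocCHolder n a f U) : IsHolder a f K := by
  rcases n with _ | n
  · refine (h.2 K hK hKc).of_norm_le zero_le_one fun x _ y _ => ?_
    simp only [iteratedFDerivWithin_zero_eq_comp, Function.comp]
    rw [one_mul, ← dist_eq_norm, ← dist_eq_norm, LinearIsometryEquiv.dist_map]
  · have h1 := h.1
    rw [Nat.cast_succ, contDiffOn_succ_iff_fderivWithin hU] at h1
    obtain ⟨C, hC⟩ := hKc.exists_bound_of_continuousOn (h1.2.2.continuousOn.mono hK)
    rw [isHolder_iff]
    have hC0 : ∀ x ∈ K, 0 ≤ C := fun x hx => (norm_nonneg _).trans (hC x hx)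
    refine ⟨|C| * diam K ^ (1 - (a : ℝ)), mul_nonneg (abs_nonneg _)
      (Real.rpow_nonneg diam_nonneg _), fun x hx y hy => ?_⟩
    have h2 := hKv.norm_image_sub_le_of_norm_hasFDerivWithin_le (f := f)
      (fun z hz => ((h1.1 z (hK hz)).hasFDerivWithinAt).mono hK) hC hy hx
    have h3 : ‖x - y‖ ≤ diam K ^ (1 - (a : ℝ)) * ‖x - y‖ ^ (a : ℝ) := by
      rcases (norm_nonneg (x - y)).eq_or_lt with h4 | h4
      · rw [← h4]; exact mul_nonneg (Real.rpow_nonneg diam_nonneg _) (by positivity)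
      · have h5 : ‖x - y‖ = ‖x - y‖ ^ (1 - (a : ℝ)) * ‖x - y‖ ^ (a : ℝ) := by
          rw [← Real.rpow_add h4]; simp
        have h6 : ‖x - y‖ ≤ diam K := by
          rw [← dist_eq_norm]; exact dist_le_diam_of_mem hKc.isBounded hx hy
        conv_lhs => rw [h5]
        gcongr
        exact sub_nonneg.2 (by exact_mod_cast ha)
    calc ‖f x - f y‖ ≤ C * ‖x - y‖ := h2
      _ ≤ |C| * (diam K ^ (1 - (a : ℝ)) * ‖x - y‖ ^ (a : ℝ)) := by
          gcongr
          exact le_abs_self C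
      _ = _ := by ring

end LocCHolder

section Partial

variable {Z : Type*} [NormedAddCommGroup Z] [NormedSpace ℝ Z] {R : ℝ} {D : Set Z}
  {H : Tan d × Z → ℝ} {H' : Tan d × Z → (Tan d × Z →L[ℝ] ℝ)} {L : Tan d × Z → (Z →L[ℝ] ℝ)}
  {L' : Tan d × Z → (Tan d × Z →L[ℝ] (Z →L[ℝ] ℝ))}

lemma hasDerivAt_shift {Y : Type*} [NormedAddCommGroup Y] [NormedSpace ℝ Y] {G : Tan d × Z → Y}
    {G' : Tan d × Z →L[ℝ] Y} {e y : Tan d} {z : Z} {σ : ℝ} (hy : y + σ • e ∈ tanBall d R)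
    (hz : z ∈ D) (h : HasFDerivWithinAt G G' (tanBall d R ×ˢ D) (y + σ • e, z)) :
    HasDerivAt (fun σ : ℝ => G (y + σ • e, z)) (G' (e, 0)) σ := by
  have h1 : HasDerivAt (fun σ : ℝ => y + σ • e) e σ := by
    simpa using ((hasDerivAt_id σ).smul_const e).const_add y
  refine h.comp_hasDerivAt_of_eq σ (h1.prodMk (hasDerivAt_const σ z)) ?_ rfl
  have h2 : ∀ᶠ σ' in 𝓝 σ, y + σ' • e ∈ tanBall d R :=
    h1.continuousAt.eventually (isOpen_tanBall.mem_nhds hy)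
  filter_upwards [h2] with σ' h using ⟨h, hz⟩

lemma norm_sub_sub_smul_le {Y : Type*} [NormedAddCommGroup Y] [NormedSpace ℝ Y] {f f' : ℝ → Y}
    {A : Y} {σ ε : ℝ} (hσ : 0 ≤ σ) (hf : ∀ σ' ∈ Icc 0 σ, HasDerivAt f (f' σ') σ')
    (hε : ∀ σ' ∈ Icc 0 σ, ‖f' σ' - A‖ ≤ ε) : ‖f σ - f 0 - σ • A‖ ≤ ε * σ := by
  have h1 : ∀ σ' ∈ Icc 0 σ, HasDerivWithinAt (fun σ' => f σ' - σ' • A) (f' σ' - A)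
      (Icc 0 σ) σ' := fun σ' hσ' => by
    have h2 := (hasDerivAt_id σ').smul_const A
    rw [one_smul] at h2
    exact ((hf σ' hσ').sub h2).hasDerivWithinAt
  have h3 := Convex.norm_image_sub_le_of_norm_hasDerivWithin_le h1 hε (convex_Icc 0 σ)
    ⟨le_rfl, hσ⟩ ⟨hσ, le_rfl⟩
  simp only [zero_smul, sub_zero, Real.norm_eq_abs, abs_of_nonneg hσ] at h3
  rwa [sub_right_comm]

/-- Exchange of a tangential derivative with the derivative in the remaining variables, under the
assumption that the latter is continuously differentiable. -/
lemma hasFDerivWithinAt_partial (hD : Convex ℝ D)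
    (hH : ∀ x ∈ tanBall d R ×ˢ D, HasFDerivWithinAt H (H' x) (tanBall d R ×ˢ D) x)
    (hL : ∀ y ∈ tanBall d R, ∀ z ∈ D, HasFDerivWithinAt (fun z => H (y, z)) (L (y, z)) D z)
    (hL' : ∀ x ∈ tanBall d R ×ˢ D, HasFDerivWithinAt L (L' x) (tanBall d R ×ˢ D) x)
    (hc : ContinuousOn L' (tanBall d R ×ˢ D)) (e : Tan d) {y : Tan d} (hy : y ∈ tanBall d R)
    {z : Z} (hz : z ∈ D) :
    HasFDerivWithinAt (fun z => H' (y, z) (e, 0)) (L' (y, z) (e, 0)) D z := by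
  obtain ⟨A, hA⟩ : ∃ A, A = L' (y, z) (e, 0) := ⟨_, rfl⟩
  rw [← hA]
  refine HasFDerivWithinAt.of_isLittleO (isLittleO_iff.2 fun ε hε => ?_)
  have hc' : ContinuousWithinAt (fun x => L' x (e, 0)) (tanBall d R ×ˢ D) (y, z) :=
    (hc (y, z) ⟨hy, hz⟩).clm_apply continuousWithinAt_const
  obtain ⟨δ, hδ, hδ'⟩ := Metric.continuousWithinAt_iff.1 hc' ε hε
  rw [← hA] at hδ'
  have hδ'' : ∀ x ∈ tanBall d R ×ˢ D, dist x (y, z) < δ → ‖L' x (e, 0) - A‖ ≤ ε := by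
    intro x hx h
    have h1 := hδ' hx h
    rw [dist_eq_norm] at h1
    exact h1.le
  -- segments in direction `e` that start at `y` and are short enough
  have hshort : ∀ᶠ σ : ℝ in 𝓝 0, y + σ • e ∈ tanBall d R ∧ dist (y + σ • e) y < δ := by
    have h1 : ContinuousAt (fun σ : ℝ => y + σ • e) 0 := by fun_prop
    have h2 : y + (0 : ℝ) • e = y := by simp
    have h3 : tanBall d R ∩ ball y δ ∈ 𝓝 (y + (0 : ℝ) • e) := by
      rw [h2]
      exact inter_mem (isOpen_tanBall.mem_nhds hy) (ball_mem_nhds y hδ)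
    exact h1.eventually h3
  obtain ⟨σ₀, hσ₀, hs⟩ := Metric.eventually_nhds_iff.1 hshort
  have hs' : ∀ σ ∈ Ioo 0 σ₀, ∀ σ' ∈ Icc 0 σ, y + σ' • e ∈ tanBall d R ∧
      dist (y + σ' • e) y < δ := fun σ hσ σ' hσ' => hs (by
    rw [Real.dist_eq, sub_zero, abs_of_nonneg hσ'.1]
    exact hσ'.2.trans_lt hσ.2)
  filter_upwards [self_mem_nhdsWithin, mem_nhdsWithin_of_mem_nhds (ball_mem_nhds z hδ)]
    with z' hz' hzδ
  have inner : ∀ σ ∈ Ioo 0 σ₀, ∀ ζ ∈ D ∩ ball z δ,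
      ‖L (y + σ • e, ζ) - L (y, ζ) - σ • A‖ ≤ ε * σ := by
    intro σ hσ ζ hζ
    have h1 : ∀ σ' ∈ Icc 0 σ, HasDerivAt (fun σ' : ℝ => L (y + σ' • e, ζ))
        (L' (y + σ' • e, ζ) (e, 0)) σ' := fun σ' hσ' =>
      hasDerivAt_shift (hs' σ hσ σ' hσ').1 hζ.1 (hL' _ ⟨(hs' σ hσ σ' hσ').1, hζ.1⟩)
    have h2 : ∀ σ' ∈ Icc 0 σ, ‖L' (y + σ' • e, ζ) (e, 0) - A‖ ≤ ε := fun σ' hσ' => by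
      have h3 : dist (y + σ' • e, ζ) (y, z) < δ := by
        rw [Prod.dist_eq]
        exact max_lt (hs' σ hσ σ' hσ').2 hζ.2
      exact hδ'' (y + σ' • e, ζ) ⟨(hs' σ hσ σ' hσ').1, hζ.1⟩ h3
    have h3 := norm_sub_sub_smul_le hσ.1.le h1 h2
    rwa [zero_smul, add_zero] at h3
  have outer : ∀ σ ∈ Ioo 0 σ₀, ‖H (y + σ • e, z') - H (y, z') - σ • A z' -
      (H (y + σ • e, z) - H (y, z) - σ • A z)‖ ≤ ε * σ * ‖z' - z‖ := by
    intro σ hσ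
    have hyσ := (hs' σ hσ σ ⟨hσ.1.le, le_rfl⟩).1
    have h1 : ∀ ζ ∈ D ∩ ball z δ, HasFDerivWithinAt
        (fun ζ => H (y + σ • e, ζ) - H (y, ζ) - σ • A ζ)
        (L (y + σ • e, ζ) - L (y, ζ) - σ • A) (D ∩ ball z δ) ζ := fun ζ hζ =>
      (((hL _ hyσ ζ hζ.1).sub (hL _ hy ζ hζ.1)).sub
        (A.hasFDerivWithinAt.const_smul σ)).mono inter_subset_left
    exact Convex.norm_image_sub_le_of_norm_hasFDerivWithin_le h1 (inner σ hσ)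
      (hD.inter (convex_ball z δ)) ⟨hz, mem_ball_self hδ⟩ ⟨hz', hzδ⟩
  have hy0 : y + (0 : ℝ) • e ∈ tanBall d R := by simpa using hy
  have hlim : Tendsto (fun σ : ℝ => ‖σ⁻¹ • ((H (y + σ • e, z') - H (y + σ • e, z)) -
      (H (y, z') - H (y, z))) - A (z' - z)‖) (𝓝[>] 0)
      (𝓝 ‖H' (y, z') (e, 0) - H' (y, z) (e, 0) - A (z' - z)‖) := by
    have h1 := ((hasDerivAt_shift hy0 hz' (hH _ ⟨hy0, hz'⟩)).sub
      (hasDerivAt_shift hy0 hz (hH _ ⟨hy0, hz⟩))).tendsto_slope_zero_right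
    simp only [zero_add, Pi.sub_apply, zero_smul, add_zero] at h1
    exact (h1.sub_const _).norm
  refine le_of_tendsto hlim ?_
  filter_upwards [Ioo_mem_nhdsGT hσ₀] with σ hσ
  have h1 := outer σ hσ
  have hσ0 := hσ.1
  have h2 : σ⁻¹ • ((H (y + σ • e, z') - H (y + σ • e, z)) - (H (y, z') - H (y, z))) - A (z' - z) =
      σ⁻¹ * (H (y + σ • e, z') - H (y, z') - σ • A z' -
      (H (y + σ • e, z) - H (y, z) - σ • A z)) := by
    rw [map_sub]
    simp only [smul_eq_mul]
    field_simp
    ring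
  rw [h2, norm_mul, norm_inv, Real.norm_eq_abs σ, abs_of_pos hσ0, inv_mul_le_iff₀ hσ0]
  calc _ ≤ _ := h1
    _ = _ := by ring

end Partial

section Classes

variable {Z : Type*} [NormedAddCommGroup Z] [NormedSpace ℝ Z] {R : ℝ} {D : Set Z}
  {F G : Tan d × Z → ℝ} {a : ℝ≥0} {n m s : ℕ} {P : (Tan d × Z → ℝ) → Prop}

lemma IsLocCHolder.hasFDerivWithinAt_prod {Y : Type*} [NormedAddCommGroup Y] [NormedSpace ℝ Y]
    {F : Tan d × Z → Y} (h : IsLocCHolder (n + 1) a F (tanBall d R ×ˢ D)) :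
    ∀ x ∈ tanBall d R ×ˢ D, HasFDerivWithinAt F
      (fderivWithin ℝ F (tanBall d R ×ˢ D) x) (tanBall d R ×ˢ D) x := fun x hx =>
  ((h.1 x hx).differentiableWithinAt (by simp)).hasFDerivWithinAt

lemma IsLocCHolder.toCY (hD : UniqueDiffOn ℝ D)
    (hP : ∀ n F, IsLocCHolder n a F (tanBall d R ×ˢ D) → P F) (hs : s ≤ n)
    (h : IsLocCHolder n a F (tanBall d R ×ˢ D)) : CY R D P s F := by
  have hU : UniqueDiffOn ℝ (tanBall d R ×ˢ D) := isOpen_tanBall.uniqueDiffOn.prod hD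
  induction s generalizing F n with
  | zero => exact hP n _ h
  | succ s ih =>
    obtain ⟨n, rfl⟩ : ∃ k, n = k + 1 := ⟨n - 1, by omega⟩
    exact ⟨hP _ _ h, _, h.hasFDerivWithinAt_prod, fun v => ih (n := n) (by omega)
      ((h.isLocCHolder_fderivWithin hU).clm_comp hU (ContinuousLinearMap.apply ℝ ℝ v))⟩

/-- A function of class `C^{n,a}` has `m` derivatives along `Z` of class `C^{s,a}` if
`m + s ≤ n`. -/
lemma IsLocCHolder.toCFz (hD : UniqueDiffOn ℝ D)
    (hP : ∀ n F, IsLocCHolder n a F (tanBall d R ×ˢ D) → P F) (hs : m + s ≤ n)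
    (h : IsLocCHolder n a F (tanBall d R ×ˢ D)) : CFz R D P m s F := by
  have hU : UniqueDiffOn ℝ (tanBall d R ×ˢ D) := isOpen_tanBall.uniqueDiffOn.prod hD
  induction m generalizing F n with
  | zero => exact h.toCY hD hP (by omega)
  | succ m ih =>
    obtain ⟨n, rfl⟩ : ∃ k, n = k + 1 := ⟨n - 1, by omega⟩
    refine ⟨h.toCY hD hP (by omega),
      fun x => (fderivWithin ℝ F (tanBall d R ×ˢ D) x).comp (ContinuousLinearMap.inr ℝ (Tan d) Z),
      fun y hy z hz => ?_, fun v => ih (n := n) (by omega)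
      ((h.isLocCHolder_fderivWithin hU).clm_comp hU
        (ContinuousLinearMap.apply ℝ ℝ ((0, v) : Tan d × Z)))⟩
    exact (h.hasFDerivWithinAt_prod (y, z) ⟨hy, hz⟩).comp z
      ((hasFDerivAt_prodMk_right y z).hasFDerivWithinAt) fun z' hz' => ⟨hy, hz'⟩

/-- `G` and its derivative along `Z` are of class `C^{n,a}` in all variables. -/
def HasLocZDeriv (R : ℝ) (D : Set Z) (n : ℕ) (a : ℝ≥0) (G : Tan d × Z → ℝ) : Prop :=
  IsLocCHolder n a G (tanBall d R ×ˢ D) ∧ ∃ L : Tan d × Z → (Z →L[ℝ] ℝ),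
    (∀ y ∈ tanBall d R, ∀ z ∈ D, HasFDerivWithinAt (fun z => G (y, z)) (L (y, z)) D z) ∧
      IsLocCHolder n a L (tanBall d R ×ˢ D)

lemma HasLocZDeriv.add (hD : UniqueDiffOn ℝ D) (hF : HasLocZDeriv R D n a F)
    (hG : HasLocZDeriv R D n a G) : HasLocZDeriv R D n a (fun x => F x + G x) := by
  have hU : UniqueDiffOn ℝ (tanBall d R ×ˢ D) := isOpen_tanBall.uniqueDiffOn.prod hD
  obtain ⟨hF, L, hL, hL'⟩ := hF
  obtain ⟨hG, M, hM, hM'⟩ := hG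
  exact ⟨hF.add hU hG, fun x => L x + M x, fun y hy z hz => (hL y hy z hz).add (hM y hy z hz),
    hL'.add hU hM'⟩

/-- The class is stable under partial derivatives in all variables, with a loss of one order: those
in `y'` commute with the derivative along `Z`. -/
lemma HasLocZDeriv.hasLocZDeriv_fderivWithin (hD : UniqueDiffOn ℝ D) (hDc : Convex ℝ D)
    (h : HasLocZDeriv R D (n + 1) a G) (w : Tan d × Z) :
    HasLocZDeriv R D n a (fun x => fderivWithin ℝ G (tanBall d R ×ˢ D) x w) := by
  have hU : UniqueDiffOn ℝ (tanBall d R ×ˢ D) := isOpen_tanBall.uniqueDiffOn.prod hD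
  obtain ⟨hG, L, hL, hL'⟩ := h
  have h1 : HasLocZDeriv R D n a (fun x => fderivWithin ℝ G (tanBall d R ×ˢ D) x (w.1, 0)) := by
    refine ⟨(hG.isLocCHolder_fderivWithin hU).clm_comp hU
        (ContinuousLinearMap.apply ℝ ℝ ((w.1, 0) : Tan d × Z)),
      fun x => fderivWithin ℝ L (tanBall d R ×ˢ D) x (w.1, 0), fun y hy z hz => ?_,
      (hL'.isLocCHolder_fderivWithin hU).clm_comp hU
        (ContinuousLinearMap.apply ℝ (Z →L[ℝ] ℝ) ((w.1, 0) : Tan d × Z))⟩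
    exact hasFDerivWithinAt_partial hDc hG.hasFDerivWithinAt_prod hL hL'.hasFDerivWithinAt_prod
      (hL'.isLocCHolder_fderivWithin hU).1.continuousOn w.1 hy hz
  have h2 : HasLocZDeriv R D n a (fun x => fderivWithin ℝ G (tanBall d R ×ˢ D) x (0, w.2)) := by
    refine ⟨(hG.isLocCHolder_fderivWithin hU).clm_comp hU
        (ContinuousLinearMap.apply ℝ ℝ ((0, w.2) : Tan d × Z)),
      fun x => (ContinuousLinearMap.apply ℝ ℝ w.2).comp
        ((fderivWithin ℝ L (tanBall d R ×ˢ D) x).comp (ContinuousLinearMap.inr ℝ (Tan d) Z)),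
      fun y hy z hz => ?_, ?_⟩
    · have h3 : ∀ z ∈ D, fderivWithin ℝ G (tanBall d R ×ˢ D) (y, z) (0, w.2) = L (y, z) w.2 := by
        intro z hz
        have h4 := (hG.hasFDerivWithinAt_prod (y, z) ⟨hy, hz⟩).comp z
          ((hasFDerivAt_prodMk_right y z).hasFDerivWithinAt) fun z' hz' => ⟨hy, hz'⟩
        exact congrArg (fun T => T w.2) ((hD z hz).eq h4 (hL y hy z hz))
      have h5 := (hL'.hasFDerivWithinAt_prod (y, z) ⟨hy, hz⟩).comp z
          ((hasFDerivAt_prodMk_right y z).hasFDerivWithinAt) fun z' hz' => ⟨hy, hz'⟩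
      exact ((ContinuousLinearMap.apply ℝ ℝ w.2).hasFDerivAt.comp_hasFDerivWithinAt z h5).congr h3
        (h3 z hz)
    · have h6 := (hL'.isLocCHolder_fderivWithin hU).clm_comp hU
        ((ContinuousLinearMap.compL ℝ Z (Z →L[ℝ] ℝ) ℝ (ContinuousLinearMap.apply ℝ ℝ w.2)).comp
        ((ContinuousLinearMap.compL ℝ Z (Tan d × Z) (Z →L[ℝ] ℝ)).flip
          (ContinuousLinearMap.inr ℝ (Tan d) Z)))
      exact h6
  have h3 := h1.add hD h2
  have h4 : ∀ x, fderivWithin ℝ G (tanBall d R ×ˢ D) x w =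
      fderivWithin ℝ G (tanBall d R ×ˢ D) x (w.1, 0) +
        fderivWithin ℝ G (tanBall d R ×ˢ D) x (0, w.2) := fun x => by
    rw [← map_add]; simp
  simpa only [h4] using h3

lemma HasLocZDeriv.toCY (hD : UniqueDiffOn ℝ D) (hDc : Convex ℝ D)
    (hP : ∀ n F, HasLocZDeriv R D n a F → P F) (hs : s ≤ n)
    (h : HasLocZDeriv R D n a F) : CY R D P s F := by
  induction s generalizing F n with
  | zero => exact hP n _ h
  | succ s ih =>
    obtain ⟨n, rfl⟩ : ∃ k, n = k + 1 := ⟨n - 1, by omega⟩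
    exact ⟨hP _ _ h, _, h.1.hasFDerivWithinAt_prod, fun v => ih (n := n) (by omega)
      (h.hasLocZDeriv_fderivWithin hD hDc v)⟩

/-- If all iterated derivatives of `F` along `Z` are of class `C^{n,a}`, then so are the functions
obtained by evaluating them, with any number of further derivatives along `Z`. -/
lemma toCFz_of_iteratedFDerivWithin (hD : UniqueDiffOn ℝ D) (hDc : Convex ℝ D)
    (hP : ∀ n F, HasLocZDeriv R D n a F → P F)
    (hs : ∀ y ∈ tanBall d R, ContDiffOn ℝ ∞ (fun z => F (y, z)) D)
    (hF : ∀ j : ℕ, IsLocCHolder n a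
      (fun x : Tan d × Z => iteratedFDerivWithin ℝ j (fun z => F (x.1, z)) D x.2)
      (tanBall d R ×ˢ D)) (m : ℕ) : CFz R D P m n F := by
  have hU : UniqueDiffOn ℝ (tanBall d R ×ˢ D) := isOpen_tanBall.uniqueDiffOn.prod hD
  suffices H : ∀ (m j : ℕ) (T : (ContinuousMultilinearMap ℝ (fun _ : Fin j => Z) ℝ) →L[ℝ] ℝ),
      CFz R D P m n
        (fun x => T (iteratedFDerivWithin ℝ j (fun z => F (x.1, z)) D x.2)) by
    have := H m 0 ((continuousMultilinearCurryFin0 ℝ Z ℝ).toContinuousLinearEquiv : _ →L[ℝ] _)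
    simpa using this
  have key : ∀ (j : ℕ) (T : (ContinuousMultilinearMap ℝ (fun _ : Fin j => Z) ℝ) →L[ℝ] ℝ),
      ∃ T' : (ContinuousMultilinearMap ℝ (fun _ : Fin (j + 1) => Z) ℝ) →L[ℝ] (Z →L[ℝ] ℝ),
      ∀ y ∈ tanBall d R, ∀ z ∈ D, HasFDerivWithinAt
        (fun z => T (iteratedFDerivWithin ℝ j (fun z => F (y, z)) D z))
        (T' (iteratedFDerivWithin ℝ (j + 1) (fun z => F (y, z)) D z)) D z := by
    intro j T
    refine ⟨(ContinuousLinearMap.compL ℝ Z _ ℝ T).comp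
      ((continuousMultilinearCurryLeftEquiv ℝ (fun _ : Fin (j + 1) => Z)
        ℝ).toContinuousLinearEquiv : _ →L[ℝ] _), fun y hy z hz => ?_⟩
    have h1 : DifferentiableWithinAt ℝ (iteratedFDerivWithin ℝ j (fun z => F (y, z)) D) D z :=
      (hs y hy).differentiableOn_iteratedFDerivWithin (by exact_mod_cast WithTop.coe_lt_top _)
        hD z hz
    have h2 := T.hasFDerivAt.comp_hasFDerivWithinAt z h1.hasFDerivWithinAt
    refine h2.congr_fderiv ?_
    rw [iteratedFDerivWithin_succ_eq_comp_left]
    ext v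
    simp
  have hcl : ∀ (j : ℕ) (T : (ContinuousMultilinearMap ℝ (fun _ : Fin j => Z) ℝ) →L[ℝ] ℝ),
      HasLocZDeriv R D n a
        (fun x => T (iteratedFDerivWithin ℝ j (fun z => F (x.1, z)) D x.2)) := by
    intro j T
    obtain ⟨T', hT'⟩ := key j T
    exact ⟨(hF j).clm_comp hU T, _, hT', (hF (j + 1)).clm_comp hU T'⟩
  intro m
  induction m with
  | zero => exact fun j T => (hcl j T).toCY hD hDc hP le_rfl
  | succ m ih =>
    intro j T
    obtain ⟨T', hT'⟩ := key j T
    exact ⟨(hcl j T).toCY hD hDc hP le_rfl, _, hT', fun v => ih (j + 1)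
      ((ContinuousLinearMap.apply ℝ ℝ v).comp T')⟩

end Classes

section CompBase

variable {Z : Type*} [NormedAddCommGroup Z] [NormedSpace ℝ Z] {ι : Type*} [Fintype ι]
  (b : Module.Basis ι ℝ Z) {z : Tan d × ℝ → Z} {F : Tan d × Z → ℝ} {a : ℝ≥0} {R γ ε : ℝ}
  {S : Set ℝ} {KY : Set (Tan d)} {D KZ : Set Z} {n : ℕ}

/-- The properties of nonlinearities with a continuous derivative along `Z` that are used on a
compact set. -/
def HolderLip (a : ℝ≥0) (KY : Set (Tan d)) (KZ : Set Z) (F : Tan d × Z → ℝ) : Prop :=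
  IsHolder a F (KY ×ˢ KZ) ∧ ∃ Λ : ℝ, 0 ≤ Λ ∧ ∀ y ∈ KY, ∀ z ∈ KZ, ∀ z' ∈ KZ,
    |F (y, z) - F (y, z')| ≤ Λ * ‖z - z'‖

lemma HasLocZDeriv.holderLip (ha : a ≤ 1) (hD : UniqueDiffOn ℝ D) (hKY : KY ⊆ tanBall d R)
    (hKZ : KZ ⊆ D) (hY : IsCompact KY) (hZ : IsCompact KZ) (hYc : Convex ℝ KY)
    (hZc : Convex ℝ KZ) (h : HasLocZDeriv R D n a F) : HolderLip a KY KZ F := by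
  have hU : UniqueDiffOn ℝ (tanBall d R ×ˢ D) := isOpen_tanBall.uniqueDiffOn.prod hD
  have hK := prod_mono hKY hKZ
  obtain ⟨hF, L, hL, hL'⟩ := h
  refine ⟨hF.isHolder ha hU hK (hY.prod hZ) (hYc.prod hZc), ?_⟩
  obtain ⟨C, hC⟩ := (hY.prod hZ).exists_bound_of_continuousOn (hL'.1.continuousOn.mono hK)
  refine ⟨|C|, abs_nonneg _, fun y hy z hz z' hz' => ?_⟩
  have h1 : ∀ ζ ∈ KZ, HasFDerivWithinAt (fun z => F (y, z)) (L (y, ζ)) KZ ζ := fun ζ hζ =>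
    (hL y (hKY hy) ζ (hKZ hζ)).mono hKZ
  exact Convex.norm_image_sub_le_of_norm_hasFDerivWithin_le h1
    (fun ζ hζ => (hC (y, ζ) ⟨hy, hζ⟩).trans (le_abs_self C)) hZc hz' hz

include b in
lemma norm_le_sum_coord (w : Z) : ‖w‖ ≤ ∑ i, |b.repr w i| * ‖b i‖ := by
  conv_lhs => rw [← b.sum_repr w]
  refine (norm_sum_le _ _).trans (Finset.sum_le_sum fun i _ => ?_)
  rw [norm_smul, Real.norm_eq_abs]

include b in
lemma norm_le_of_coord (hz : ∀ i, W r S false γ (fun x => b.repr (z x) i)) :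
    ∃ C, 0 ≤ C ∧ ∀ x ∈ cyl d r, ‖z x‖ ≤ C * x.2 ^ γ := by
  choose C h0 hC using fun i => (hz i).bd 0 (mem_loss_false.2 rfl)
  refine ⟨∑ i, C i * ‖b i‖, Finset.sum_nonneg fun i _ => mul_nonneg (h0 i) (norm_nonneg _),
    fun x hx => (norm_le_sum_coord b _).trans ?_⟩
  rw [Finset.sum_mul]
  refine Finset.sum_le_sum fun i _ => ?_
  have := hC i x hx
  rw [sub_zero] at this
  calc |b.repr (z x) i| * ‖b i‖ ≤ (C i * x.2 ^ γ) * ‖b i‖ := by gcongr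
    _ = _ := by ring

include b in
lemma norm_sub_le_of_coord (hε : ε ∈ S) (hz : ∀ i, W r S false γ (fun x => b.repr (z x) i)) :
    ∃ C, 0 ≤ C ∧ ∀ x ∈ cyl d r, ∀ x' ∈ cyl d r, x'.2 ≤ x.2 → x.2 ≤ 2 * x'.2 →
      ‖z x - z x'‖ ≤ C * x.2 ^ (γ - ε) * ‖x - x'‖ ^ ε := by
  choose C h0 hC using fun i => (hz i).hol ε hε 0 (mem_loss_false.2 rfl)
  refine ⟨∑ i, C i * ‖b i‖, Finset.sum_nonneg fun i _ => mul_nonneg (h0 i) (norm_nonneg _),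
    fun x hx x' hx' h1 h2 => (norm_le_sum_coord b _).trans ?_⟩
  rw [Finset.sum_mul, Finset.sum_mul]
  refine Finset.sum_le_sum fun i _ => ?_
  have := hC i x hx x' hx' h1 h2
  rw [sub_zero] at this
  rw [map_sub, Finsupp.sub_apply]
  calc |b.repr (z x) i - b.repr (z x') i| * ‖b i‖
      ≤ (C i * x.2 ^ (γ - ε) * ‖x - x'‖ ^ ε) * ‖b i‖ := by gcongr
    _ = _ := by ring

omit [NormedSpace ℝ Z] in
lemma isHolder_boundary (hKY : tanBall d r ⊆ KY) (h0 : (0 : Z) ∈ KZ)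
    (h : IsHolder a F (KY ×ˢ KZ)) : IsHolder a (fun x : Tan d × ℝ => F (x.1, 0)) (cyl d r) := by
  rw [isHolder_iff] at h ⊢
  obtain ⟨C, hC0, hC⟩ := h
  refine ⟨C, hC0, fun x hx x' hx' => (hC (x.1, 0) ⟨hKY (mem_cyl.1 hx).1, h0⟩ (x'.1, 0)
    ⟨hKY (mem_cyl.1 hx').1, h0⟩).trans ?_⟩
  have h1 : ‖((x.1, 0) : Tan d × Z) - (x'.1, 0)‖ ≤ ‖x - x'‖ := by
    rw [Prod.mk_sub_mk, sub_zero, Prod.norm_mk, norm_zero, max_eq_left (norm_nonneg _)]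
    exact norm_fst_le (x - x')
  gcongr

omit [NormedSpace ℝ Z] in
lemma compBase_of_pairs {C : ℝ} (ha : 0 < a) (hC : 0 ≤ C)
    (h1 : ∀ x ∈ cyl d r, |F (x.1, z x) - F (x.1, 0)| ≤ C * x.2 ^ (a : ℝ))
    (h2 : ∀ x ∈ cyl d r, ∀ x' ∈ cyl d r, x'.2 ≤ x.2 → x.2 ≤ 2 * x'.2 →
      |F (x.1, z x) - F (x'.1, z x')| ≤ C * ‖x - x'‖ ^ (a : ℝ))
    (h3 : IsHolder a (fun x : Tan d × ℝ => F (x.1, 0)) (cyl d r)) : CompBase r a z F := by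
  refine ⟨?_, W.of_isHolder_zero ha h3⟩
  rw [isHolder_iff] at h3
  obtain ⟨C', hC0', hC'⟩ := h3
  have ha' : (0 : ℝ) < a := ha
  refine (W.of_pairs (C := C + C') ha' (by positivity) (fun x hx => ?_)
    fun x hx x' hx' hl hl' => ?_).weaken Ioo_subset_Ioc_self (dom_of_le le_rfl)
  · have hx0 := (mem_cyl.1 hx).2.1
    rw [neg_one_mul, ← sub_eq_add_neg, add_mul]
    exact (h1 x hx).trans (le_add_of_nonneg_right (by positivity))
  · have e : F (x.1, z x) + -1 * F (x.1, 0) - (F (x'.1, z x') + -1 * F (x'.1, 0)) =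
        (F (x.1, z x) - F (x'.1, z x')) - (F (x.1, 0) - F (x'.1, 0)) := by ring
    rw [e, add_mul]
    exact (abs_sub _ _).trans (add_le_add (h2 x hx x' hx' hl hl') (hC' x hx x' hx'))

include b in
/-- For arguments that are Lipschitz on comparable heights, Hölder continuity of the nonlinearity
suffices. -/
lemma compBase_of_isHolder (ha : 0 < a) (hKY : tanBall d r ⊆ KY) (h0 : (0 : Z) ∈ KZ)
    (hzK : ∀ x ∈ cyl d r, z x ∈ KZ) (hz : ∀ i, W r {1} false 1 (fun x => b.repr (z x) i))
    (h : IsHolder a F (KY ×ˢ KZ)) : CompBase r a z F := by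
  have h3 := isHolder_boundary hKY h0 h
  rw [isHolder_iff] at h
  obtain ⟨C, hC0, hC⟩ := h
  obtain ⟨B, hB0, hB⟩ := norm_le_of_coord b hz
  obtain ⟨B', hB0', hB'⟩ := norm_sub_le_of_coord b (mem_singleton 1) hz
  have ha' : (0 : ℝ) < a := ha
  refine compBase_of_pairs (C := C * B ^ (a : ℝ) + C * (1 + B') ^ (a : ℝ)) ha (by positivity)
    (fun x hx => ?_) (fun x hx x' hx' hl hl' => ?_) h3
  · have hx' := mem_cyl.1 hx
    have hx0 := hx'.2.1
    have h1 := hC (x.1, z x) ⟨hKY hx'.1, hzK x hx⟩ (x.1, 0) ⟨hKY hx'.1, h0⟩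
    have h2 : ‖((x.1, z x) : Tan d × Z) - (x.1, 0)‖ ≤ B * x.2 := by
      rw [Prod.mk_sub_mk, sub_self, sub_zero, Prod.norm_mk, norm_zero,
        max_eq_right (norm_nonneg _)]
      simpa using hB x hx
    rw [add_mul]
    refine le_add_of_le_of_nonneg (h1.trans ?_) (by positivity)
    rw [mul_assoc, ← Real.mul_rpow hB0 hx0.le]
    gcongr
  · have hx1 := mem_cyl.1 hx
    have hx1' := mem_cyl.1 hx'
    have h1 := hC (x.1, z x) ⟨hKY hx1.1, hzK x hx⟩ (x'.1, z x') ⟨hKY hx1'.1, hzK x' hx'⟩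
    have h2 : ‖((x.1, z x) : Tan d × Z) - (x'.1, z x')‖ ≤ (1 + B') * ‖x - x'‖ := by
      rw [Prod.mk_sub_mk, Prod.norm_mk]
      have h4 := hB' x hx x' hx' hl hl'
      rw [sub_self, Real.rpow_zero, Real.rpow_one, mul_one] at h4
      have h5 : ‖x.1 - x'.1‖ ≤ ‖x - x'‖ := norm_fst_le (x - x')
      have h6 := mul_nonneg hB0' (norm_nonneg (x - x'))
      refine max_le ?_ ?_ <;> nlinarith [norm_nonneg (x - x')]
    rw [add_mul]
    refine le_add_of_nonneg_of_le (by positivity) (h1.trans ?_)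
    rw [mul_assoc, ← Real.mul_rpow (by positivity) (norm_nonneg _)]
    gcongr

include b in
/-- For arguments that are only Hölder continuous, the nonlinearity has to be Lipschitz along
`Z`. -/
lemma compBase_of_holderLip (ha : 0 < a) (hKY : tanBall d r ⊆ KY) (h0 : (0 : Z) ∈ KZ)
    (hzK : ∀ x ∈ cyl d r, z x ∈ KZ)
    (hz : ∀ i, W r (Ioc 0 (a : ℝ)) false a (fun x => b.repr (z x) i))
    (h : HolderLip a KY KZ F) : CompBase r a z F := by
  have h3 := isHolder_boundary hKY h0 h.1
  obtain ⟨h, Λ, hΛ0, hΛ⟩ := h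
  rw [isHolder_iff] at h
  obtain ⟨C, hC0, hC⟩ := h
  have ha' : (0 : ℝ) < a := ha
  obtain ⟨B, hB0, hB⟩ := norm_le_of_coord b hz
  obtain ⟨B', hB0', hB'⟩ := norm_sub_le_of_coord b (right_mem_Ioc.2 ha') hz
  refine compBase_of_pairs (C := Λ * B + (Λ * B' + C)) ha (by positivity)
    (fun x hx => ?_) (fun x hx x' hx' hl hl' => ?_) h3
  · have hx' := mem_cyl.1 hx
    have hx0 := hx'.2.1
    have h1 := hΛ x.1 (hKY hx'.1) (z x) (hzK x hx) 0 h0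
    rw [sub_zero] at h1
    rw [add_mul]
    refine le_add_of_le_of_nonneg (h1.trans ?_) (by positivity)
    rw [mul_assoc]
    gcongr
    exact hB x hx
  · have hx1 := mem_cyl.1 hx
    have hx1' := mem_cyl.1 hx'
    have h1 := hΛ x.1 (hKY hx1.1) (z x) (hzK x hx) (z x') (hzK x' hx')
    have h2 := hC (x.1, z x') ⟨hKY hx1.1, hzK x' hx'⟩ (x'.1, z x') ⟨hKY hx1'.1, hzK x' hx'⟩
    have h4 := hB' x hx x' hx' hl hl'
    rw [sub_self, Real.rpow_zero, mul_one] at h4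
    have h5 : ‖((x.1, z x') : Tan d × Z) - (x'.1, z x')‖ ≤ ‖x - x'‖ := by
      rw [Prod.mk_sub_mk, sub_self, Prod.norm_mk, norm_zero, max_eq_left (norm_nonneg _)]
      exact norm_fst_le (x - x')
    have h6 : ‖((x.1, z x') : Tan d × Z) - (x'.1, z x')‖ ^ (a : ℝ) ≤ ‖x - x'‖ ^ (a : ℝ) := by
      gcongr
    rw [add_mul]
    refine le_add_of_nonneg_of_le (by positivity) ?_
    calc |F (x.1, z x) - F (x'.1, z x')|
        ≤ |F (x.1, z x) - F (x.1, z x')| + |F (x.1, z x') - F (x'.1, z x')| := abs_sub_le _ _ _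
      _ ≤ Λ * (B' * ‖x - x'‖ ^ (a : ℝ)) + C * ‖x - x'‖ ^ (a : ℝ) := by
          refine add_le_add (h1.trans ?_) (h2.trans ?_)
          · gcongr
          · gcongr
      _ = _ := by ring

/-- Bounds on one derivative of each kind yield the weighted Lipschitz class. -/
lemma W.lipschitz {f g : Tan d × ℝ → ℝ} {k : Fin d → Tan d × ℝ → ℝ} (hf : W r ∅ false γ f)
    (hg : IsTheta r f g) (hg' : W r ∅ false γ g) (hk : IsGrad r f k)
    (hk' : ∀ a, W r ∅ false (γ - 1) (k a)) : W r {1} false γ f := by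
  refine W.of_theta (by simp) hg hf.bd hg'.bd fun ε hε η hη => ?_
  rw [mem_singleton_iff.1 hε, mem_loss_false.1 hη]
  choose C h0 hC using fun i => (hk' i).bd 0 (mem_loss_false.2 rfl)
  refine ⟨∑ i, C i, Finset.sum_nonneg fun i _ => h0 i, fun y hy y' hy' t ht => ?_⟩
  have ht0 := ht.1
  have h1 : ∀ z ∈ tanBall d r, HasFDerivWithinAt (fun z => f (z, t))
      (∑ a, k a (z, t) • (EuclideanSpace.proj a : Tan d →L[ℝ] ℝ)) (tanBall d r) z :=
    fun z hz => (hk (z, t) (mk_mem_cyl.2 ⟨hz, ht⟩)).hasFDerivWithinAt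
  have h2 : ∀ z ∈ tanBall d r, ‖∑ a, k a (z, t) • (EuclideanSpace.proj a : Tan d →L[ℝ] ℝ)‖ ≤
      (∑ i, C i) * t ^ (γ - 1 - 0) := by
    intro z hz
    rw [Finset.sum_mul]
    refine (norm_sum_le _ _).trans (Finset.sum_le_sum fun i _ => ?_)
    have h3 : ‖(EuclideanSpace.proj i : Tan d →L[ℝ] ℝ)‖ ≤ 1 :=
      ContinuousLinearMap.opNorm_le_bound _ zero_le_one fun v => by
        rw [one_mul]; exact PiLp.norm_apply_le v i
    have h4 := hC i (z, t) (mk_mem_cyl.2 ⟨hz, ht⟩)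
    rw [norm_smul, Real.norm_eq_abs]
    have := mul_le_mul h4 h3 (norm_nonneg _) (mul_nonneg (h0 i) (by positivity))
    rwa [mul_one] at this
  have h3 := Convex.norm_image_sub_le_of_norm_hasFDerivWithin_le h1 h2 (convex_ball 0 r) hy' hy
  rw [Real.rpow_one]
  exact h3

end CompBase

/-! ### First consequences of the hypotheses on the solution -/

section

variable {Y : Type*} [NormedAddCommGroup Y] [NormedSpace ℝ Y] {G : Tan d × ℝ → Y}
  {f : Tan d × ℝ → ℝ} {s : ℕ} {a : ℝ≥0}

lemma isOpen_cyl : IsOpen (cyl d r) := isOpen_tanBall.prod isOpen_Ioo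

lemma reg_clm_of_isHolder (L : Y →L[ℝ] ℝ)
    (hc : ∀ t ∈ Ioo 0 r, ContDiffOn ℝ s (fun z => G (z, t)) (tanBall d r))
    (hG : ∀ τ ≤ s, IsHolder a (dTanIter τ G) (cyl d r)) (hf : EqOn f (fun x => L (G x)) (cyl d r)) :
    Reg r (fun f => IsHolder a f (cyl d r)) 0 s f := by
  refine Reg.congr (fun f g h hg => hg.congr h) hf
    (reg_of_isHolder (fun t ht => L.contDiff.comp_contDiffOn (hc t ht)) fun τ hτ => ?_)
  have h1 : ∀ x ∈ cyl d r, dTanIter τ (fun x => L (G x)) x =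
      L.compContinuousMultilinearMap (dTanIter τ G x) := fun x hx =>
    L.iteratedFDeriv_comp_left ((hc x.2 (mem_cyl.1 hx).2).contDiffAt
      (isOpen_tanBall.mem_nhds (mem_cyl.1 hx).1)) (by exact_mod_cast hτ)
  refine (hG τ hτ).of_norm_le (norm_nonneg L) fun x hx y hy => ?_
  rw [h1 x hx, h1 y hy]
  refine le_trans (le_of_eq ?_) (L.norm_compContinuousMultilinearMap_le _)
  congr 1
  ext m; simp

lemma reg_smul_of_isHolder {g : Tan d × ℝ → ℝ} (φ : ℝ → ℝ)
    (hc : ∀ t ∈ Ioo 0 r, ContDiffOn ℝ s (fun z => g (z, t)) (tanBall d r))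
    (hG : ∀ τ ≤ s, IsHolder a (fun x => φ x.2 • dTanIter τ g x) (cyl d r))
    (hf : EqOn f (fun x => φ x.2 * g x) (cyl d r)) :
    Reg r (fun f => IsHolder a f (cyl d r)) 0 s f := by
  refine Reg.congr (fun f g h hg => hg.congr h) hf
    (reg_of_isHolder (fun t ht => (contDiffOn_const (c := φ t)).mul (hc t ht)) fun τ hτ => ?_)
  refine (hG τ hτ).congr fun x hx => ?_
  have h1 := (hc x.2 (mem_cyl.1 hx).2).contDiffAt (isOpen_tanBall.mem_nhds (mem_cyl.1 hx).1)
  exact iteratedFDeriv_const_smul_apply (a := φ x.2) (h1.of_le (by exact_mod_cast hτ))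

lemma contDiffOn_slice {n : WithTop ℕ∞} (h : ∀ x ∈ cyl d r, ContDiffAt ℝ n G x) {t : ℝ}
    (ht : t ∈ Ioo 0 r) : ContDiffOn ℝ n (fun z => G (z, t)) (tanBall d r) := fun z hz =>
  ((h (z, t) (mk_mem_cyl.2 ⟨hz, ht⟩)).comp z
    (contDiffAt_id.prodMk contDiffAt_const)).contDiffWithinAt

lemma hasDerivAt_dt (h : ∀ x ∈ cyl d r, ContDiffAt ℝ 1 f x) {x : Tan d × ℝ} (hx : x ∈ cyl d r) :
    HasDerivAt (fun s => f (x.1, s)) (fderiv ℝ f x (0, 1)) x.2 := by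
  have h1 := ((h x hx).differentiableAt (by simp)).hasFDerivAt
  exact h1.comp_hasDerivAt_of_eq x.2 ((hasDerivAt_const x.2 x.1).prodMk (hasDerivAt_id x.2)) rfl

lemma hasFDerivAt_dTan (h : ∀ x ∈ cyl d r, ContDiffAt ℝ 1 f x) {x : Tan d × ℝ}
    (hx : x ∈ cyl d r) : HasFDerivAt (fun z => f (z, x.2))
      ((fderiv ℝ f x).comp (ContinuousLinearMap.inl ℝ (Tan d) ℝ)) x.1 := by
  have h1 := ((h x hx).differentiableAt (by simp)).hasFDerivAt
  exact HasFDerivAt.comp (f := fun z => (z, x.2)) x.1 h1 (hasFDerivAt_prodMk_left x.1 x.2)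

lemma dt_eq (h : ∀ x ∈ cyl d r, ContDiffAt ℝ 1 f x) :
    EqOn (dt f) (fun x => fderiv ℝ f x (0, 1)) (cyl d r) := fun _ hx => (hasDerivAt_dt h hx).deriv

lemma dTan_eq (h : ∀ x ∈ cyl d r, ContDiffAt ℝ 1 f x) (b : Fin d) :
    EqOn (dTan b f) (fun x => fderiv ℝ f x (EuclideanSpace.single b 1, 0)) (cyl d r) :=
  fun x hx => by
    rw [dTan, (hasFDerivAt_dTan h hx).fderiv]
    simp

lemma isGrad_dTan (h : ∀ x ∈ cyl d r, ContDiffAt ℝ 1 f x) :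
    IsGrad r f (fun b => dTan b f) := fun x hx => by
  have h1 := hasFDerivAt_dTan h hx
  have h2 : (∑ b, dTan b f x • (EuclideanSpace.proj b : Tan d →L[ℝ] ℝ)) =
      (fderiv ℝ f x).comp (ContinuousLinearMap.inl ℝ (Tan d) ℝ) := by
    rw [clm_eq_sum_proj ((fderiv ℝ f x).comp _)]
    refine Finset.sum_congr rfl fun b _ => ?_
    rw [dTan_eq h b hx]
    simp
  rwa [h2]

lemma contDiffAt_dt {n : ℕ} (h : ∀ x ∈ cyl d r, ContDiffAt ℝ (n + 1 : ℕ) f x) :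
    ∀ x ∈ cyl d r, ContDiffAt ℝ n (dt f) x := fun x hx => by
  have h1 : ContDiffAt ℝ n (fun x => fderiv ℝ f x (0, 1)) x :=
    ((h x hx).fderiv_right (m := n) (by push_cast; rfl)).clm_apply contDiffAt_const
  refine h1.congr_of_eventuallyEq ?_
  filter_upwards [isOpen_cyl.mem_nhds hx] with x hx
  exact dt_eq (fun x hx => (h x hx).of_le (by push_cast; simp)) hx

lemma contDiffAt_dTan {n : ℕ} (h : ∀ x ∈ cyl d r, ContDiffAt ℝ (n + 1 : ℕ) f x) (b : Fin d) :
    ∀ x ∈ cyl d r, ContDiffAt ℝ n (dTan b f) x := fun x hx => by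
  have h1 : ContDiffAt ℝ n (fun x => fderiv ℝ f x (EuclideanSpace.single b 1, 0)) x :=
    ((h x hx).fderiv_right (m := n) (by push_cast; rfl)).clm_apply contDiffAt_const
  refine h1.congr_of_eventuallyEq ?_
  filter_upwards [isOpen_cyl.mem_nhds hx] with x hx
  exact dTan_eq (fun x hx => (h x hx).of_le (by push_cast; simp)) b hx

lemma Reg.gradW {S : Set ℝ} {e : Bool} {γ : ℝ} {m : ℕ} {k : Fin d → Tan d × ℝ → ℝ}
    (h : Reg r (W r S e γ) m (s + 1) f) (hk : IsGrad r f k) (b : Fin d) :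
    Reg r (W r S e γ) m s (k b) := by
  obtain ⟨l, hl, hl'⟩ := h.grad
  exact (hl' b).congrW (hk.unique hl b)

lemma Reg.time_mulW {S : Set ℝ} {e : Bool} {γ : ℝ} {m : ℕ} (hr : 0 < r) (hS : S ⊆ Ioc 0 1)
    (hf : Reg r (W r S e γ) m s f) : Reg r (W r S e (1 + γ)) m s (fun x => x.2 * f x) := by
  have h1 : Reg r (W r S false (1 : ℕ)) m s (fun x : Tan d × ℝ => x.2 ^ 1) := Reg.powW hr hS 1
  simpa using h1.mulW hf

end

/-- The hypotheses on the equation and on its solution. The characteristic exponents of the equation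
are `a` and `b`. -/
structure Setting (d : ℕ) (a : ℤ) (b ℓ : ℕ) (α : ℝ≥0) (r R : ℝ) (F : Tan d × ℝ × Jet d → ℝ)
    (v : Tan d × ℝ → ℝ) : Prop where
  ha : a ≤ 0
  hb : 2 ≤ b
  hℓ : b ≤ ℓ
  hα : 0 < α
  hα1 : α < 1
  hr : 0 < r
  hR : r < R
  hF : IsLocCHolder (ℓ - 2) α F (argSet d R)
  hF2 : b = 2 → IsSmoothExceptTan (ℓ - 2) α F R
  hv : IsLocCHolder ℓ α v (cyl d R)
  sol : IsSolution (1 - ((a : ℝ) + b)) (a * b) F R v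
  tan : TangentialRegularity ℓ α r v

/-- The rescaled solution `u = v / t²`. -/
noncomputable def resc (v : Tan d × ℝ → ℝ) (x : Tan d × ℝ) : ℝ := v x / x.2 ^ 2

/-- The function `t ∂_t u + 2 u = v_t / t`, where `u = v / t²`. -/
noncomputable def rescT (v : Tan d × ℝ → ℝ) (x : Tan d × ℝ) : ℝ := dt v x / x.2

namespace Setting

variable {a : ℤ} {b ℓ : ℕ} {α : ℝ≥0} {R : ℝ} {F : Tan d × ℝ × Jet d → ℝ} {v : Tan d × ℝ → ℝ}

lemma coe_pos (H : Setting d a b ℓ α r R F v) : (0 : ℝ) < α := H.hα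

lemma coe_lt (H : Setting d a b ℓ α r R F v) : (α : ℝ) < 1 := H.hα1

lemma cyl_subset (H : Setting d a b ℓ α r R F v) : cyl d r ⊆ cyl d R :=
  prod_mono (ball_subset_ball H.hR.le) (Ioo_subset_Ioo_right H.hR.le)

lemma contDiffAt (H : Setting d a b ℓ α r R F v) :
    ∀ x ∈ cyl d r, ContDiffAt ℝ ℓ v x := fun _ hx =>
  H.hv.1.contDiffAt (isOpen_cyl.mem_nhds (H.cyl_subset hx))

lemma contDiffAt_one (H : Setting d a b ℓ α r R F v) :
    ∀ x ∈ cyl d r, ContDiffAt ℝ 1 v x := fun x hx =>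
  (H.contDiffAt x hx).of_le (by exact_mod_cast (show 1 ≤ ℓ by have := H.hb; have := H.hℓ; omega))

lemma exists_eq (H : Setting d a b ℓ α r R F v) : ∃ n, ℓ = n + 2 :=
  ⟨ℓ - 2, by have := H.hb; have := H.hℓ; omega⟩

lemma contDiffAt_dt' (H : Setting d a b ℓ α r R F v) :
    ∀ x ∈ cyl d r, ContDiffAt ℝ (ℓ - 1 : ℕ) (dt v) x := by
  obtain ⟨n, rfl⟩ := H.exists_eq
  exact contDiffAt_dt (n := n + 1) H.contDiffAt

lemma contDiffAt_dt_one (H : Setting d a b ℓ α r R F v) :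
    ∀ x ∈ cyl d r, ContDiffAt ℝ 1 (dt v) x := fun x hx => (H.contDiffAt_dt' x hx).of_le (by
  obtain ⟨n, rfl⟩ := H.exists_eq
  simp)

lemma contDiffAt_dTan_one (H : Setting d a b ℓ α r R F v) (i : Fin d) :
    ∀ x ∈ cyl d r, ContDiffAt ℝ 1 (dTan i v) x := fun x hx => by
  obtain ⟨n, rfl⟩ := H.exists_eq
  exact (contDiffAt_dTan (n := n + 1) H.contDiffAt i x hx).of_le (by simp)

section Holder

variable (H : Setting d a b ℓ α r R F v)
include H

lemma reg_fderiv {f : Tan d × ℝ → ℝ} (w : Tan d × ℝ)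
    (hf : EqOn f (fun x => fderiv ℝ v x w) (cyl d r)) :
    Reg r (fun f => IsHolder α f (cyl d r)) 0 (ℓ - 1) f := by
  obtain ⟨n, rfl⟩ := H.exists_eq
  refine reg_clm_of_isHolder (G := fderiv ℝ v) (ContinuousLinearMap.apply ℝ ℝ w)
    (fun t ht => contDiffOn_slice (n := (n + 1 : ℕ)) (fun x hx => ?_) ht)
    (fun τ hτ => (H.tan τ (by omega)).2.1) hf
  exact (H.contDiffAt x hx).fderiv_right (by push_cast; rw [add_assoc]; norm_num)

lemma reg_dt : Reg r (fun f => IsHolder α f (cyl d r)) 0 (ℓ - 1) (dt v) :=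
  H.reg_fderiv (0, 1) (dt_eq H.contDiffAt_one)

lemma reg_dTan (i : Fin d) : Reg r (fun f => IsHolder α f (cyl d r)) 0 (ℓ - 1) (dTan i v) :=
  H.reg_fderiv _ (dTan_eq H.contDiffAt_one i)

lemma slice_v {t : ℝ} (ht : t ∈ Ioo 0 r) :
    ContDiffOn ℝ (ℓ - 1 : ℕ) (fun z => v (z, t)) (tanBall d r) :=
  (contDiffOn_slice H.contDiffAt ht).of_le (by exact_mod_cast Nat.sub_le ℓ 1)

lemma slice_dt {t : ℝ} (ht : t ∈ Ioo 0 r) :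
    ContDiffOn ℝ (ℓ - 1 : ℕ) (fun z => dt v (z, t)) (tanBall d r) :=
  contDiffOn_slice H.contDiffAt_dt' ht

lemma lt_of_le {τ : ℕ} (hτ : τ ≤ ℓ - 1) : τ < ℓ := by
  have := H.hb; have := H.hℓ; omega

lemma reg_div : Reg r (fun f => IsHolder α f (cyl d r)) 0 (ℓ - 1) (fun x => v x / x.2) :=
  reg_smul_of_isHolder (fun t => t⁻¹) (fun _ => H.slice_v)
    (fun τ hτ => (H.tan τ (H.lt_of_le hτ)).1) fun x _ => by simp only; ring

lemma reg_sq : Reg r (fun f => IsHolder α f (cyl d r)) 0 (ℓ - 1)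
    (fun x => v x ^ 2 / x.2 ^ 3) :=
  reg_smul_of_isHolder (fun t => (t ^ 3)⁻¹) (fun _ ht => (H.slice_v ht).pow 2)
    (fun τ hτ => (H.tan τ (H.lt_of_le hτ)).2.2.1) fun x _ => by simp only; ring

lemma reg_mul_dt : Reg r (fun f => IsHolder α f (cyl d r)) 0 (ℓ - 1)
    (fun x => v x * dt v x / x.2 ^ 2) :=
  reg_smul_of_isHolder (fun t => (t ^ 2)⁻¹) (fun _ ht => (H.slice_v ht).mul (H.slice_dt ht))
    (fun τ hτ => (H.tan τ (H.lt_of_le hτ)).2.2.2.1) fun x _ => by simp only; ring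

lemma reg_dt_sq : Reg r (fun f => IsHolder α f (cyl d r)) 0 (ℓ - 1)
    (fun x => dt v x ^ 2 / x.2) :=
  reg_smul_of_isHolder (fun t => t⁻¹) (fun _ ht => (H.slice_dt ht).pow 2)
    (fun τ hτ => (H.tan τ (H.lt_of_le hτ)).2.2.2.2) fun x _ => by simp only; ring

omit H in
lemma exists_bound {f : Tan d × ℝ → ℝ} (hα : 0 < α) (h : IsHolder α f (cyl d r)) :
    ∃ C, 0 ≤ C ∧ ∀ x ∈ cyl d r, |f x| ≤ C := by
  obtain ⟨C, h0, hC⟩ := (W.of_isHolder_zero hα h).bd 0 (mem_loss_false.2 rfl)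
  exact ⟨C, h0, fun x hx => by simpa using hC x hx⟩

/-- The bounds on `v² / t³` and `v_t² / t` force `v / t`, `v_t` to vanish on the boundary. -/
lemma abs_div_le : ∃ C, 0 ≤ C ∧ ∀ x ∈ cyl d r,
    |v x / x.2| ≤ C * x.2 ^ (1 / 2 : ℝ) ∧ |dt v x| ≤ C * x.2 ^ (1 / 2 : ℝ) := by
  obtain ⟨C, h0, hC⟩ := exists_bound H.hα H.reg_sq.base
  obtain ⟨C', h0', hC'⟩ := exists_bound H.hα H.reg_dt_sq.base
  refine ⟨√C + √C', by positivity, fun x hx => ?_⟩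
  have hx0 := (mem_cyl.1 hx).2.1
  rw [← Real.sqrt_eq_rpow, add_mul, ← Real.sqrt_mul h0, ← Real.sqrt_mul h0']
  constructor
  · refine le_add_of_le_of_nonneg (Real.abs_le_sqrt ?_) (by positivity)
    have h1 := (le_abs_self _).trans (hC x hx)
    rw [div_le_iff₀ (by positivity)] at h1
    rw [div_pow, div_le_iff₀ (by positivity)]
    calc v x ^ 2 ≤ C * x.2 ^ 3 := h1
      _ = _ := by ring
  · refine le_add_of_nonneg_of_le (by positivity) (Real.abs_le_sqrt ?_)
    have h1 := (le_abs_self _).trans (hC' x hx)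
    rwa [div_le_iff₀ hx0] at h1

lemma tendsto_div {y : Tan d} (hy : y ∈ tanBall d r) :
    Tendsto (fun t => v (y, t) / t) (𝓝[Ioo 0 r] 0) (𝓝 0) := by
  obtain ⟨C, h0, hC⟩ := H.abs_div_le
  exact tendsto_zero_of_le (a := 1 / 2) (by norm_num)
    fun t ht => (hC (y, t) (mk_mem_cyl.2 ⟨hy, ht⟩)).1

lemma tendsto_dt {y : Tan d} (hy : y ∈ tanBall d r) :
    Tendsto (fun t => dt v (y, t)) (𝓝[Ioo 0 r] 0) (𝓝 0) := by
  obtain ⟨C, h0, hC⟩ := H.abs_div_le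
  exact tendsto_zero_of_le (a := 1 / 2) (by norm_num)
    fun t ht => (hC (y, t) (mk_mem_cyl.2 ⟨hy, ht⟩)).2

lemma tendsto_v {y : Tan d} (hy : y ∈ tanBall d r) :
    Tendsto (fun t => v (y, t)) (𝓝[Ioo 0 r] 0) (𝓝 0) := by
  have h1 : Tendsto (fun t : ℝ => t) (𝓝[Ioo 0 r] 0) (𝓝 0) := nhdsWithin_le_nhds
  have h2 := h1.mul (H.tendsto_div hy)
  rw [zero_mul] at h2
  refine h2.congr' ?_
  filter_upwards [self_mem_nhdsWithin] with t ht
  have := ht.1.ne'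
  field_simp

lemma regW_div : Reg r (W r (Ioc 0 (α : ℝ)) false α) 0 (ℓ - 1) (fun x => v x / x.2) :=
  H.reg_div.of_isHolder H.hα fun _ => H.tendsto_div

lemma regW_dt : Reg r (W r (Ioc 0 (α : ℝ)) false α) 0 (ℓ - 1) (dt v) :=
  H.reg_dt.of_isHolder H.hα fun _ => H.tendsto_dt

lemma regW_dTan (i : Fin d) : Reg r (W r (Ioc 0 (α : ℝ)) false α) 0 (ℓ - 1) (dTan i v) :=
  (H.reg_dTan i).of_isHolder H.hα fun _ =>
    (isGrad_dTan H.contDiffAt_one).tendsto_zero H.hα (H.reg_dTan i).base fun _ => H.tendsto_v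

lemma succ_eq : ℓ - 1 = ℓ - 2 + 1 := by have := H.hb; have := H.hℓ; omega

lemma regW_dTan_dt (i : Fin d) :
    Reg r (W r (Ioc 0 (α : ℝ)) false α) 0 (ℓ - 2) (dTan i (dt v)) := by
  have h := H.regW_dt
  rw [H.succ_eq] at h
  exact h.gradW (isGrad_dTan H.contDiffAt_dt_one) i

lemma regW_dTan_dTan (i j : Fin d) :
    Reg r (W r (Ioc 0 (α : ℝ)) false α) 0 (ℓ - 2) (dTan i (dTan j v)) := by
  have h := H.regW_dTan j
  rw [H.succ_eq] at h
  exact h.gradW (isGrad_dTan (H.contDiffAt_dTan_one j)) i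

lemma isGrad_div : IsGrad r (fun x => v x / x.2) (fun i x => dTan i v x / x.2) :=
  ((IsGrad.time fun t => t⁻¹).mul (isGrad_dTan H.contDiffAt_one)).congr
    (fun x _ => by simp only; ring) fun i x _ => by simp only; ring

lemma regW_dTan_div (i : Fin d) :
    Reg r (W r (Ioc 0 (α : ℝ)) false α) 0 (ℓ - 2) (fun x => dTan i v x / x.2) := by
  have h := H.regW_div
  rw [H.succ_eq] at h
  exact h.gradW H.isGrad_div i

/-- One derivative in `t` and `ℓ - 1` tangential ones may be applied to `v / t`. -/
lemma regW_div_one : Reg r (W r (Ioc 0 (α : ℝ)) false α) 1 (ℓ - 1) (fun x => v x / x.2) := by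
  refine Reg.of_isTheta H.hr (Ioc_sub H.coe_lt) H.regW_div
    (H.regW_dt.addW (H.regW_div.const_mulW (-1))) fun x hx => ?_
  have h0 := (mem_cyl.1 hx).2.1.ne'
  have h1 := hasDerivAt_dt H.contDiffAt_one hx
  have h2 : dt v x = fderiv ℝ v x (0, 1) := dt_eq H.contDiffAt_one hx
  rw [← h2] at h1
  refine (h1.div (hasDerivAt_id x.2) h0).congr_deriv ?_
  simp only [id]
  field_simp
  ring

lemma regW_v : Reg r (W r (Ioc 0 (α : ℝ)) false (1 + α)) 1 (ℓ - 1) v :=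
  (H.regW_div_one.time_mulW H.hr (Ioc_sub H.coe_lt)).congrW fun x hx => by
    have := (mem_cyl.1 hx).2.1.ne'
    field_simp

end Holder

end Setting

/-! ### The equation for the rescaled solution, and decay of the arguments of the nonlinearity -/

/-- The standard basis of the space of the arguments of `F` other than `y'`. -/
noncomputable def jetBasis (d : ℕ) :
    Module.Basis (Unit ⊕ Fin 5 ⊕ Fin d ⊕ ((_ : Fin d) × Fin d) ⊕ Fin d) ℝ (ℝ × Jet d) :=
  (Module.Basis.singleton Unit ℝ).prod ((Pi.basisFun ℝ (Fin 5)).prod ((Pi.basisFun ℝ (Fin d)).prod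
    ((Pi.basis fun _ : Fin d => Pi.basisFun ℝ (Fin d)).prod (Pi.basisFun ℝ (Fin d)))))

/-- The arguments of `F` other than `y'`. -/
noncomputable def arg (v : Tan d × ℝ → ℝ) (x : Tan d × ℝ) : ℝ × Jet d := (x.2, jet v x)

lemma forall_coord {v : Tan d × ℝ → ℝ} (P : (Tan d × ℝ → ℝ) → Prop) (h0 : P fun x => x.2)
    (h1 : P (dt v)) (h2 : P fun x => v x / x.2) (h3 : P fun x => v x ^ 2 / x.2 ^ 3)
    (h4 : P fun x => v x * dt v x / x.2 ^ 2) (h5 : P fun x => dt v x ^ 2 / x.2)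
    (h6 : ∀ i, P (dTan i (dt v))) (h7 : ∀ i j, P (dTan i (dTan j v)))
    (h8 : ∀ i, P fun x => dTan i v x / x.2) (i) :
    P (fun x => (jetBasis d).repr (arg v x) i) := by
  rcases i with _ | i | i | ⟨i, j⟩ | i
  · simpa [jetBasis, arg, jet] using h0
  · fin_cases i
    · simpa [jetBasis, arg, jet] using h1
    · simpa [jetBasis, arg, jet] using h2
    · simpa [jetBasis, arg, jet] using h3
    · simpa [jetBasis, arg, jet] using h4
    · simpa [jetBasis, arg, jet] using h5
  · simpa [jetBasis, arg, jet] using h6 i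
  · simpa [jetBasis, arg, jet, Pi.basis_repr] using h7 i j
  · simpa [jetBasis, arg, jet] using h8 i

lemma continuousOn_of_coord {Z : Type*} [NormedAddCommGroup Z] [NormedSpace ℝ Z] {ι : Type*}
    [Fintype ι] (b : Module.Basis ι ℝ Z) {z : Tan d × ℝ → Z} {S : Set ℝ} {e : Bool} {γ : ℝ}
    (hz : ∀ i, W r S e γ (fun x => b.repr (z x) i)) {y : Tan d} (hy : y ∈ tanBall d r) :
    ContinuousOn (fun t => z (y, t)) (Ioo 0 r) := by
  have h1 : ContinuousOn (fun t => ∑ i, b.repr (z (y, t)) i • b i) (Ioo 0 r) :=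
    continuousOn_finsetSum _ fun i _ => ((hz i).cont y hy).smul continuousOn_const
  exact h1.congr fun t _ => (b.sum_repr (z (y, t))).symm

namespace Setting

variable {a : ℤ} {b ℓ : ℕ} {α : ℝ≥0} {R : ℝ} {F : Tan d × ℝ × Jet d → ℝ} {v : Tan d × ℝ → ℝ}
  (H : Setting d a b ℓ α r R F v)
include H

omit H in
lemma uniqueDiffOn_time : UniqueDiffOn ℝ (Ico 0 R ×ˢ (univ : Set (Jet d))) :=
  (uniqueDiffOn_Ico 0 R).prod uniqueDiffOn_univ

omit H in
lemma uniqueDiffOn_argSet : UniqueDiffOn ℝ (argSet d R) :=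
  isOpen_tanBall.uniqueDiffOn.prod uniqueDiffOn_time

omit H in
lemma convex_time : Convex ℝ (Ico 0 R ×ˢ (univ : Set (Jet d))) := (convex_Ico 0 R).prod convex_univ

lemma arg_mem {x : Tan d × ℝ} (hx : x ∈ cyl d r) : arg v x ∈ Ico 0 R ×ˢ (univ : Set (Jet d)) :=
  ⟨⟨(mem_cyl.1 hx).2.1.le, (mem_cyl.1 hx).2.2.trans H.hR⟩, mem_univ _⟩

lemma zero_mem : (0 : ℝ × Jet d) ∈ Ico 0 R ×ˢ (univ : Set (Jet d)) :=
  ⟨⟨le_rfl, H.hr.trans H.hR⟩, mem_univ _⟩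

lemma of_isHolder_bounded {f : Tan d × ℝ → ℝ} {s : ℕ}
    (h : Reg r (fun f => IsHolder α f (cyl d r)) 0 s f) : Reg r (W r ∅ false 0) 0 s f :=
  h.imp fun _ hf => (W.of_isHolder_zero H.hα hf).weaken (empty_subset _) (dom_of_le le_rfl)

lemma regW_bounded {f : Tan d × ℝ → ℝ} {s : ℕ}
    (h : Reg r (W r (Ioc 0 (α : ℝ)) false α) 0 s f) : Reg r (W r ∅ false 0) 0 s f :=
  h.weakenW (empty_subset _) (dom_of_le H.coe_pos.le)

/-- All arguments of `F` are bounded, together with `ℓ - 2` tangential derivatives. -/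
lemma coord_bounded (i) :
    Reg r (W r ∅ false 0) 0 (ℓ - 2) (fun x => (jetBasis d).repr (arg v x) i) := by
  have hs : ℓ - 2 ≤ ℓ - 1 := by omega
  refine forall_coord (fun f => Reg r (W r ∅ false 0) 0 (ℓ - 2) f) ?_
    (H.of_isHolder_bounded (H.reg_dt.mono le_rfl hs))
    (H.of_isHolder_bounded (H.reg_div.mono le_rfl hs))
    (H.of_isHolder_bounded (H.reg_sq.mono le_rfl hs))
    (H.of_isHolder_bounded (H.reg_mul_dt.mono le_rfl hs))
    (H.of_isHolder_bounded (H.reg_dt_sq.mono le_rfl hs))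
    (fun i => H.regW_bounded (H.regW_dTan_dt i)) (fun i j => H.regW_bounded (H.regW_dTan_dTan i j))
    (fun i => H.regW_bounded (H.regW_dTan_div i)) i
  have h1 : Reg r (W r ∅ false (1 : ℕ)) 0 (ℓ - 2) (fun x : Tan d × ℝ => x.2 ^ 1) :=
    Reg.powW H.hr (empty_subset _) 1
  simpa using h1.weakenW Subset.rfl (e' := false) (γ' := 0) (dom_of_le (by simp))

/-- A compact convex set that contains the arguments of `F`. -/
lemma exists_compact : ∃ K : Set (ℝ × Jet d), IsCompact K ∧ Convex ℝ K ∧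
    K ⊆ Ico 0 R ×ˢ univ ∧ (0 : ℝ × Jet d) ∈ K ∧ ∀ x ∈ cyl d r, arg v x ∈ K := by
  obtain ⟨C, h0, hC⟩ := norm_le_of_coord (jetBasis d) fun i => (H.coord_bounded i).base
  refine ⟨Icc 0 r ×ˢ closedBall 0 C, isCompact_Icc.prod (isCompact_closedBall 0 C),
    (convex_Icc 0 r).prod (convex_closedBall 0 C),
    prod_mono (fun t ht => ⟨ht.1, ht.2.trans_lt H.hR⟩) (subset_univ _),
    ⟨⟨le_rfl, H.hr.le⟩, mem_closedBall_self h0⟩,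
    fun x hx => ⟨⟨(mem_cyl.1 hx).2.1.le, (mem_cyl.1 hx).2.2.le⟩, ?_⟩⟩
  rw [mem_closedBall_zero_iff]
  have := hC x hx
  rw [Real.rpow_zero, mul_one] at this
  exact (norm_snd_le (arg v x)).trans this

lemma closedBall_subset : closedBall (0 : Tan d) r ⊆ tanBall d R :=
  closedBall_subset_ball H.hR

lemma comp_cont {n : ℕ} {G : Tan d × ℝ × Jet d → ℝ} (hG : IsLocCHolder n α G (argSet d R)) :
    W r ∅ false 0 (fun x => G (x.1, arg v x)) := by
  obtain ⟨K, hK, -, hKs, -, hKm⟩ := H.exists_compact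
  refine ⟨fun y hy => ?_, fun η hη => ?_, fun ε hε => absurd hε (notMem_empty ε)⟩
  · refine hG.1.continuousOn.comp (continuousOn_const.prodMk (continuousOn_of_coord (jetBasis d)
      (fun i => (H.coord_bounded i).base) hy)) fun t ht => ?_
    exact ⟨ball_subset_ball H.hR.le hy, H.arg_mem (mk_mem_cyl.2 ⟨hy, ht⟩)⟩
  · obtain ⟨C, hC⟩ := ((isCompact_closedBall (0 : Tan d) r).prod hK).exists_bound_of_continuousOn
      (hG.1.continuousOn.mono (prod_mono H.closedBall_subset hKs))
    rw [mem_loss_false.1 hη]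
    refine ⟨|C|, abs_nonneg _, fun x hx => ?_⟩
    rw [sub_zero, Real.rpow_zero, mul_one]
    exact (hC (x.1, arg v x) ⟨ball_subset_closedBall (mem_cyl.1 hx).1, hKm x hx⟩).trans
      (le_abs_self C)

/-- `F` at the solution is bounded, together with `ℓ - 2` tangential derivatives. -/
lemma rhs_bounded : Reg r (W r ∅ false 0) 0 (ℓ - 2) (fun x => F (x.1, arg v x)) :=
  comp_bounded (jetBasis d) H.hR.le (fun _ => H.arg_mem) H.coord_bounded
    (H.hF.toCY uniqueDiffOn_time (fun _ _ hG => H.comp_cont hG) le_rfl)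

lemma isTheta_resc : IsTheta r (resc v) (fun x => rescT v x + -2 * resc v x) := fun x hx => by
  have h0 := (mem_cyl.1 hx).2.1.ne'
  have h1 := (hasDerivAt_dt H.contDiffAt_one hx)
  have h2 : dt v x = fderiv ℝ v x (0, 1) := dt_eq H.contDiffAt_one hx
  rw [← h2] at h1
  refine (h1.div (hasDerivAt_pow 2 x.2) (pow_ne_zero 2 h0)).congr_deriv ?_
  simp only [resc, rescT]
  field_simp
  ring

/-- The second order equation for `u` splits into two first order ones; this is the one for
`u₁ = t ∂_t u + (2 - b) u`. -/
lemma isTheta_first : IsTheta r (fun x => rescT v x + -b * resc v x)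
    (fun x => -1 * F (x.1, arg v x) + -(2 - a : ℝ) * (rescT v x + -b * resc v x)) := fun x hx => by
  have h0 := (mem_cyl.1 hx).2.1.ne'
  have h1 := (hasDerivAt_dt H.contDiffAt_dt_one hx)
  have h2 : dt (dt v) x = fderiv ℝ (dt v) x (0, 1) := dt_eq H.contDiffAt_dt_one hx
  rw [← h2] at h1
  have h3 := (h1.div (hasDerivAt_id x.2) h0).add ((H.isTheta_resc x hx).const_mul (-b : ℝ))
  refine h3.congr_deriv ?_
  have h4 : dt (dt v) x + (1 - ((a : ℝ) + b)) * (dt v x / x.2) + a * b * (v x / x.2 ^ 2) +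
    F (x.1, arg v x) = 0 := H.sol x (H.cyl_subset hx)
  have h5 : F (x.1, arg v x) = -(dt (dt v) x + (1 - ((a : ℝ) + b)) * (dt v x / x.2) +
    a * b * (v x / x.2 ^ 2)) := by linarith
  simp only [resc, rescT, id, h5]
  field_simp
  ring

lemma isTheta_second : IsTheta r (resc v)
    (fun x => (rescT v x + -b * resc v x) + (b - 2 : ℕ) * resc v x) :=
  H.isTheta_resc.congr (eqOn_refl _ _) fun x _ => by
    rw [Nat.cast_sub H.hb]; push_cast; ring

lemma tendsto_first {y : Tan d} (hy : y ∈ tanBall d r) :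
    Tendsto (fun t => t ^ (2 - a : ℝ) * (rescT v (y, t) + -b * resc v (y, t)))
      (𝓝[Ioo 0 r] 0) (𝓝 0) := by
  have h1 : Tendsto (fun t => t ^ (1 - a : ℝ)) (𝓝[Ioo 0 r] 0) (𝓝 0) := by
    refine tendsto_rpow_time ?_
    have : (a : ℝ) ≤ 0 := by exact_mod_cast H.ha
    linarith
  have h2 := h1.mul ((H.tendsto_dt hy).add ((H.tendsto_div hy).const_mul (-b : ℝ)))
  simp only [mul_zero, add_zero] at h2
  refine h2.congr' ?_
  filter_upwards [self_mem_nhdsWithin] with t ht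
  have ht0 := ht.1.ne'
  have h3 : t ^ (2 - a : ℝ) = t ^ (1 - a : ℝ) * t := by
    rw [← Real.rpow_add_one ht0]; ring_nf
  rw [h3]
  simp only [resc, rescT]
  field_simp

lemma two_sub_pos : (0 : ℝ) < 2 - a := by
  have : (a : ℝ) ≤ 0 := by exact_mod_cast H.ha
  linarith

lemma resc_slice {S : Set ℝ} (hS : S ⊆ Ioc 0 (α : ℝ)) :
    RegC r S (ℓ - 1) (fun y => resc v (y, r / 2)) := by
  have h1 := ((H.regW_v.mono (Nat.zero_le 1) le_rfl).slice (Ioc_sub H.coe_lt)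
    (half_mem H.hr)).weaken hS le_rfl
  exact (h1.const_mul (((r / 2) ^ 2)⁻¹)).congr fun y _ => by simp only [resc]; ring

/-- Bounds for `u₁` and `u` of the size of those for the nonlinear term, up to an arbitrarily small
loss in the presence of a resonance. -/
lemma resc_bounded {γ : ℝ} {s : ℕ} (hs : s ≤ ℓ - 2) (hγ : -1 ≤ γ) (hγ0 : γ ≤ 0)
    (hγb : γ < (b - 2 : ℕ)) :
    Reg r (W r ∅ false γ) 1 s (fun x => rescT v x + -b * resc v x) ∧
      Reg r (W r ∅ false γ) 2 s (resc v) := by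
  have h1 : Reg r (W r ∅ false γ) 1 s (fun x => rescT v x + -b * resc v x) :=
    Reg.solve_pos H.hr (empty_subset _) (by
        have h2 : (a : ℝ) ≤ 0 := by exact_mod_cast H.ha
        linarith)
      (fun ε hε => absurd hε (notMem_empty ε))
      ((((H.rhs_bounded.mono le_rfl hs)).const_mulW (-1)).weakenW Subset.rfl (dom_of_le hγ0))
      H.isTheta_first fun _ => H.tendsto_first
  exact ⟨h1, Reg.solve_neg H.hr (empty_subset _) hγb h1 H.isTheta_second
    ((H.resc_slice (empty_subset _)).weaken Subset.rfl (by omega))⟩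

omit H in
lemma eq_resc {x : Tan d × ℝ} (hx : x ∈ cyl d r) :
    dt v x = x.2 * rescT v x ∧ v x / x.2 = x.2 * resc v x ∧
    v x ^ 2 / x.2 ^ 3 = x.2 * (resc v x * resc v x) ∧
    v x * dt v x / x.2 ^ 2 = x.2 * (resc v x * rescT v x) ∧
    dt v x ^ 2 / x.2 = x.2 * (rescT v x * rescT v x) := by
  have h0 := (mem_cyl.1 hx).2.1.ne'
  simp only [resc, rescT]
  refine ⟨?_, ?_, ?_, ?_, ?_⟩ <;> field_simp

lemma resc_quarter : W r ∅ false (-1 / 4) (resc v) ∧ W r ∅ false (-1 / 4) (rescT v) := by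
  obtain ⟨h1, h2⟩ := H.resc_bounded (γ := -1 / 4) (s := 0) (Nat.zero_le _) (by norm_num)
    (by norm_num) (lt_of_lt_of_le (by norm_num) (Nat.cast_nonneg _))
  exact ⟨h2.base, (h1.base.add (h2.base.const_mul b)).congr fun x _ => by ring⟩

omit H in
lemma tendsto_of_eq {f g : Tan d × ℝ → ℝ} (hf : W r ∅ false (-1 / 4 + -1 / 4) f)
    (hg : ∀ x ∈ cyl d r, g x = x.2 * f x) {y : Tan d} (hy : y ∈ tanBall d r) :
    Tendsto (fun t => g (y, t)) (𝓝[Ioo 0 r] 0) (𝓝 0) := by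
  refine (hf.tendsto (μ := 1) (by norm_num) hy).congr' ?_
  filter_upwards [self_mem_nhdsWithin] with t ht
  rw [hg (y, t) (mk_mem_cyl.2 ⟨hy, ht⟩), Real.rpow_one]

lemma regW_sq : Reg r (W r (Ioc 0 (α : ℝ)) false α) 0 (ℓ - 1) (fun x => v x ^ 2 / x.2 ^ 3) :=
  H.reg_sq.of_isHolder H.hα fun _ hy => tendsto_of_eq
    (H.resc_quarter.1.mul H.resc_quarter.1)
    (fun _ hx => (eq_resc hx).2.2.1) hy

lemma regW_mul_dt : Reg r (W r (Ioc 0 (α : ℝ)) false α) 0 (ℓ - 1)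
    (fun x => v x * dt v x / x.2 ^ 2) :=
  H.reg_mul_dt.of_isHolder H.hα fun _ hy => tendsto_of_eq
    (H.resc_quarter.1.mul H.resc_quarter.2)
    (fun _ hx => (eq_resc hx).2.2.2.1) hy

lemma regW_dt_sq : Reg r (W r (Ioc 0 (α : ℝ)) false α) 0 (ℓ - 1) (fun x => dt v x ^ 2 / x.2) :=
  H.reg_dt_sq.of_isHolder H.hα fun _ hy => tendsto_of_eq
    (H.resc_quarter.2.mul H.resc_quarter.2)
    (fun _ hx => (eq_resc hx).2.2.2.2) hy

/-- All arguments of `F` are `O(t^α)`, with the corresponding Hölder bounds. -/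
lemma coord_regW (i) :
    Reg r (W r (Ioc 0 (α : ℝ)) false α) 0 (ℓ - 2) (fun x => (jetBasis d).repr (arg v x) i) := by
  have hs : ℓ - 2 ≤ ℓ - 1 := by omega
  refine forall_coord (fun f => Reg r (W r (Ioc 0 (α : ℝ)) false α) 0 (ℓ - 2) f) ?_
    (H.regW_dt.mono le_rfl hs) (H.regW_div.mono le_rfl hs) (H.regW_sq.mono le_rfl hs)
    (H.regW_mul_dt.mono le_rfl hs) (H.regW_dt_sq.mono le_rfl hs) H.regW_dTan_dt H.regW_dTan_dTan
    H.regW_dTan_div i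
  have h1 : Reg r (W r (Ioc 0 (α : ℝ)) false (1 : ℕ)) 0 (ℓ - 2) (fun x : Tan d × ℝ => x.2 ^ 1) :=
    Reg.powW H.hr (Ioc_sub H.coe_lt) 1
  simpa using h1.weakenW Subset.rfl (e' := false) (γ' := α)
    (dom_of_le (by simpa using H.coe_lt.le))

/-! ### The nonlinearity at the solution -/

/-- If `b ≥ 3`, there is no resonance at order `0`, and the arguments of `F` are Lipschitz at
comparable heights. -/
lemma coord_lipschitz (hb : 3 ≤ b) (i) :
    W r {1} false 1 (fun x => (jetBasis d).repr (arg v x) i) := by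
  have hr := H.hr
  have hℓ := H.hℓ
  have hE : (∅ : Set ℝ) ⊆ Ioc 0 1 := empty_subset _
  obtain ⟨h1, h2⟩ := H.resc_bounded (γ := 0) (s := ℓ - 2) le_rfl (by norm_num) le_rfl
    (by exact_mod_cast (by omega : 0 < b - 2))
  have hT : Reg r (W r ∅ false 0) 1 (ℓ - 2) (rescT v) :=
    (h1.addW ((h2.mono one_le_two le_rfl).const_mulW b)).congrW fun x _ => by ring
  have hu := h2.mono (m' := 1) one_le_two le_rfl
  -- products with `t` of functions with one bounded derivative of each kind
  have key : ∀ {f g : Tan d × ℝ → ℝ}, Reg r (W r ∅ false 0) 1 (ℓ - 2) f →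
      (∀ x ∈ cyl d r, g x = x.2 * f x) → W r {1} false 1 g := by
    intro f g hf hg
    have h3 := (hf.time_mulW hr hE).congrW hg
    rw [add_zero, show ℓ - 2 = (ℓ - 3) + 1 by omega] at h3
    obtain ⟨g', hg', hg''⟩ := h3.theta
    obtain ⟨k, hk, hk'⟩ := h3.grad
    exact h3.base.lipschitz hg' hg''.base hk
      fun i => (hk' i).base.weaken Subset.rfl (dom_of_le (by norm_num))
  have mul : ∀ {f g : Tan d × ℝ → ℝ}, Reg r (W r ∅ false 0) 1 (ℓ - 2) f →
      Reg r (W r ∅ false 0) 1 (ℓ - 2) g → Reg r (W r ∅ false 0) 1 (ℓ - 2) fun x => f x * g x :=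
    fun hf hg => by simpa using hf.mulW hg
  -- functions with one derivative `t ∂_t` of size `t`, and bounded tangential ones
  have key' : ∀ {f : Tan d × ℝ → ℝ}, Reg r (W r ∅ false 1) 1 0 f →
      Reg r (W r (Ioc 0 (α : ℝ)) false α) 0 (ℓ - 2) f → W r {1} false 1 f := by
    intro f hf hf'
    obtain ⟨g', hg', hg''⟩ := hf.theta
    rw [show ℓ - 2 = (ℓ - 3) + 1 by omega] at hf'
    obtain ⟨k, hk, hk'⟩ := hf'.grad
    exact hf.base.lipschitz hg' hg''.base hk fun i => (hk' i).base.weaken (empty_subset _)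
      (dom_of_le (by linarith [H.coe_pos]))
  refine forall_coord (fun f => W r {1} false 1 f) ?_
    (key hT fun x hx => (eq_resc hx).1) (key hu fun x hx => (eq_resc hx).2.1)
    (key (mul hu hu) fun x hx => (eq_resc hx).2.2.1)
    (key (mul hu hT) fun x hx => (eq_resc hx).2.2.2.1)
    (key (mul hT hT) fun x hx => (eq_resc hx).2.2.2.2) (fun j => ?_) (fun i j => ?_)
    (fun j => ?_) i
  · have := W.mono_log (d := d) (S := {1}) hr (by simp) 1 0 false (Or.inr rfl)
    simpa using this
  · refine key' ?_ (H.regW_dTan_dt j)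
    have h3 := ((hT.time_mulW hr hE).congrW fun x hx => (eq_resc hx).1)
    rw [add_zero, show ℓ - 2 = (ℓ - 3) + 1 by omega] at h3
    exact (h3.gradW (isGrad_dTan H.contDiffAt_dt_one) j).mono le_rfl (Nat.zero_le _)
  · refine key' ?_ (H.regW_dTan_dTan i j)
    have h3 := H.regW_v
    rw [show ℓ - 1 = (ℓ - 3) + 1 + 1 by omega] at h3
    exact (((h3.gradW (isGrad_dTan H.contDiffAt_one) j).gradW
      (isGrad_dTan (H.contDiffAt_dTan_one j)) i).weakenW (empty_subset _)
        (dom_of_le (by linarith [H.coe_pos]))).mono le_rfl (Nat.zero_le _)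
  · refine key' ?_ (H.regW_dTan_div j)
    have h3 := ((hu.time_mulW hr hE).congrW fun x hx => (eq_resc hx).2.1)
    rw [add_zero, show ℓ - 2 = (ℓ - 3) + 1 by omega] at h3
    exact (h3.gradW H.isGrad_div j).mono le_rfl (Nat.zero_le _)

/-- The derivatives of the nonlinearity that are needed. If `b = 2`, there are arbitrarily many
ones along the arguments other than `y'`. -/
lemma cfz {m s : ℕ} (h : b = 2 ∨ m + s ≤ ℓ - 2) (hs : s ≤ ℓ - 2) :
    CFz R (Ico 0 R ×ˢ (univ : Set (Jet d))) (CompBase r α (arg v)) m s F := by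
  obtain ⟨K, hK, hKc, hKs, hK0, hKm⟩ := H.exists_compact
  have hY := ball_subset_closedBall (x := (0 : Tan d)) (ε := r)
  rcases eq_or_ne b 2 with hb | hb
  · have h1 : CFz R (Ico 0 R ×ˢ (univ : Set (Jet d))) (CompBase r α (arg v)) m (ℓ - 2) F := by
      refine toCFz_of_iteratedFDerivWithin (a := α) uniqueDiffOn_time convex_time
        (fun n G hG => ?_) (H.hF2 hb).1 (H.hF2 hb).2 m
      exact compBase_of_holderLip (jetBasis d) H.hα hY hK0 hKm (fun i => (H.coord_regW i).base)
        (hG.holderLip H.hα1.le uniqueDiffOn_time H.closedBall_subset hKs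
          (isCompact_closedBall 0 r) hK (convex_closedBall 0 r) hKc)
    exact h1.mono hs
  · have hb' : 3 ≤ b := by have := H.hb; omega
    refine H.hF.toCFz uniqueDiffOn_time (fun n G hG => ?_) (h.resolve_left hb)
    exact compBase_of_isHolder (jetBasis d) H.hα hY hK0 hKm (H.coord_lipschitz hb')
      (hG.isHolder H.hα1.le uniqueDiffOn_argSet (prod_mono H.closedBall_subset hKs)
        ((isCompact_closedBall 0 r).prod hK) ((convex_closedBall 0 r).prod hKc))

end Setting

/-! ### The expansion of the rescaled solution -/

section

variable {α : ℝ} {n n' : ℕ → ℕ} {X X' : ℕ → ℕ → Prop} {e : Bool} {m q s : ℕ} {γ : ℝ}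
  {f g ζ : Tan d × ℝ → ℝ} {k : Fin d → Tan d × ℝ → ℝ}

lemma HasExp.theta_of (hr : 0 < r) (hα1 : α < 1) (h : HasExp r α n X e m γ (q + 1) s f)
    (hX : ∀ i j, X i j → X i (j + 1)) (hg : IsTheta r f g) : HasExp r α n X e m γ q s g := by
  obtain ⟨g', hg', h'⟩ := h.theta hr hα1 hX
  exact h'.congr (hg.unique hg')

lemma HasExp.grad_of (hr : 0 < r) (hα1 : α < 1) (h : HasExp r α n X e m γ q (s + 1) f)
    (hk : IsGrad r f k) (a : Fin d) : HasExp r α n X e m γ q s (k a) := by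
  obtain ⟨k', hk', h'⟩ := h.grad hr hα1
  exact (h' a).congr (hk.unique hk' a)

/-- If `f = t ζ`, then `t ∂_t f = t h` with `h = ζ + t ∂_t ζ`. -/
lemma HasExp.exists_theta_eq_time_mul (hr : 0 < r) (hα1 : α < 1)
    (h : HasExp r α n X e m γ (q + 1) s ζ) (hX : ∀ i j, X i j → X i (j + 1))
    (hf : EqOn f (fun x => x.2 * ζ x) (cyl d r)) :
    ∃ h, IsTheta r f (fun x => x.2 * h x) ∧ HasExp r α n X e m γ q s h := by
  obtain ⟨g, hg, hg'⟩ := h.theta hr hα1 hX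
  refine ⟨fun x => ζ x + g x, fun x hx => ?_,
    (h.weaken hr hα1 (fun _ _ => le_rfl) (fun _ _ _ h => h) (dom_of_le le_rfl)
      (fun h => absurd h (lt_irrefl _)) (Nat.le_succ q) le_rfl).add hg'⟩
  have h0 := (mem_cyl.1 hx).2.1.ne'
  have h1 := (hasDerivAt_id x.2).mul (hg x hx)
  refine (h1.congr_of_eventuallyEq ?_).congr_deriv ?_
  · filter_upwards [eventually_time hx] with t ht using hf ht
  · simp only [id]
    field_simp

end

/-- The number of powers of the logarithm, including the power `0`, that are allowed along with
`t^i` in the nonlinear term. Two more for each order leave room for those in a product with a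
further argument of `F`, see `logF_add`. -/
def logF (b i : ℕ) : ℕ := 2 * (i + 2 - b) + 1

/-- The number of powers of the logarithm that accompany `t^i` in the rescaled solution: there is a
resonance at order `b - 2`. -/
def logU (b i : ℕ) : ℕ := logF b i + if i + 2 = b then 1 else 0

/-- The coefficients of the rescaled solution of the sharp Hölder class: those of the orders up to
the resonant one, except for the free coefficient. -/
def ExactU (b i j : ℕ) : Prop := i + 1 < b ∧ (i, j) ≠ (b - 2, 0)

lemma logU_le (b i : ℕ) : logU b i ≤ logF b (i + 1) := by
  unfold logU logF; split_ifs <;> omega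

lemma ExactU.of_lt {b i j : ℕ} (h : i + 2 < b) : ExactU b i j :=
  ⟨by omega, fun h' => by rw [Prod.mk.injEq] at h'; omega⟩

lemma ExactU.succ {b i j : ℕ} (h : ExactU b i j) : ExactU b i (j + 1) :=
  ⟨h.1, by simp⟩

namespace Setting

variable {a : ℤ} {b ℓ : ℕ} {α : ℝ≥0} {R : ℝ} {F : Tan d × ℝ × Jet d → ℝ} {v : Tan d × ℝ → ℝ}
  {e : Bool} {m M s : ℕ}

/-- The expansion of `u = v / t²` up to order `m`. -/
def ExpU (r : ℝ) (b ℓ : ℕ) (α : ℝ≥0) (v : Tan d × ℝ → ℝ) (e : Bool) (m : ℕ) : Prop :=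
  HasExp r α (logU b) (ExactU b) e m (m + α) (m + 2) (ℓ - 2 - m) (resc v)

variable (H : Setting d a b ℓ α r R F v)
include H

lemma isGrad_resc : IsGrad r (resc v) (fun i x => dTan i v x / x.2 ^ 2) :=
  ((IsGrad.time fun t => (t ^ 2)⁻¹).mul (isGrad_dTan H.contDiffAt_one)).congr
    (fun x _ => by simp only [resc]; ring) fun i x _ => by simp only; ring

lemma isGrad_rescT : IsGrad r (rescT v) (fun i x => dTan i (dt v) x / x.2) :=
  ((IsGrad.time fun t => t⁻¹).mul (isGrad_dTan H.contDiffAt_dt_one)).congr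
    (fun x _ => by simp only [rescT]; ring) fun i x _ => by simp only; ring

lemma isGrad_grad_resc (j : Fin d) :
    IsGrad r (fun x => dTan j v x / x.2 ^ 2) (fun i x => dTan i (dTan j v) x / x.2 ^ 2) :=
  ((IsGrad.time fun t => (t ^ 2)⁻¹).mul (isGrad_dTan (H.contDiffAt_dTan_one j))).congr
    (fun x _ => by simp only; ring) fun i x _ => by simp only; ring

omit H in
/-- A lossy expansion of higher order implies a sharp one of lower order. -/
lemma hasExp_of_lt {n : ℕ → ℕ} {X : ℕ → ℕ → Prop} {q q' : ℕ} {f : Tan d × ℝ → ℝ} {e' : Bool}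
    (hr : 0 < r) (hα1 : (α : ℝ) < 1) (h : HasExp r α n X e M (M + α) q s f)
    (hm : m < M ∨ m = M ∧ e = e') (hq : q' ≤ q) : HasExp r α n X e' m (m + α) q' s f := by
  refine h.weaken hr hα1 (fun _ _ => le_rfl) (fun _ _ _ h => h) ?_ (fun _ => by linarith) hq le_rfl
  rcases hm with hm | ⟨rfl, rfl⟩
  · exact dom_of_lt (by simpa using hm)
  · exact dom_of_le le_rfl

lemma ExpU.rescT (h : ExpU r b ℓ α v e m) :
    HasExp r α (logU b) (ExactU b) e m (m + α) (m + 1) (ℓ - 2 - m) (rescT v) := by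
  have h1 := HasExp.theta_of H.hr H.coe_lt h (fun _ _ => ExactU.succ) H.isTheta_resc
  have h2 := hasExp_of_lt H.hr H.coe_lt h (Or.inr ⟨rfl, rfl⟩) (q' := m + 1) (Nat.le_succ _)
  exact (h1.add (h2.const_mul 2)).congr fun x _ => by ring

omit H in
lemma hasExp_linear {q : ℕ} {f : Tan d × ℝ → ℝ} (hr : 0 < r) (hα1 : (α : ℝ) < 1)
    (h : HasExp r α (logU b) (ExactU b) e m (m + α) q s f) (hq : m + 1 ≤ q) :
    HasExp r α (fun i => logF b (i + 1)) (fun i _ => i + 2 < b) e m (m + α) (m + 1) s f :=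
  h.weaken hr hα1 (fun i _ => logU_le b i) (fun _ _ _ h => ExactU.of_lt h) (dom_of_le le_rfl)
    (fun h => absurd h (lt_irrefl _)) hq le_rfl

omit H in
lemma hasExp_quadratic {f g : Tan d × ℝ → ℝ} (hr : 0 < r) (hb : 2 ≤ b) (hα : (0 : ℝ) < α)
    (hα1 : (α : ℝ) < 1) (he : e = true ∨ 3 ≤ b)
    (hf : HasExp r α (logU b) (ExactU b) e m (m + α) (m + 1) s f)
    (hg : HasExp r α (logU b) (ExactU b) e m (m + α) (m + 1) s g) :
    HasExp r α (fun i => logF b (i + 1)) (fun i _ => i + 2 < b) e m (m + α) (m + 1) s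
      (fun x => f x * g x) := by
  have h1 : (Dom e (m + α) e (m + α) ∧ logU b 0 ≤ 1) ∨ Dom true ((m : ℝ) + α) e (m + α) := by
    rcases he with rfl | he
    · exact Or.inr (dom_of_le le_rfl)
    · exact Or.inl ⟨dom_of_le le_rfl, by unfold logU logF; split_ifs <;> omega⟩
  refine hf.mul hr hα1 hg (fun i j a b' ha hb' _ => ?_)
    (fun i j _ _ h => ⟨ExactU.of_lt (by omega), ExactU.of_lt (by omega)⟩) (by positivity) le_rfl
    (by linarith) h1 h1
  unfold logU logF at *
  split_ifs at * <;> omega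

/-- The second tangential derivatives of `v` have expansions of one order more than those of
`v / t`. At the lowest order one uses the hypotheses on `v`. -/
lemma hasExp_hessian (hm : m < ℓ - 2) (h : ∀ m' < m, ExpU r b ℓ α v e m') (i j : Fin d) :
    HasExp r α (fun i => logF b (i + 1)) (fun i _ => i + 2 < b) e m (m + α) (m + 1)
      (ℓ - 2 - (m + 1)) (fun x => x.2 * (dTan i (dTan j v) x / x.2 ^ 2)) := by
  have hr := H.hr
  cases m with
  | zero =>
    have h1 := H.regW_div_one
    rw [show ℓ - 1 = ℓ - 2 - (0 + 1) + 1 + 1 by omega] at h1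
    have h2 : IsGrad r (fun x => dTan j v x / x.2) (fun i x => dTan i (dTan j v) x / x.2) :=
      ((IsGrad.time fun t => t⁻¹).mul (isGrad_dTan (H.contDiffAt_dTan_one j))).congr
        (fun x _ => by simp only; ring) fun i x _ => by simp only; ring
    have h3 := ((h1.gradW H.isGrad_div j).gradW h2 i).congrW
      (f := fun x => x.2 * (dTan i (dTan j v) x / x.2 ^ 2)) fun x hx => by
        have := (mem_cyl.1 hx).2.1.ne'
        field_simp
    exact HasExp.of_rem (h3.weakenW Ioo_subset_Ioc_self (by simpa using dom_false))
  | succ m =>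
    have h1 := h m (Nat.lt_succ_self m)
    unfold ExpU at h1
    rw [show ℓ - 2 - m = ℓ - 2 - (m + 1 + 1) + 1 + 1 by omega] at h1
    have h2 := (h1.grad_of hr H.coe_lt H.isGrad_resc j).grad_of hr H.coe_lt
      (H.isGrad_grad_resc j) i
    have h3 := h2.time_mul (n' := fun i => logF b (i + 1)) (X' := fun i _ => i + 2 < b) hr H.coe_lt
      (fun i _ => (logU_le b i).trans (by unfold logF; omega))
      (fun _ _ h => ExactU.of_lt (by omega))
    convert h3 using 1
    push_cast
    ring

/-- If `z` stands for any of the arguments of `F` other than `y'`, then `t ∂_t z = t h` and `h` has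
an expansion of order `m`. -/
lemma exists_theta_coord (hm : m < ℓ - 2) (h : ∀ m' ≤ m, ExpU r b ℓ α v e m')
    (hq : ∀ f ∈ ({resc v, rescT v} : Set _), ∀ g ∈ ({resc v, rescT v} : Set _),
      HasExp r α (fun i => logF b (i + 1)) (fun i _ => i + 2 < b) e m (m + α) (m + 1)
        (ℓ - 2 - (m + 1)) (fun x => f x * g x)) (i) :
    ∃ h, IsTheta r (fun x => (jetBasis d).repr (arg v x) i) (fun x => x.2 * h x) ∧
      HasExp r α (fun i => logF b (i + 1)) (fun i _ => i + 2 < b) e m (m + α) m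
        (ℓ - 2 - (m + 1)) h := by
  have hr := H.hr
  have hα1 := H.coe_lt
  have key : ∀ {f ζ : Tan d × ℝ → ℝ}, HasExp r α (fun i => logF b (i + 1)) (fun i _ => i + 2 < b)
      e m (m + α) (m + 1) (ℓ - 2 - (m + 1)) ζ → (∀ x ∈ cyl d r, f x = x.2 * ζ x) →
      ∃ h, IsTheta r f (fun x => x.2 * h x) ∧ HasExp r α (fun i => logF b (i + 1))
        (fun i _ => i + 2 < b) e m (m + α) m (ℓ - 2 - (m + 1)) h := fun hζ hf =>
    hζ.exists_theta_eq_time_mul hr hα1 (fun _ _ h => h) hf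
  have hu := h m le_rfl
  have hT := hu.rescT H
  unfold ExpU at hu
  rw [show ℓ - 2 - m = ℓ - 2 - (m + 1) + 1 by omega] at hu hT
  have hs : ℓ - 2 - (m + 1) ≤ ℓ - 2 - (m + 1) + 1 := Nat.le_succ _
  have hu0 := hu.weaken (n' := logU b) (X' := ExactU b) hr hα1 (fun _ _ => le_rfl)
    (fun _ _ _ h => h) (dom_of_le le_rfl) (fun h => absurd h (lt_irrefl _)) le_rfl hs
  have hT0 := hT.weaken (n' := logU b) (X' := ExactU b) hr hα1 (fun _ _ => le_rfl)
    (fun _ _ _ h => h) (dom_of_le le_rfl) (fun h => absurd h (lt_irrefl _)) le_rfl hs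
  have ht : ∀ x ∈ cyl d r, x.2 ≠ 0 := fun x hx => (mem_cyl.1 hx).2.1.ne'
  refine forall_coord (fun f => ∃ h, IsTheta r f (fun x => x.2 * h x) ∧ HasExp r α
      (fun i => logF b (i + 1)) (fun i _ => i + 2 < b) e m (m + α) m (ℓ - 2 - (m + 1)) h)
    (key (ζ := fun _ => 1) ?_ fun x _ => by ring)
    (key (hasExp_linear hr hα1 hT0 le_rfl) fun x hx => (eq_resc hx).1)
    (key (hasExp_linear hr hα1 hu0 (by omega)) fun x hx => (eq_resc hx).2.1)
    (key (hq _ (by simp) _ (by simp)) fun x hx => (eq_resc hx).2.2.1)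
    (key (hq _ (by simp) _ (by simp)) fun x hx => (eq_resc hx).2.2.2.1)
    (key (hq _ (by simp) _ (by simp)) fun x hx => (eq_resc hx).2.2.2.2)
    (fun i => key (hasExp_linear hr hα1 (hT.grad_of hr hα1 H.isGrad_rescT i) le_rfl) fun x hx => ?_)
    (fun i j => key (H.hasExp_hessian hm (fun m' h' => h m' h'.le) i j) fun x hx => ?_)
    (fun i => key (hasExp_linear hr hα1 (hu.grad_of hr hα1 H.isGrad_resc i) (by omega))
      fun x hx => ?_) i
  · have h1 : RegC r (Ioc 0 (α : ℝ)) (ℓ - 2 - (m + 1)) (fun _ : Tan d => (1 : ℝ)) := fun q => by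
      simpa using Reg.powW (d := d) (r := r) (m := q) (e := false) hr (Ioc_sub hα1) 0
    have h2 := HasExp.of_term (n := fun i => logF b (i + 1)) (X := fun i _ => i + 2 < b) (e := e)
      (q := m + 1) (γ := m + α) (m := m) (i := 0) (j := 0) hr hα1
      (h1.weaken Ioo_subset_Ioc_self le_rfl) (fun _ => ⟨by unfold logF; omega, fun _ => h1⟩)
      (fun h => by omega)
    simpa using h2
  · have := ht x hx; field_simp
  · have := ht x hx; field_simp
  · have := ht x hx; field_simp

omit H in
lemma logF_add {b i j p q : ℕ} (hb : 2 ≤ b) (hp : p < logF b i) (hq : q < logF b (j + 1)) :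
    p + q < logF b (i + j + 1) := by
  unfold logF at *; omega

/-- From expansions of `u` of orders below `M` to expansions of order `M` of the nonlinear term. -/
lemma hasExp_comp (hM : M ≤ ℓ - 2) (he : e = true ∨ 3 ≤ b) (h : ∀ m < M, ExpU r b ℓ α v e m)
    {F' : Tan d × ℝ × Jet d → ℝ} (hF : CFz R (Ico 0 R ×ˢ (univ : Set (Jet d)))
      (CompBase r α (arg v)) M (ℓ - 2 - M) F') :
    HasExp r α (logF b) (fun i _ => i + 1 < b) e M (M + α) M (ℓ - 2 - M)
      (fun x => F' (x.1, arg v x)) := by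
  have hr := H.hr
  have hα1 := H.coe_lt
  have hb := H.hb
  have hz : ∀ i, Reg r (W r (Ioo 0 (α : ℝ)) false α) 0 (ℓ - 2 - M)
      (fun x => (jetBasis d).repr (arg v x) i) := fun i =>
    ((H.coord_regW i).weakenW Ioo_subset_Ioc_self (dom_of_le le_rfl)).mono le_rfl (Nat.sub_le _ _)
  have hn0 : logF b 0 = 1 := by unfold logF; omega
  cases M with
  | zero =>
    exact comp_hasExp_zero (jetBasis d) H.hR.le H.coe_pos hα1 hr
      (fun _ => H.arg_mem) H.zero_mem hz hn0 hF.toCY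
  | succ m =>
    have hq : ∀ f ∈ ({resc v, rescT v} : Set _), HasExp r α (logU b) (ExactU b) e m (m + α) (m + 1)
        (ℓ - 2 - (m + 1)) f := by
      have hs : ℓ - 2 - (m + 1) ≤ ℓ - 2 - m := by omega
      rintro f (rfl | rfl)
      · exact (h m (Nat.lt_succ_self m)).weaken hr hα1 (fun _ _ => le_rfl)
          (fun _ _ _ h => h) (dom_of_le le_rfl) (fun h => absurd h (lt_irrefl _)) (by omega) hs
      · exact ((h m (Nat.lt_succ_self m)).rescT H).weaken hr hα1 (fun _ _ => le_rfl)
          (fun _ _ _ h => h) (dom_of_le le_rfl) (fun h => absurd h (lt_irrefl _)) le_rfl hs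
    choose h' hh hh' using H.exists_theta_coord (by omega) (fun m' hm' => h m' (by omega))
      fun f hf g hg => hasExp_quadratic hr hb H.coe_pos hα1 he (hq f hf) (hq g hg)
    exact comp_hasExp (jetBasis d) (n' := fun i => logF b (i + 1)) (X' := fun i _ => i + 2 < b)
      H.hR.le H.coe_pos hα1 hr (fun _ => H.arg_mem) H.zero_mem hz hh hn0
      (fun i j p q hp hq => logF_add hb hp hq) (fun i j _ _ h => ⟨by omega, by omega⟩)
      (fun _ => le_rfl) (fun i _ _ h => by omega)
      (he.imp_right fun he => by unfold logF; omega)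
      (fun i m' hm' => hasExp_of_lt hr hα1 (hh' i)
        (by rcases (Nat.lt_succ_iff.1 hm').lt_or_eq with h | h <;> simp [h]) (by omega))
      (m + 1) le_rfl F' hF

/-- The two first order equations turn an expansion of the nonlinear term into one of `u`. -/
lemma expU_of_hasExp (h : HasExp r α (logF b) (fun i _ => i + 1 < b) e M (M + α) M (ℓ - 2 - M)
      (fun x => F (x.1, arg v x))) : ExpU r b ℓ α v e M := by
  have hr := H.hr
  have hα1 := H.coe_lt
  have h1 := (h.const_mul (-1)).solve_pos hr H.coe_pos hα1 (fun _ _ _ h => h) H.two_sub_pos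
    (by linarith [Nat.cast_nonneg (α := ℝ) M]) H.isTheta_first fun _ => H.tendsto_first
  have hb := H.hb
  exact h1.solve_nonpos hr H.coe_pos hα1 (b - 2) (n' := logU b)
    (fun i _ => by unfold logU; omega)
    (by unfold logU; rw [if_pos (by omega)]; omega) (fun _ _ _ h => h) H.isTheta_second
    ((H.resc_slice Ioo_subset_Ioc_self).weaken Subset.rfl (by omega))

/-- The expansion of the rescaled solution by induction on the order, with lossy weights if
`b = 2`. -/
lemma expU (he : e = true ∨ 3 ≤ b) (hM : M ≤ ℓ - 2) : ExpU r b ℓ α v e M := by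
  induction M using Nat.strong_induction_on with
  | _ M ih =>
  exact H.expU_of_hasExp (H.hasExp_comp hM he (fun m hm => ih m hm (by omega))
    (H.cfz (Or.inr (by omega)) (by omega)))

/-- If `b = 2`, there is a logarithm in the leading term of `u`. Quadratic terms then lose the exact
weight; it is recovered from the lossy expansion of one order more. -/
lemma expU_of_eq_two (hb2 : b = 2) (hM : M ≤ ℓ - 2) : ExpU r b ℓ α v false M := by
  have hr := H.hr
  have hα1 := H.coe_lt
  have hb := H.hb
  induction M using Nat.strong_induction_on with
  | _ M ih =>
  refine H.expU_of_hasExp ?_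
  have hz : ∀ i, Reg r (W r (Ioo 0 (α : ℝ)) false α) 0 (ℓ - 2 - M)
      (fun x => (jetBasis d).repr (arg v x) i) := fun i =>
    ((H.coord_regW i).weakenW Ioo_subset_Ioc_self (dom_of_le le_rfl)).mono le_rfl (Nat.sub_le _ _)
  have hn0 : logF b 0 = 1 := by unfold logF; omega
  cases M with
  | zero =>
    exact comp_hasExp_zero (jetBasis d) H.hR.le H.coe_pos hα1 hr
      (fun _ => H.arg_mem) H.zero_mem hz hn0
      (H.cfz (m := 0) (Or.inl hb2) (Nat.sub_le _ _)).toCY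
  | succ m =>
    have hw := H.expU (e := true) (M := m + 1) (Or.inl rfl) hM
    have hq : ∀ f ∈ ({resc v, rescT v} : Set _), HasExp r α (logU b) (ExactU b) true (m + 1)
        ((m + 1 : ℕ) + α) (m + 1 + 1) (ℓ - 2 - (m + 1)) f := by
      rintro f (rfl | rfl)
      · exact hasExp_of_lt hr hα1 hw (Or.inr ⟨rfl, rfl⟩) (by omega)
      · exact hw.rescT H
    choose h' hh hh' using H.exists_theta_coord (by omega)
      (fun m' hm' => ih m' (by omega) (by omega)) fun f hf g hg => hasExp_of_lt hr hα1
        (hasExp_quadratic hr hb H.coe_pos hα1 (Or.inl rfl) (hq f hf) (hq g hg))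
        (Or.inl (Nat.lt_succ_self m)) (by omega)
    exact comp_hasExp_sharp (jetBasis d) (n' := fun i => logF b (i + 1))
      (X' := fun i _ => i + 2 < b)
      H.hR.le H.coe_pos hα1 hr (fun _ => H.arg_mem) H.zero_mem hz hh hn0
      (fun i j p q hp hq => logF_add hb hp hq) (fun i j _ _ h => ⟨by omega, by omega⟩)
      (fun _ => le_rfl) (fun i _ _ h => by omega) hh'
      (fun F' hF' => H.hasExp_comp hM (Or.inl rfl)
        (fun m' _ => H.expU (Or.inl rfl) (by omega)) hF')
      (H.cfz (Or.inl hb2) (Nat.sub_le _ _))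

/-- The expansion of the rescaled solution, with sharp weights. -/
lemma expU_sharp (hM : M ≤ ℓ - 2) : ExpU r b ℓ α v false M := by
  rcases H.hb.eq_or_lt with h | h
  · exact H.expU_of_eq_two h.symm hM
  · exact H.expU (Or.inr h) hM

end Setting

/-! ### The remainder as an iterated integral -/

section

variable {S : Set ℝ} {e : Bool} {m s : ℕ} {γ : ℝ} {f : Tan d × ℝ → ℝ}

lemma Reg.invW (hS : S ⊆ Ioc 0 1) :
    Reg r (W r S false (-1)) m s (fun x : Tan d × ℝ => x.2⁻¹) := by
  have hθ : ∀ c : ℝ, IsTheta r (fun x : Tan d × ℝ => c * x.2⁻¹) (fun x => -c * x.2⁻¹) :=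
    fun c x hx => by
      have h0 := (mem_cyl.1 hx).2.1.ne'
      refine ((hasDerivAt_inv h0).const_mul c).congr_deriv ?_
      field_simp
  refine Reg.of_family (fun _ _ f => ∃ c : ℝ, f = fun x => c * x.2⁻¹) ?_ ?_ ?_ _ _ _
    ⟨1, by simp⟩
  · rintro _ _ _ ⟨c, rfl⟩
    have hb : ∀ c : ℝ, ∀ η ∈ loss false, ∃ C, 0 ≤ C ∧ ∀ x ∈ cyl d r,
        |c * x.2⁻¹| ≤ C * x.2 ^ (-1 - η) := by
      intro c η hη
      rw [mem_loss_false.1 hη]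
      refine ⟨|c|, abs_nonneg c, fun x hx => ?_⟩
      have h0 := (mem_cyl.1 hx).2.1
      rw [sub_zero, Real.rpow_neg_one, abs_mul, abs_of_pos (inv_pos.2 h0)]
    exact W.of_theta hS (hθ c) (hb c) (hb (-c)) fun ε hε η hη => ⟨0, le_rfl, by simp⟩
  · rintro _ _ _ ⟨c, rfl⟩
    exact ⟨_, hθ c, -c, rfl⟩
  · rintro _ _ _ ⟨c, rfl⟩
    exact ⟨_, IsGrad.time fun t => c * t⁻¹, fun _ => ⟨0, by simp⟩⟩

lemma Reg.exists_hasDerivAt (hS : S ⊆ Ioc 0 1)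
    (h : Reg r (W r S e (γ + 1)) (m + 1) s f) :
    ∃ g, (∀ x ∈ cyl d r, HasDerivAt (fun t => f (x.1, t)) (g x) x.2) ∧
      Reg r (W r S e γ) m s g := by
  obtain ⟨g, hg, hg'⟩ := h.theta
  refine ⟨fun x => x.2⁻¹ * g x, fun x hx => (hg x hx).congr_deriv (by ring), ?_⟩
  have h1 := (Reg.invW (m := m) (s := s) hS).mulW hg'
  rwa [Bool.false_or, neg_add_cancel_comm_assoc] at h1

lemma W.integral_eq (h : W r S false γ f) (hγ : 0 < γ) {γ' : ℝ} {g : Tan d × ℝ → ℝ}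
    (hg : ∀ x ∈ cyl d r, HasDerivAt (fun t => f (x.1, t)) (g x) x.2) (hg' : W r S false γ' g)
    (hγ' : 0 ≤ γ') {y : Tan d} (hy : y ∈ tanBall d r) {t : ℝ} (ht : t ∈ Ioo 0 r) :
    ∫ s in (0 : ℝ)..t, g (y, s) = f (y, t) := by
  have hsub : Ioo 0 t ⊆ Ioo 0 r := Ioo_subset_Ioo_right ht.2.le
  have hint : IntervalIntegrable (fun s => g (y, s)) volume 0 t := by
    rw [intervalIntegrable_iff_integrableOn_Ioo_of_le ht.1.le]
    obtain ⟨C, h0, hC⟩ := (hg'.weaken (S' := S) (e' := false) (γ' := 0) Subset.rfl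
      (dom_of_le hγ')).bd 0 (mem_loss_false.2 rfl)
    refine Integrable.of_bound (((hg'.cont y hy).mono hsub).aestronglyMeasurable
      measurableSet_Ioo) C ?_
    filter_upwards [ae_restrict_mem measurableSet_Ioo] with s hs
    simpa using hC (y, s) (mk_mem_cyl.2 ⟨hy, hsub hs⟩)
  have hlim : Tendsto (fun s => f (y, s)) (𝓝[>] 0) (𝓝 0) := by
    have := h.tendsto (μ := 0) (by linarith) hy
    rw [nhdsWithin_Ioo_eq_nhdsGT (ht.1.trans ht.2)] at this
    simpa using this
  have hlim' : Tendsto (fun s => f (y, s)) (𝓝[<] t) (𝓝 (f (y, t))) :=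
    ((hg (y, t) (mk_mem_cyl.2 ⟨hy, ht⟩)).continuousAt.tendsto).mono_left nhdsWithin_le_nhds
  rw [intervalIntegral.integral_eq_sub_of_hasDerivAt_of_tendsto ht.1
    (fun s hs => hg (y, s) (mk_mem_cyl.2 ⟨hy, hsub hs⟩)) hint hlim hlim', sub_zero]

/-- A function of weight `k + γ` with `k` derivatives in `t` is the `k`-fold integral of its
`k`-th derivative. -/
lemma Reg.exists_iterIntegral (hS : S ⊆ Ioc 0 1) (hγ : 0 < γ) {k : ℕ}
    (h : Reg r (W r S false (γ + k)) k s f) :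
    ∃ w, Reg r (W r S false γ) 0 s w ∧ ∀ y ∈ tanBall d r, ∀ t ∈ Ioo 0 r,
      f (y, t) = iterIntegral (fun s => w (y, s)) k t := by
  induction k generalizing f with
  | zero => exact ⟨f, by simpa using h, fun y _ t _ => rfl⟩
  | succ k ih =>
    rw [Nat.cast_succ, ← add_assoc] at h
    obtain ⟨g, hg, hg'⟩ := h.exists_hasDerivAt hS
    obtain ⟨w, hw, hw'⟩ := ih hg'
    refine ⟨w, hw, fun y hy t ht => ?_⟩
    rw [iterIntegral, ← h.base.integral_eq (by positivity) hg hg'.base (by positivity) hy ht]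
    refine intervalIntegral.integral_congr_ae (Eventually.of_forall fun s hs => ?_)
    rw [uIoc_of_le ht.1.le] at hs
    exact hw' y hy s ⟨hs.1, hs.2.trans_lt ht.2⟩

end

/-! ### The expansion of the solution -/

namespace Setting

variable {a : ℤ} {b ℓ : ℕ} {α : ℝ≥0} {R : ℝ} {F : Tan d × ℝ × Jet d → ℝ} {v : Tan d × ℝ → ℝ}

/-- The expansion of `u = v / t²` of the highest order. The coefficient of `t^i` has `ℓ - 2 - i`
derivatives, as one sees from the expansion of order `i`. -/
lemma exists_expansion (H : Setting d a b ℓ α r R F v) {m : ℕ} (hm : m ≤ ℓ - 2) :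
    ∃ (c : ℕ → ℕ → Tan d → ℝ) (Q : Tan d × ℝ → ℝ),
      (∀ x ∈ cyl d r, resc v x = polyLog (logU b) m c x + Q x) ∧
      (∀ i ≤ m, ∀ j < logU b i, RegC r (Ioo 0 (α : ℝ)) (ℓ - 2 - i) (c i j)) ∧
      (∀ i ≤ m, ∀ j < logU b i, ExactU b i j → RegC r (Ioc 0 (α : ℝ)) (ℓ - 2 - i) (c i j)) ∧
      Reg r (W r (Ioo 0 (α : ℝ)) false (m + α)) (m + 2) (ℓ - 2 - m) Q := by
  obtain ⟨c, Q, h⟩ := H.expU_sharp hm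
  have hα := H.coe_pos
  have key : ∀ i ≤ m, ∃ c' : ℕ → ℕ → Tan d → ℝ, (∀ j, RegC r (Ioo 0 (α : ℝ)) (ℓ - 2 - i) (c' i j)) ∧
      (∀ j, ExactU b i j → RegC r (Ioc 0 (α : ℝ)) (ℓ - 2 - i) (c' i j)) ∧
      ∀ j < logU b i, EqOn (c i j) (c' i j) (tanBall d r) := by
    intro i hi
    obtain ⟨c', Q', h'⟩ := H.expU_sharp (hi.trans hm)
    obtain ⟨Q'', h''⟩ := h.trunc H.hr H.coe_lt hi (e' := false) (γ' := i + α)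
      (dom_of_le (by simpa using hi)) (by linarith [H.coe_lt])
    exact ⟨c', h'.coeff i, h'.exact_coeff i, fun j hj =>
      h''.coeff_unique H.hr h' (by linarith) (by linarith) le_rfl hj⟩
  refine ⟨c, Q, h.eq, fun i hi j hj => ?_, fun i hi j hj hX => ?_, h.rem⟩
  · obtain ⟨c', h1, -, h3⟩ := key i hi
    exact (h1 j).congr (h3 j hj)
  · obtain ⟨c', -, h2, h3⟩ := key i hi
    exact (h2 j hX).congr (h3 j hj)

end Setting

/-- The terms of the expansion of `t² u`, sorted by their powers of `t`. -/
lemma sq_mul_polyLog {b k : ℕ} (hb : 2 ≤ b) (hk : b ≤ k) (c : ℕ → ℕ → Tan d → ℝ)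
    (x : Tan d × ℝ) :
    x.2 ^ 2 * polyLog (logU b) (k - 2) c x =
      ∑ i ∈ Finset.Ico 2 b, c (i - 2) 0 x.1 * x.2 ^ i +
      ∑ i ∈ Finset.Icc b k, ∑ j ∈ Finset.range (logU b (i - 2)),
        c (i - 2) j x.1 * x.2 ^ i * Real.log x.2 ^ j := by
  have h1 : x.2 ^ 2 * polyLog (logU b) (k - 2) c x = ∑ i ∈ Finset.Ico 2 (k + 1),
      ∑ j ∈ Finset.range (logU b (i - 2)), c (i - 2) j x.1 * x.2 ^ i * Real.log x.2 ^ j := by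
    rw [Finset.sum_Ico_eq_sum_range, polyLog, Finset.mul_sum, show k + 1 - 2 = k - 2 + 1 by omega]
    refine Finset.sum_congr rfl fun i _ => ?_
    rw [Finset.mul_sum, show 2 + i - 2 = i by omega]
    exact Finset.sum_congr rfl fun j _ => by ring
  rw [h1, ← Finset.sum_Ico_consecutive _ hb (by omega : b ≤ k + 1)]
  congr 1
  refine Finset.sum_congr rfl fun i hi => ?_
  rw [Finset.mem_Ico] at hi
  rw [show logU b (i - 2) = 1 by unfold logU logF; rw [if_neg (by omega)]; omega]
  simp

end SingularExpansion

open SingularExpansion in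
theorem mainTheorem2 (mlo : ℤ) (mhi : ℕ) (hlo : mlo ≤ 0) (hhi : 2 ≤ mhi) :
    ∃ N : ℕ → ℕ, N mhi = 1 ∧
      ∀ (d : ℕ) (p q : ℝ), p = 1 - ((mlo : ℝ) + (mhi : ℝ)) → q = (mlo : ℝ) * (mhi : ℝ) →
      ∀ (ℓ k : ℕ), mhi ≤ k → k ≤ ℓ →
      ∀ α : ℝ≥0, 0 < α → α < 1 →
      ∀ (r R : ℝ), 0 < r → r < R →
      ∀ F : Tan d × ℝ × Jet d → ℝ,
        IsLocCHolder (ℓ - 2) α F (argSet d R) →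
        (mhi = 2 → IsSmoothExceptTan (ℓ - 2) α F R) →
      ∀ v : Tan d × ℝ → ℝ,
        ContDiffOn ℝ 1 v (closure (cyl d R)) →
        IsLocCHolder ℓ α v (cyl d R) →
        IsSolution p q F R v →
        TangentialRegularity ℓ α r v →
      ∃ (c : ℕ → Tan d → ℝ) (cl : ℕ → ℕ → Tan d → ℝ) (w : Tan d × ℝ → ℝ),
        -- the expansion
        (∀ y ∈ tanBall d r, ∀ t ∈ Set.Ioo 0 r,
          v (y, t) = ∑ i ∈ Finset.Ico 2 mhi, c i y * t ^ i
            + ∑ i ∈ Finset.Icc mhi k, ∑ j ∈ Finset.range (N i + 1),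
                cl i j y * t ^ i * Real.log t ^ j
            + iterIntegral (fun s => w (y, s)) k t) ∧
        -- regularity of the coefficients
        (∀ i ∈ Finset.Ico 2 mhi, IsCHolder (ℓ - i) α (c i) (tanBall d r)) ∧
        IsCHolder (ℓ - mhi) α (cl mhi 1) (tanBall d r) ∧
        (∀ ε : ℝ≥0, 0 < ε → ε < α →
          IsCHolder (ℓ - mhi) ε (cl mhi 0) (tanBall d r) ∧
          ∀ i ∈ Finset.Ioc mhi k, ∀ j ≤ N i, IsCHolder (ℓ - i) ε (cl i j) (tanBall d r)) ∧
        -- regularity and decay of the remainder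
        (∀ t ∈ Set.Ioo 0 r, ContDiffOn ℝ (ℓ - k : ℕ) (fun z => w (z, t)) (tanBall d r)) ∧
        (∀ τ ≤ ℓ - k, ∀ ε : ℝ≥0, 0 < ε → ε < α → IsHolder ε (dTanIter τ w) (cyl d r)) ∧
        (∀ τ ≤ ℓ - k, ∃ C : ℝ, ∀ x ∈ cyl d r, ‖dTanIter τ w x‖ ≤ C * x.2 ^ (α : ℝ)) := by
  have hN : ∀ i, mhi ≤ i → logU mhi (i - 2) - 1 + 1 = logU mhi (i - 2) := fun i hi => by
    unfold logU logF; omega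
  have hb1 : logU mhi (mhi - 2) = 2 := by
    unfold logU logF; rw [if_pos (by omega)]; omega
  refine ⟨fun i => logU mhi (i - 2) - 1, by simp only [hb1], ?_⟩
  rintro d p q rfl rfl ℓ k hk hkℓ α hα hα1 r R hr hR F hF hF2 v - hv hsol htan
  have H : Setting d mlo mhi ℓ α r R F v :=
    ⟨hlo, hhi, hk.trans hkℓ, hα, hα1, hr, hR, hF, hF2, hv, hsol, htan⟩
  have hIoo := Ioo_sub H.coe_lt
  have hIoc := Ioc_sub H.coe_lt
  have hαS : (α : ℝ) ∈ Ioc 0 (α : ℝ) := ⟨H.coe_pos, le_rfl⟩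
  obtain ⟨c, Q, h1, h2, h3, h4⟩ := H.exists_expansion (m := k - 2) (by omega)
  -- in terms of the powers of `t` in the expansion of `v`
  have h2' : ∀ i, 2 ≤ i → i ≤ k → ∀ j < logU mhi (i - 2), ∀ ε : ℝ≥0, 0 < ε → ε < α →
      IsCHolder (ℓ - i) ε (c (i - 2) j) (tanBall d r) := by
    intro i hi hik j hj ε h0 hε
    have := h2 (i - 2) (by omega) j hj
    rw [show ℓ - 2 - (i - 2) = ℓ - i by omega] at this
    exact this.isCHolder hr hIoo ⟨NNReal.coe_pos.2 h0, NNReal.coe_lt_coe.2 hε⟩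
  have h3' : ∀ i, 2 ≤ i → i ≤ k → ∀ j < logU mhi (i - 2), ExactU mhi (i - 2) j →
      IsCHolder (ℓ - i) α (c (i - 2) j) (tanBall d r) := by
    intro i hi hik j hj hX
    have := h3 (i - 2) (by omega) j hj hX
    rw [show ℓ - 2 - (i - 2) = ℓ - i by omega] at this
    exact this.isCHolder hr hIoc hαS
  have h5 : Reg r (W r (Ioo 0 (α : ℝ)) false (α + k)) k (ℓ - k) (fun x => x.2 ^ 2 * Q x) := by
    have h6 := (Reg.powW (d := d) (e := false) (m := k) (s := ℓ - k) hr hIoo 2).mulW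
      (h4.mono (m' := k) (s' := ℓ - k) (by omega) (by omega))
    refine h6.weakenW Subset.rfl (dom_of_le (le_of_eq ?_))
    rw [Nat.cast_sub (hhi.trans hk)]
    push_cast
    ring
  obtain ⟨w, hw, hw'⟩ := h5.exists_iterIntegral hIoo H.coe_pos
  refine ⟨fun i => c (i - 2) 0, fun i => c (i - 2), w, fun y hy t ht => ?_, fun i hi => ?_,
    h3' mhi hhi hk 1 (by omega) ⟨by omega, by simp⟩, fun ε h0 hε =>
    ⟨h2' mhi hhi hk 0 (by omega) ε h0 hε, fun i hi j hj => ?_⟩, fun t ht => ?_,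
    fun τ hτ ε h0 hε => ?_, fun τ hτ => norm_dTanIter_le hw hτ⟩
  · rw [← hw' y hy t ht]
    have ht0 := ht.1.ne'
    have h6 : v (y, t) = t ^ 2 * resc v (y, t) := by simp only [resc]; field_simp
    rw [h6, h1 (y, t) (mk_mem_cyl.2 ⟨hy, ht⟩), mul_add, sq_mul_polyLog (x := (y, t)) hhi hk]
    congr 2
    refine Finset.sum_congr rfl fun i hi => ?_
    simp only [hN i (Finset.mem_Icc.1 hi).1]
  · rw [Finset.mem_Ico] at hi
    refine h3' i hi.1 (by omega) 0 (by unfold logU logF; omega) ⟨by omega, ?_⟩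
    simp only [ne_eq, Prod.mk.injEq, and_true]
    omega
  · rw [Finset.mem_Ioc] at hi
    have := hN i hi.1.le
    change j ≤ logU mhi (i - 2) - 1 at hj
    exact h2' i (by omega) hi.2 j (by omega) ε h0 hε
  · exact hw.contDiffOn_slice (fun f hf t ht => hf.continuousOn_slice hIoo
      (nonempty_Ioo.2 H.coe_pos) ht) ht
  · exact dTanIter_isHolder (fun f hf => hf.isHolder
      ⟨NNReal.coe_pos.2 h0, NNReal.coe_lt_coe.2 hε⟩ h0 (NNReal.coe_le_coe.2 hε.le)) hw hτ
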